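/- Let $p$ be a prime, $K/\mathbb{Q}_p$ a finite extension with ring of integers $\mathcal{O}_K$, residue field of size $p^f$, a fixed uniformizer $\pi$, normalized valuation $v_K$ ($v_K(\pi)=1$) and $|x|_K=p^{-fv_K(x)}$, $|0|_K=0$. Let $dx$ be the Haar measure on $K$ giving $\mathcal{O}_K$ volume $1$. For an integer $m\ge 1$ let $E=\bigcup_{s=0}^{m-1}\pi^s\mathcal{O}_K^\times$ (a fundamental domain of the Tate curve $K^\times/\pi^{m\mathbb{Z}}$), $V=\int_E dx/|x|_K$, and $$D\phi(x)=\int_E\frac{\phi(z)-\phi(x)}{|z-x|_K^2}\,|x|_K\,dz\qquad(x\in E).$$ For functions of two variables $D$ acts on the first one. For $x,y\in E$ put $$d(x,y)=\frac{|x-y|_K}{\max\{|x|_K,|y|_K\}},\qquad U_K(y)=p^{-fv_K(y)}+p^{-f(m-1-v_K(y))},$$ $$\Lambda_q=1+p^{-f}-p^{-f(q+1)}-p^{-f(m-q)}.$$ A symmetric Green's function is a function $G(x,y)$ on $\{(x,y)\in E\times E: x\neq y\}$ with $G(x,y)=G(y,x)$ such that for each $y\in E$ the function $G(\cdot,y)$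 is continuous on $E\setminus\{y\}$, integrable on $E$ for $dx/|x|_K$, and satisfies $DG(\cdot,y)=\delta_y-\frac1V$ as a distribution, i.e. $\int_E G(x,y)\,D\phi(x)\frac{dx}{|x|_K}=\phi(y)-\frac1V\int_E\phi(x)\frac{dx}{|x|_K}$ for all locally constant $\phi:E\to\mathbb{R}$. Then the following hold. 1. Let $\lambda_0\in\mathbb{R}$, let $A,\lambda_n:E\to\mathbb{R}$ ($n\ge1$) be functions with $\sum_{n\ge1}|\lambda_n(y)|<\infty$ for all $y\in E$, and put $F(x,y)=A(y)+\lambda_0\log_{p^f}d(x,y)+\sum_{n\ge1}\lambda_n(y)d(x,y)^n$. Then $DF(x,y)$, for $x\ne y$ in $E$, depends only on $v_K(x)$ and $v_K(y)$ if and only if, for all $y\in E$ and $n\ge1$, $$\lambda_n(y)=U_K(y)^n\,\frac{p^{f(n+1)}-1}{(p^f-1)(p^f+1)^n(p^{fn}-1)}\,\lambda_0.$$ 2. For every $\lambda_0\in\mathbb{R}$, let $\lambda_n$ be given by the formula in 1. Then $\sum_{n\ge 1}|\lambda_n(y)|<\infty$. Let $$B_{K,m}(x,y)=-\sum_{n\ge1}\lambda_n(y)+\lambda_0\log_{p^f}d(x,y)+\sum_{n\ge1}\lambda_n(y)d(x,y)^n.$$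 For all $x\neq y$ in $E$ the integral defining $DB_{K,m}(x,y)$ converges absolutely and $$DB_{K,m}(x,y)=-\lambda_0\,\frac{p^{-f|v_K(x)-v_K(y)|}}{p^f-1}\,\frac{p^f+1}{p^f+1-U_K(y)}.$$ 3. For $\lambda_0\in\mathbb{R}$ there is a real array $C=(C(q,r))_{0\le q,r\le m-1}$ with $D\big(B_{K,m}+C(v_K(\cdot),v_K(\cdot))\big)(x,y)=-\frac1V$ for all $x\ne y$ in $E$ if and only if $$\lambda_0=\frac{p^f(p^f-1)}{p^f+1}.$$ 4. Fix this value of $\lambda_0$. A real array $C=(C(q,r))_{0\le q,r\le m-1}$ is symmetric and satisfies the equation in 3 for all $x\neq y$ in $E$ if and only if $$C(q,r)=\begin{cases}C(m-1,0)-\dfrac{p^f}{m\Lambda_{m-2}}&q=m-2\ge 0,\ r=0\\[8pt]\dfrac{\Lambda_q+\Lambda_{q+2}}{\Lambda_q}C(q+1,0)-\dfrac{\Lambda_{q+2}}{\Lambda_q}C(q+2,0)-\dfrac{p^f-1}{m\Lambda_q}&0\le q<m-2,\ r=0\\[8pt]C(q,0)+C(m-1-r,0)-C(m-1,0)&q\ge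 r\\C(m-1-q,0)+C(r,0)-C(m-1,0)&q\le r\end{cases}$$ (all lines holding wherever they apply). Moreover $C(m-1,0)$ is arbitrary: for every $c\in\mathbb{R}$ there is such an array with $C(m-1,0)=c$. 5. With the value of $\lambda_0$ from 3, a function $G$ on $\{(x,y)\in E\times E:x\ne y\}$ is a symmetric Green's function if and only if $$G(x,y)=B_{K,m}(x,y)+C(v_K(x),v_K(y))\qquad(x\neq y)$$ for some array $C$ as in 4. -/

import Mathlib

open MeasureTheory

noncomputable section

namespace TateGreen

/-- A normed field extension of `ℚ_[p]` is nonarchimedean. -/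
theorem isUltrametricDist (p : ℕ) [Fact p.Prime] (K : Type*) [NormedField K]
    [NormedAlgebra ℚ_[p] K] : IsUltrametricDist K := by
  apply IsUltrametricDist.isUltrametricDist_of_forall_norm_natCast_le_one
  intro n
  have h : ((n : ℕ) : K) = algebraMap ℚ_[p] K (n : ℚ_[p]) := by simp
  rw [h, norm_algebraMap']
  simpa using Padic.norm_int_le_one (p := p) (n : ℤ)

/-- The ring of integers `𝒪_K = {x | ‖x‖ ≤ 1}` of a normed extension `K` of `ℚ_[p]`. -/
def ringOfIntegers (p : ℕ) [Fact p.Prime] (K : Type*) [NormedField K] [NormedAlgebra ℚ_[p] K] :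
    ValuationSubring K :=
  haveI := isUltrametricDist p K
  (NormedField.valuation (K := K)).valuationSubring

theorem mem_ringOfIntegers (p : ℕ) [Fact p.Prime] (K : Type*) [NormedField K]
    [NormedAlgebra ℚ_[p] K] (x : K) : x ∈ ringOfIntegers p K ↔ ‖x‖ ≤ 1 := by
  have := isUltrametricDist p K
  exact (Valuation.mem_valuationSubring_iff _ _)

section Curve

variable {K : Type*} [NormedField K]

open Classical in
/-- The normalized valuation `v_K` with respect to a uniformizer `π`: the integer `k` such that
`x = π ^ k * u` with `‖u‖ = 1` (and the value `0` at `x = 0`). -/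
def valK (π x : K) : ℤ :=
  if h : ∃ k : ℤ, ‖x‖ = ‖π‖ ^ k then h.choose else 0

open Classical in
/-- The normalized absolute value `|x|_K = p ^ (-f * v_K x)`, `|0|_K = 0`. -/
def absK (p f : ℕ) (π x : K) : ℝ :=
  if x = 0 then 0 else (p : ℝ) ^ (-((f : ℤ) * valK π x))

/-- The fundamental domain `E = ⋃_{s < m} π ^ s 𝒪_K^×` of the Tate curve `K^× / π^{mℤ}`. -/
def domainE (p : ℕ) [Fact p.Prime] [NormedAlgebra ℚ_[p] K] (π : K) (m : ℕ) : Set K :=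
  {x | ∃ s : ℕ, s < m ∧ ∃ u : (ringOfIntegers p K)ˣ, x = π ^ s * ((u : ringOfIntegers p K) : K)}

/-- `d(x,y) = |x - y|_K / max {|x|_K, |y|_K}`. -/
def dist01 (p f : ℕ) (π x y : K) : ℝ :=
  absK p f π (x - y) / max (absK p f π x) (absK p f π y)

/-- `U_K(y) = p^{-f v_K(y)} + p^{-f (m - 1 - v_K(y))}`. -/
def UK (p f : ℕ) (π : K) (m : ℕ) (y : K) : ℝ :=
  (p : ℝ) ^ (-((f : ℤ) * valK π y)) + (p : ℝ) ^ (-((f : ℤ) * ((m : ℤ) - 1 - valK π y)))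

/-- The coefficient `λ_n(y)`, `n ≥ 1`, attached to the constant `λ₀ = lam0`. -/
def lambdaK (p f : ℕ) (π : K) (m : ℕ) (lam0 : ℝ) (n : ℕ) (y : K) : ℝ :=
  UK p f π m y ^ n *
    (((p : ℝ) ^ (f * (n + 1)) - 1) /
      (((p : ℝ) ^ f - 1) * ((p : ℝ) ^ f + 1) ^ n * ((p : ℝ) ^ (f * n) - 1))) * lam0

/-- `A(y) + λ₀ log_{p^f} d(x,y) + ∑_{n ≥ 1} λ_n(y) d(x,y)^n`. -/
def logSeries (p f : ℕ) (π : K) (lam0 : ℝ) (A : K → ℝ) (lam : ℕ → K → ℝ) (x y : K) : ℝ :=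
  A y + lam0 * Real.logb ((p : ℝ) ^ f) (dist01 p f π x y) +
    ∑' n : ℕ, lam (n + 1) y * dist01 p f π x y ^ (n + 1)

/-- `B_{K,m}` for a given `λ₀`: the logarithmic series with coefficients `λ_n = lambdaK` and
`A(y) = -∑_{n ≥ 1} λ_n(y)`. -/
def BKm (p f : ℕ) (π : K) (m : ℕ) (lam0 : ℝ) (x y : K) : ℝ :=
  logSeries p f π lam0 (fun y => -∑' n : ℕ, lambdaK p f π m lam0 (n + 1) y)
    (lambdaK p f π m lam0) x y

/-- The integrand `z ↦ (φ z - φ x) / |z - x|_K ^ 2 * |x|_K` in the definition of `D φ x`. -/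
def lapIntegrand (p f : ℕ) (π : K) (φ : K → ℝ) (x z : K) : ℝ :=
  (φ z - φ x) / absK p f π (z - x) ^ 2 * absK p f π x

/-- The Laplacian `D φ x = ∫_E (φ z - φ x) / |z - x|_K ^ 2 * |x|_K dz`. -/
def lap (p f : ℕ) [Fact p.Prime] [NormedAlgebra ℚ_[p] K] [MeasurableSpace K] (μ : Measure K)
    (π : K) (m : ℕ) (φ : K → ℝ) (x : K) : ℝ :=
  ∫ z in domainE p π m, lapIntegrand p f π φ x z ∂μ

/-- The multiplicative measure `dx / |x|_K`. -/
def mulMeasure (p f : ℕ) [MeasurableSpace K] (μ : Measure K) (π : K) : Measure K :=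
  μ.withDensity (fun x => ENNReal.ofReal (absK p f π x)⁻¹)

/-- The volume `V` of the Tate curve for `dx / |x|_K`. -/
def vol (p f : ℕ) [Fact p.Prime] [NormedAlgebra ℚ_[p] K] [MeasurableSpace K] (μ : Measure K)
    (π : K) (m : ℕ) : ℝ :=
  (mulMeasure p f μ π (domainE p π m)).toReal

/-- `G` is a symmetric Green's function of `D`: `D G(·,y) = δ_y - 1/V` in the sense of
distributions, tested against locally constant functions, for the pairing
`⟨g, h⟩ = ∫_E g h dx / |x|_K` (for which `D` is self-adjoint). The values of `G` on the diagonal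
are irrelevant. -/
structure IsSymmGreen (p f : ℕ) [Fact p.Prime] [NormedAlgebra ℚ_[p] K] [MeasurableSpace K]
    (μ : Measure K) (π : K) (m : ℕ) (G : K → K → ℝ) : Prop where
  symm : ∀ x ∈ domainE p π m, ∀ y ∈ domainE p π m, G x y = G y x
  continuousOn : ∀ y ∈ domainE p π m, ContinuousOn (fun x => G x y) (domainE p π m \ {y})
  integrableOn : ∀ y ∈ domainE p π m,
    IntegrableOn (fun x => G x y) (domainE p π m) (mulMeasure p f μ π)
  green : ∀ y ∈ domainE p π m, ∀ φ : K → ℝ,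
    IsLocallyConstant (fun x : domainE p π m => φ x) →
      ∫ x in domainE p π m, G x y * lap p f μ π m φ x ∂(mulMeasure p f μ π) =
        φ y - 1 / vol p f μ π m * ∫ x in domainE p π m, φ x ∂(mulMeasure p f μ π)

end Curve

/-- `Λ_q = 1 + p^{-f} - p^{-f (q+1)} - p^{-f (m-q)}`. -/
def Lam (p f m : ℕ) (q : ℤ) : ℝ :=
  1 + (p : ℝ) ^ (-(f : ℤ)) - (p : ℝ) ^ (-((f : ℤ) * (q + 1))) -
    (p : ℝ) ^ (-((f : ℤ) * ((m : ℤ) - q)))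

/-- The recurrence formulas for the array `C q r`, `0 ≤ q, r ≤ m - 1`. -/
structure IsRecurrent (p f m : ℕ) (C : ℤ → ℤ → ℝ) : Prop where
  step_last : 2 ≤ m →
    C ((m : ℤ) - 2) 0 = C ((m : ℤ) - 1) 0 - (p : ℝ) ^ f / (m * Lam p f m ((m : ℤ) - 2))
  step : ∀ q : ℤ, 0 ≤ q → q < (m : ℤ) - 2 →
    C q 0 = (Lam p f m q + Lam p f m (q + 2)) / Lam p f m q * C (q + 1) 0 -
      Lam p f m (q + 2) / Lam p f m q * C (q + 2) 0 - ((p : ℝ) ^ f - 1) / (m * Lam p f m q)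
  lower : ∀ q r : ℤ, 0 ≤ r → r ≤ q → q ≤ (m : ℤ) - 1 →
    C q r = C q 0 + C ((m : ℤ) - 1 - r) 0 - C ((m : ℤ) - 1) 0
  upper : ∀ q r : ℤ, 0 ≤ q → q ≤ r → r ≤ (m : ℤ) - 1 →
    C q r = C ((m : ℤ) - 1 - q) 0 + C r 0 - C ((m : ℤ) - 1) 0

end TateGreen

end

/-!
For fixed `y` the function `B_{K,m}(·, y)` is a function of `k = v_K(x - y) - min (v_K x) (v_K y)`
alone. Splitting the domain into spheres around `x` turns `D` on such functions into a discrete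
operator in `k`, and the requirement that its value not depend on `k` forces a recurrence that
determines every coefficient `λ_n`. On functions of `v_K(x)` the operator `D` becomes a difference
operator on `{0, …, m - 1}`; inverting it column by column gives the recurrence for `C`, and the
solvability condition (the total mass must vanish) fixes `λ₀`.

The operator `D` is symmetric after truncation of its kernel, which proves that `B + C` is a Green's
function. For uniqueness, take as test function a Green's function averaged over a small ball around
its pole `c`: its Laplacian is constant on the ball and `-1/V` off it, so testing another Green's
function `G(·, y)` against it gives the average of `G(·, y)` over the ball minus its mean on `E`.
Shrinking the ball determines `G(c, y)` up to a constant `κ(y)`, and symmetry makes `κ` constant.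
-/

namespace TateGreen

open Metric Filter Topology

section RingOfIntegers

variable {p : ℕ} [Fact p.Prime] {K : Type*} [NormedField K] [NormedAlgebra ℚ_[p] K]
  {ϖ : ringOfIntegers p K}

theorem isUnit_iff_norm_eq_one (x : ringOfIntegers p K) : IsUnit x ↔ ‖(x : K)‖ = 1 := by
  have := isUltrametricDist p K
  exact ((Valuation.integer.integers (NormedField.valuation (K := K))).isUnit_iff_valuation_eq_one
    (x := x)).trans NNReal.coe_eq_one.symm

theorem norm_pos_of_irreducible (hϖ : Irreducible ϖ) : 0 < ‖(ϖ : K)‖ :=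
  norm_pos_iff.2 fun h => hϖ.ne_zero (Subtype.ext h)

theorem norm_lt_one_of_irreducible (hϖ : Irreducible ϖ) : ‖(ϖ : K)‖ < 1 :=
  lt_of_le_of_ne ((mem_ringOfIntegers p K _).1 ϖ.2)
    fun h => hϖ.not_isUnit ((isUnit_iff_norm_eq_one _).2 h)

theorem norm_le_of_irreducible (hϖ : Irreducible ϖ) {x : K} (hx : ‖x‖ < 1) :
    ‖x‖ ≤ ‖(ϖ : K)‖ := by
  by_contra! h
  have hx0 : x ≠ 0 := norm_pos_iff.1 ((norm_nonneg _).trans_lt h)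
  have hquot : ‖(ϖ : K) / x‖ < 1 := by
    rwa [norm_div, div_lt_one (norm_pos_iff.2 hx0)]
  have hmul : ϖ = (⟨x, (mem_ringOfIntegers p K _).2 hx.le⟩ : ringOfIntegers p K) *
      ⟨(ϖ : K) / x, (mem_ringOfIntegers p K _).2 hquot.le⟩ :=
    Subtype.ext (mul_div_cancel₀ _ hx0).symm
  rcases hϖ.isUnit_or_isUnit hmul with hunit | hunit
  · exact hx.ne ((isUnit_iff_norm_eq_one _).1 hunit)
  · exact hquot.ne ((isUnit_iff_norm_eq_one _).1 hunit)

theorem exists_norm_eq_zpow (hϖ : Irreducible ϖ) {x : K} (hx : x ≠ 0) :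
    ∃ k : ℤ, ‖x‖ = ‖(ϖ : K)‖ ^ k := by
  have hpos := norm_pos_of_irreducible hϖ
  obtain ⟨n, hlt, hle⟩ := exists_mem_Ioc_zpow (norm_pos_iff.2 hx)
    ((one_lt_inv₀ hpos).2 (norm_lt_one_of_irreducible hϖ))
  rw [inv_zpow'] at hlt hle
  have hscaled : ‖x / (ϖ : K) ^ (-(n + 1))‖ = 1 := by
    by_contra hne
    have hle_one : ‖x / (ϖ : K) ^ (-(n + 1))‖ ≤ 1 := by
      rw [norm_div, norm_zpow]
      exact (div_le_one (zpow_pos hpos _)).2 hle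
    have hle_pi := norm_le_of_irreducible hϖ (lt_of_le_of_ne hle_one hne)
    rw [norm_div, norm_zpow, div_le_iff₀ (zpow_pos hpos _), ← zpow_one_add₀ hpos.ne'] at hle_pi
    exact hlt.not_ge (hle_pi.trans_eq (by congr 1; ring))
  rw [norm_div, norm_zpow, div_eq_one_iff_eq (zpow_pos hpos _).ne'] at hscaled
  exact ⟨_, hscaled⟩

theorem residue_eq_residue_iff (x y : ringOfIntegers p K) :
    IsLocalRing.residue (ringOfIntegers p K) x = IsLocalRing.residue (ringOfIntegers p K) y ↔
      ‖(x : K) - y‖ < 1 := by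
  rw [← sub_eq_zero, ← map_sub, IsLocalRing.residue_eq_zero_iff, IsLocalRing.mem_maximalIdeal,
    mem_nonunits_iff, isUnit_iff_norm_eq_one, lt_iff_le_and_ne]
  exact (and_iff_right ((mem_ringOfIntegers p K _).1 (x - y).2)).symm

theorem closedBall_eq_iUnion_residueField (hϖ : Irreducible ϖ)
    {g : IsLocalRing.ResidueField (ringOfIntegers p K) → ringOfIntegers p K}
    (hg : ∀ a, IsLocalRing.residue _ (g a) = a) (k : ℤ) :
    closedBall (0 : K) (‖(ϖ : K)‖ ^ k) =
      ⋃ a, closedBall ((ϖ : K) ^ k * g a) (‖(ϖ : K)‖ ^ (k + 1)) := by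
  have := isUltrametricDist p K
  have hpos := norm_pos_of_irreducible hϖ
  have hne : (ϖ : K) ≠ 0 := norm_pos_iff.1 hpos
  ext x
  simp only [Set.mem_iUnion, mem_closedBall, dist_eq_norm, sub_zero]
  constructor
  · intro hx
    have hquot : ‖x / (ϖ : K) ^ k‖ ≤ 1 := by
      rwa [norm_div, norm_zpow, div_le_one (zpow_pos hpos _)]
    set u : ringOfIntegers p K := ⟨x / (ϖ : K) ^ k, (mem_ringOfIntegers p K _).2 hquot⟩
    refine ⟨IsLocalRing.residue _ u, ?_⟩
    have hclose := norm_le_of_irreducible hϖ ((residue_eq_residue_iff u _).1 (hg _).symm)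
    rw [show x - (ϖ : K) ^ k * g (IsLocalRing.residue _ u) =
        (ϖ : K) ^ k * ((u : K) - g (IsLocalRing.residue _ u)) by simp only [u]; field_simp,
      norm_mul, norm_zpow, zpow_add_one₀ hpos.ne']
    gcongr
  · rintro ⟨a, ha⟩
    have hcenter : ‖(ϖ : K) ^ k * g a‖ ≤ ‖(ϖ : K)‖ ^ k := by
      rw [norm_mul, norm_zpow]
      exact mul_le_of_le_one_right (zpow_pos hpos _).le ((mem_ringOfIntegers p K _).1 (g a).2)
    have hradius : ‖(ϖ : K)‖ ^ (k + 1) ≤ ‖(ϖ : K)‖ ^ k :=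
      zpow_le_zpow_right_of_le_one₀ hpos (norm_lt_one_of_irreducible hϖ).le (by lia)
    simpa using (IsUltrametricDist.norm_add_le_max (x - (ϖ : K) ^ k * g a) _).trans
      (max_le (ha.trans hradius) hcenter)

theorem pairwise_disjoint_closedBall_residueField (hϖ : Irreducible ϖ)
    {g : IsLocalRing.ResidueField (ringOfIntegers p K) → ringOfIntegers p K}
    (hg : ∀ a, IsLocalRing.residue _ (g a) = a) (k : ℤ) :
    Pairwise (Function.onFun Disjoint
      fun a => closedBall ((ϖ : K) ^ k * (g a : K)) (‖(ϖ : K)‖ ^ (k + 1))) := by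
  have := isUltrametricDist p K
  have hpos := norm_pos_of_irreducible hϖ
  refine fun a b hab => Set.disjoint_left.2 fun x hxa hxb => hab ?_
  rw [← hg a, ← hg b, residue_eq_residue_iff]
  have hdist := (dist_triangle_max ((ϖ : K) ^ k * g a) x ((ϖ : K) ^ k * g b)).trans
    (max_le (mem_closedBall'.1 hxa) (mem_closedBall.1 hxb))
  rw [dist_eq_norm, ← mul_sub, norm_mul, norm_zpow, zpow_add_one₀ hpos.ne',
    mul_le_mul_iff_right₀ (zpow_pos hpos _)] at hdist
  exact hdist.trans_lt (norm_lt_one_of_irreducible hϖ)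

end RingOfIntegers

theorem measure_closedBall_eq_measure_closedBall_zero {E : Type*} [SeminormedAddCommGroup E]
    [MeasurableSpace E] [BorelSpace E] (μ : Measure E) [μ.IsAddRightInvariant] (c : E) (r : ℝ) :
    μ (closedBall c r) = μ (closedBall 0 r) := by
  rw [← measure_preimage_add_right μ (-c) (closedBall 0 r)]
  congr 1
  ext x
  simp [dist_eq_norm, sub_eq_add_neg]

section HaarMeasure

variable {p : ℕ} [Fact p.Prime] {K : Type*} [NormedField K] [NormedAlgebra ℚ_[p] K]
  {ϖ : ringOfIntegers p K} [MeasurableSpace K] [BorelSpace K]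

theorem measure_closedBall_zpow (μ : Measure K) [μ.IsAddRightInvariant]
    [Finite (IsLocalRing.ResidueField (ringOfIntegers p K))] (hϖ : Irreducible ϖ) (k : ℤ) :
    μ (closedBall 0 (‖(ϖ : K)‖ ^ k)) =
      Nat.card (IsLocalRing.ResidueField (ringOfIntegers p K)) *
        μ (closedBall 0 (‖(ϖ : K)‖ ^ (k + 1))) := by
  have := Fintype.ofFinite (IsLocalRing.ResidueField (ringOfIntegers p K))
  choose g hg using IsLocalRing.residue_surjective (R := ringOfIntegers p K)
  rw [closedBall_eq_iUnion_residueField hϖ hg, measure_iUnion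
    (pairwise_disjoint_closedBall_residueField hϖ hg k) fun _ => measurableSet_closedBall,
    tsum_fintype]
  simp [measure_closedBall_eq_measure_closedBall_zero μ (_ * _)]

end HaarMeasure

/-- `π` is a uniformizer of the nonarchimedean field `K`: every nonzero element has norm an
integral power of `‖π‖ < 1`. -/
structure IsUniformizer {K : Type*} [NormedField K] (π : K) : Prop where
  isUltrametricDist : IsUltrametricDist K
  norm_pos : 0 < ‖π‖
  norm_lt_one : ‖π‖ < 1
  exists_norm_eq_zpow : ∀ x : K, x ≠ 0 → ∃ k : ℤ, ‖x‖ = ‖π‖ ^ k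

/-- The normalizations of the absolute value and of the Haar measure of a local field whose residue
field has `q = p ^ f` elements: `μ` gives the balls around any point their expected volume. -/
structure IsNormalizedHaar (p f : ℕ) {K : Type*} [NormedField K] [MeasurableSpace K] (π : K)
    (μ : Measure K) (q : ℝ) : Prop extends IsUniformizer π where
  pow_eq : (p : ℝ) ^ f = q
  one_lt : 1 < q
  measure_closedBall : ∀ (c : K) (k : ℤ), μ (closedBall c (‖π‖ ^ k)) = ENNReal.ofReal (q ^ (-k))

theorem isUniformizer_of_irreducible {p : ℕ} [Fact p.Prime] {K : Type*} [NormedField K]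
    [NormedAlgebra ℚ_[p] K] {ϖ : ringOfIntegers p K} (hϖ : Irreducible ϖ) :
    IsUniformizer (ϖ : K) :=
  ⟨isUltrametricDist p K, norm_pos_of_irreducible hϖ, norm_lt_one_of_irreducible hϖ,
    fun _ => exists_norm_eq_zpow hϖ⟩

theorem isNormalizedHaar_of_irreducible {p : ℕ} [Fact p.Prime] {K : Type*} [NormedField K]
    [NormedAlgebra ℚ_[p] K] [MeasurableSpace K] [BorelSpace K] {f : ℕ}
    (hf : Nat.card (IsLocalRing.ResidueField (ringOfIntegers p K)) = p ^ f)
    {ϖ : ringOfIntegers p K} (hϖ : Irreducible ϖ) {μ : Measure K} [μ.IsAddRightInvariant]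
    (hμ : μ (ringOfIntegers p K : Set K) = 1) :
    IsNormalizedHaar p f (ϖ : K) μ ((p : ℝ) ^ f) := by
  have hcard_ne : p ^ f ≠ 0 := pow_ne_zero _ (Fact.out : p.Prime).ne_zero
  have hpos : (0 : ℝ) < (p : ℝ) ^ f := by exact_mod_cast hcard_ne.bot_lt
  have : Finite (IsLocalRing.ResidueField (ringOfIntegers p K)) :=
    Nat.finite_of_card_ne_zero (hf ▸ hcard_ne)
  have hone_lt : 1 < p ^ f := hf ▸ Finite.one_lt_card
  have hstep (k : ℤ) : μ (closedBall 0 (‖(ϖ : K)‖ ^ k)) =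
      ENNReal.ofReal ((p : ℝ) ^ f) * μ (closedBall 0 (‖(ϖ : K)‖ ^ (k + 1))) := by
    rw [measure_closedBall_zpow μ hϖ, hf, ← Nat.cast_pow, ENNReal.ofReal_natCast]
  have hofReal_mul (j : ℤ) : ENNReal.ofReal ((p : ℝ) ^ f) *
      ENNReal.ofReal (((p : ℝ) ^ f) ^ (-(j + 1))) = ENNReal.ofReal (((p : ℝ) ^ f) ^ (-j)) := by
    rw [← ENNReal.ofReal_mul hpos.le, ← zpow_one_add₀ hpos.ne', neg_add, add_neg_cancel_comm_assoc]
  refine ⟨isUniformizer_of_irreducible hϖ, rfl, by exact_mod_cast hone_lt, fun c k => ?_⟩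
  rw [measure_closedBall_eq_measure_closedBall_zero]
  induction k using Int.induction_on with
  | zero =>
    have : closedBall (0 : K) 1 = ringOfIntegers p K := by
      ext x
      simp [mem_ringOfIntegers]
    simp [this, hμ]
  | succ i ih =>
    rwa [hstep, ← hofReal_mul, ENNReal.mul_right_inj (ENNReal.ofReal_pos.2 hpos).ne'
      ENNReal.ofReal_ne_top] at ih
  | pred i ih => rw [hstep, sub_add_cancel, ih, ← hofReal_mul (-i - 1), sub_add_cancel]

section Valuation

variable {K : Type*} [NormedField K] {π x y z c : K}

/-- The exponent `l ≥ 0` in `d(x,y) = q ^ (-l)`, see `dist01_eq`. -/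
noncomputable def relVal (π x y : K) : ℕ := (valK π (x - y) - valK π y).toNat

theorem valK_congr (π : K) (h : ‖x‖ = ‖y‖) : valK π x = valK π y := by
  unfold valK
  rw [h]

theorem valK_sub_comm (π x y : K) : valK π (x - y) = valK π (y - x) :=
  valK_congr π (norm_sub_rev x y)

theorem norm_sub_eq_of_mem_closedBall {E : Type*} [SeminormedAddCommGroup E] [IsUltrametricDist E]
    {x y z : E} {r : ℝ} (hy : y ∉ closedBall x r) (hz : z ∈ closedBall x r) :
    ‖z - y‖ = ‖x - y‖ := by
  rw [mem_closedBall_iff_norm] at hz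
  rw [mem_closedBall_iff_norm', not_le] at hy
  have hlt := hz.trans_lt hy
  rw [← sub_add_sub_cancel z x y, IsUltrametricDist.norm_add_eq_max_of_norm_ne_norm hlt.ne,
    max_eq_right hlt.le]

namespace IsUniformizer

theorem norm_eq_zpow_valK (hπ : IsUniformizer π) (hx : x ≠ 0) : ‖x‖ = ‖π‖ ^ valK π x := by
  rw [valK, dif_pos (hπ.exists_norm_eq_zpow x hx)]
  exact (hπ.exists_norm_eq_zpow x hx).choose_spec

theorem norm_le_zpow_iff (hπ : IsUniformizer π) (hx : x ≠ 0) {k : ℤ} :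
    ‖x‖ ≤ ‖π‖ ^ k ↔ k ≤ valK π x := by
  rw [hπ.norm_eq_zpow_valK hx, zpow_le_zpow_iff_right_of_lt_one₀ hπ.norm_pos hπ.norm_lt_one]

theorem norm_eq_zpow_iff (hπ : IsUniformizer π) {k : ℤ} :
    ‖x‖ = ‖π‖ ^ k ↔ x ≠ 0 ∧ valK π x = k := by
  by_cases hx : x = 0
  · simpa [hx] using (zpow_pos hπ.norm_pos k).ne
  · rw [hπ.norm_eq_zpow_valK hx, (zpow_right_injective₀ hπ.norm_pos hπ.norm_lt_one.ne).eq_iff]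
    exact (and_iff_right hx).symm

theorem min_valK_le_valK_sub (hπ : IsUniformizer π) (hx : x ≠ 0) (hy : y ≠ 0) (hxy : x ≠ y) :
    min (valK π x) (valK π y) ≤ valK π (x - y) := by
  have := hπ.isUltrametricDist
  rw [← hπ.norm_le_zpow_iff (sub_ne_zero.2 hxy), sub_eq_add_neg]
  refine (IsUltrametricDist.norm_add_le_max x (-y)).trans (max_le ?_ ?_)
  · exact (hπ.norm_le_zpow_iff hx).2 (min_le_left _ _)
  · rw [norm_neg]
    exact (hπ.norm_le_zpow_iff hy).2 (min_le_right _ _)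

theorem valK_sub_eq_min (hπ : IsUniformizer π) (hx : x ≠ 0) (hy : y ≠ 0)
    (h : valK π x ≠ valK π y) : valK π (x - y) = min (valK π x) (valK π y) := by
  have := hπ.isUltrametricDist
  have hmono : Antitone fun k : ℤ => ‖π‖ ^ k :=
    fun _ _ => zpow_le_zpow_right_of_le_one₀ hπ.norm_pos hπ.norm_lt_one.le
  have hne : ‖x‖ ≠ ‖-y‖ := fun h' => h (valK_congr π (h'.trans (norm_neg y)))
  refine (hπ.norm_eq_zpow_iff.1 ?_).2
  rw [hmono.map_min, ← hπ.norm_eq_zpow_valK hx, ← hπ.norm_eq_zpow_valK hy, sub_eq_add_neg,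
    IsUltrametricDist.norm_add_eq_max_of_norm_ne_norm hne, norm_neg]

theorem valK_sub_eq_min_add_relVal (hπ : IsUniformizer π) (hx : x ≠ 0) (hy : y ≠ 0)
    (hxy : x ≠ y) : valK π (x - y) = min (valK π x) (valK π y) + relVal π x y := by
  have hle := hπ.min_valK_le_valK_sub hx hy hxy
  rw [relVal]
  by_cases h : valK π x = valK π y
  · lia
  · have := hπ.valK_sub_eq_min hx hy h
    lia

theorem valK_eq_of_relVal_pos (hπ : IsUniformizer π) (hx : x ≠ 0) (hy : y ≠ 0)
    (h : 0 < relVal π x y) : valK π x = valK π y := by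
  by_contra hne
  have := hπ.valK_sub_eq_min hx hy hne
  rw [relVal] at h
  lia

theorem relVal_comm (hπ : IsUniformizer π) (hx : x ≠ 0) (hy : y ≠ 0) (hxy : x ≠ y) :
    relVal π x y = relVal π y x := by
  have h1 := hπ.valK_sub_eq_min_add_relVal hx hy hxy
  have h2 := hπ.valK_sub_eq_min_add_relVal hy hx hxy.symm
  rw [valK_sub_comm] at h2
  lia

theorem valK_sub_eq_min_of_relVal_ne (hπ : IsUniformizer π) (hxy : x ≠ y) (hzy : z ≠ y)
    (h : relVal π z y ≠ relVal π x y) : valK π (z - x) = min (valK π (z - y)) (valK π (x - y)) := by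
  rw [← sub_sub_sub_cancel_right z x y]
  refine hπ.valK_sub_eq_min (sub_ne_zero.2 hzy) (sub_ne_zero.2 hxy) fun heq => h ?_
  rw [relVal, relVal, heq]

theorem mem_closedBall_zpow_iff (hπ : IsUniformizer π) (hz : z ≠ c) {k : ℤ} :
    z ∈ closedBall c (‖π‖ ^ k) ↔ k ≤ valK π (z - c) := by
  rw [mem_closedBall, dist_eq_norm, hπ.norm_le_zpow_iff (sub_ne_zero.2 hz)]

theorem mem_sphere_zpow_iff (hπ : IsUniformizer π) {k : ℤ} :
    z ∈ sphere c (‖π‖ ^ k) ↔ z ≠ c ∧ valK π (z - c) = k := by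
  rw [mem_sphere, dist_eq_norm, hπ.norm_eq_zpow_iff, sub_ne_zero]

theorem norm_eq_of_mem_closedBall (hπ : IsUniformizer π) (hx : x ≠ 0) {k : ℤ}
    (hk : valK π x < k) (hz : z ∈ closedBall x (‖π‖ ^ k)) : ‖z‖ = ‖x‖ := by
  have := hπ.isUltrametricDist
  have hzero : (0 : K) ∉ closedBall x (‖π‖ ^ k) := by
    rw [hπ.mem_closedBall_zpow_iff hx.symm, valK_sub_comm, sub_zero, not_le]
    exact hk
  simpa only [sub_zero] using norm_sub_eq_of_mem_closedBall hzero hz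

theorem closedBall_zpow_anti (hπ : IsUniformizer π) (c : K) {j k : ℤ} (h : j ≤ k) :
    closedBall c (‖π‖ ^ k) ⊆ closedBall c (‖π‖ ^ j) :=
  closedBall_subset_closedBall (zpow_le_zpow_right_of_le_one₀ hπ.norm_pos hπ.norm_lt_one.le h)

theorem sphere_zpow_eq_sdiff (hπ : IsUniformizer π) (c : K) (k : ℤ) :
    sphere c (‖π‖ ^ k) = closedBall c (‖π‖ ^ k) \ closedBall c (‖π‖ ^ (k + 1)) := by
  ext z
  by_cases hz : z = c
  · simp [hz, (zpow_pos hπ.norm_pos _).le, (zpow_pos hπ.norm_pos _).ne]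
  · simp only [hπ.mem_sphere_zpow_iff, Set.mem_sdiff, hπ.mem_closedBall_zpow_iff hz]
    lia

theorem disjoint_sphere_zpow (hπ : IsUniformizer π) (c : K) {j k : ℤ} (h : j ≠ k) :
    Disjoint (sphere c (‖π‖ ^ j)) (sphere c (‖π‖ ^ k)) := by
  refine Set.disjoint_left.2 fun z hj hk => h ?_
  rw [← (hπ.mem_sphere_zpow_iff.1 hj).2, (hπ.mem_sphere_zpow_iff.1 hk).2]

theorem closedBall_sdiff_singleton_eq_iUnion_sphere (hπ : IsUniformizer π) (c : K) (k : ℤ) :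
    closedBall c (‖π‖ ^ k) \ {c} = ⋃ l : ℕ, sphere c (‖π‖ ^ (k + l : ℤ)) := by
  ext z
  by_cases hz : z = c
  · simp [hz, (zpow_pos hπ.norm_pos _).ne]
  · simp only [Set.mem_sdiff, hπ.mem_closedBall_zpow_iff hz, Set.mem_singleton_iff, hz,
      Set.mem_iUnion, hπ.mem_sphere_zpow_iff]
    exact ⟨fun h => ⟨(valK π (z - c) - k).toNat, by lia⟩, by rintro ⟨l, hl⟩; lia⟩

variable {p : ℕ} [Fact p.Prime] [NormedAlgebra ℚ_[p] K] {m : ℕ}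

theorem mem_domainE_iff (hπ : IsUniformizer π) :
    x ∈ domainE p π m ↔ x ≠ 0 ∧ 0 ≤ valK π x ∧ valK π x < m := by
  have hpow (s : ℕ) : (0 : ℝ) < ‖π‖ ^ s := pow_pos hπ.norm_pos s
  constructor
  · rintro ⟨s, hs, u, rfl⟩
    have hnorm : ‖π ^ s * ((u : ringOfIntegers p K) : K)‖ = ‖π‖ ^ (s : ℤ) := by
      rw [norm_mul, norm_pow, (isUnit_iff_norm_eq_one _).1 u.isUnit, mul_one, zpow_natCast]
    obtain ⟨hne, hval⟩ := hπ.norm_eq_zpow_iff.1 hnorm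
    exact ⟨hne, by lia, by lia⟩
  · rintro ⟨hx, hnonneg, hlt⟩
    have hnorm := hπ.norm_eq_zpow_valK hx
    lift valK π x to ℕ using hnonneg with s
    have hunit : ‖x / π ^ s‖ = 1 := by
      rw [norm_div, norm_pow, hnorm, zpow_natCast, div_self (hpow s).ne']
    obtain ⟨u, hu⟩ := (isUnit_iff_norm_eq_one
      (⟨x / π ^ s, (mem_ringOfIntegers p K _).2 hunit.le⟩ : ringOfIntegers p K)).2 hunit
    refine ⟨s, by exact_mod_cast hlt, u, ?_⟩
    rw [hu, mul_div_cancel₀ x (norm_pos_iff.1 (by simpa using hpow s))]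

theorem ne_zero_of_mem_domainE (hπ : IsUniformizer π) (hx : x ∈ domainE p π m) : x ≠ 0 :=
  (hπ.mem_domainE_iff.1 hx).1

theorem domainE_eq_iUnion_sphere (hπ : IsUniformizer π) :
    domainE p π m = ⋃ j : Fin m, sphere 0 (‖π‖ ^ (j : ℤ)) := by
  ext z
  simp only [hπ.mem_domainE_iff, Set.mem_iUnion, hπ.mem_sphere_zpow_iff, sub_zero]
  exact ⟨fun ⟨hz, hnonneg, _⟩ => ⟨⟨(valK π z).toNat, by lia⟩, hz, by simp [hnonneg]⟩,
    fun ⟨j, hz, hval⟩ => ⟨hz, by lia, by rw [hval]; exact_mod_cast j.2⟩⟩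

theorem closedBall_subset_domainE (hπ : IsUniformizer π) (hy : y ∈ domainE p π m) {k : ℤ}
    (hk : valK π y < k) : closedBall y (‖π‖ ^ k) ⊆ domainE p π m := by
  intro z hz
  have hnorm := hπ.norm_eq_of_mem_closedBall (hπ.ne_zero_of_mem_domainE hy) hk hz
  rw [hπ.mem_domainE_iff] at hy ⊢
  rw [valK_congr π hnorm]
  exact ⟨norm_pos_iff.1 (hnorm ▸ norm_pos_iff.2 hy.1), hy.2⟩

end IsUniformizer

end Valuation

section RadialIntegration

theorem integral_iUnion_of_const {X ι : Type*} [MeasurableSpace X] [Countable ι] {μ : Measure X}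
    {s : ι → Set X} (hs : ∀ i, MeasurableSet (s i)) (hdisj : Pairwise (Function.onFun Disjoint s))
    (hfin : ∀ i, μ (s i) ≠ ⊤) {g : X → ℝ} {c : ι → ℝ} (hg : ∀ i, ∀ z ∈ s i, g z = c i)
    (hc : Summable fun i => c i * μ.real (s i)) :
    IntegrableOn g (⋃ i, s i) μ ∧ ∫ z in ⋃ i, s i, g z ∂μ = ∑' i, c i * μ.real (s i) := by
  have hint (i : ι) : IntegrableOn g (s i) μ :=
    (integrableOn_congr_fun (hg i) (hs i)).2 (integrableOn_const (hfin i))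
  have hnorm (i : ι) : ∫ z in s i, ‖g z‖ ∂μ = |c i * μ.real (s i)| := by
    rw [setIntegral_congr_fun (g := fun _ => |c i|) (hs i) fun z hz => by simp [hg i z hz],
      setIntegral_const, smul_eq_mul, abs_mul, abs_of_nonneg measureReal_nonneg, mul_comm]
  have hunion : IntegrableOn g (⋃ i, s i) μ :=
    integrableOn_iUnion_of_summable_integral_norm hint (by simpa only [hnorm] using hc.abs)
  refine ⟨hunion, ?_⟩
  rw [integral_iUnion hs hdisj hunion]
  refine tsum_congr fun i => ?_
  rw [setIntegral_congr_fun (hs i) (hg i), setIntegral_const, smul_eq_mul, mul_comm]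

namespace IsNormalizedHaar

variable {p f : ℕ} {K : Type*} [NormedField K] [MeasurableSpace K] {π : K} {μ : Measure K} {q : ℝ}
  {x y z : K}

theorem q_pos (hμ : IsNormalizedHaar p f π μ q) : 0 < q :=
  one_pos.trans hμ.one_lt

theorem absK_eq_zpow (hμ : IsNormalizedHaar p f π μ q) (hx : x ≠ 0) :
    absK p f π x = q ^ (-valK π x) := by
  rw [absK, if_neg hx, ← hμ.pow_eq, ← zpow_natCast (p : ℝ) f, ← zpow_mul, mul_neg]

theorem dist01_eq (hμ : IsNormalizedHaar p f π μ q) (hx : x ≠ 0) (hy : y ≠ 0) (hxy : x ≠ y) :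
    dist01 p f π x y = (q ^ relVal π x y)⁻¹ := by
  have hanti : Antitone fun k : ℤ => q ^ (-k) :=
    fun _ _ h => zpow_le_zpow_right₀ hμ.one_lt.le (neg_le_neg h)
  rw [dist01, hμ.absK_eq_zpow (sub_ne_zero.2 hxy), hμ.absK_eq_zpow hx, hμ.absK_eq_zpow hy,
    ← hanti.map_min, hμ.valK_sub_eq_min_add_relVal hx hy hxy, ← zpow_sub₀ hμ.q_pos.ne',
    neg_add, add_sub_cancel_left, zpow_neg, zpow_natCast]

theorem measure_closedBall_ne_top (hμ : IsNormalizedHaar p f π μ q) (c : K) (k : ℤ) :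
    μ (closedBall c (‖π‖ ^ k)) ≠ ⊤ := by
  rw [hμ.measure_closedBall]
  exact ENNReal.ofReal_ne_top

theorem measureReal_closedBall (hμ : IsNormalizedHaar p f π μ q) (c : K) (k : ℤ) :
    μ.real (closedBall c (‖π‖ ^ k)) = q ^ (-k) := by
  rw [measureReal_def, hμ.measure_closedBall, ENNReal.toReal_ofReal (zpow_pos hμ.q_pos _).le]

theorem measure_sphere_ne_top (hμ : IsNormalizedHaar p f π μ q) (c : K) (k : ℤ) :
    μ (sphere c (‖π‖ ^ k)) ≠ ⊤ :=
  measure_ne_top_of_subset sphere_subset_closedBall (hμ.measure_closedBall_ne_top c k)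

theorem nonatomic (hμ : IsNormalizedHaar p f π μ q) (c : K) : μ {c} = 0 := by
  have hle (n : ℕ) : μ {c} ≤ ENNReal.ofReal (q⁻¹ ^ n) := by
    have := hμ.measure_closedBall c n
    rw [zpow_neg, zpow_natCast q, ← inv_pow] at this
    rw [← this]
    exact measure_mono
      (Set.singleton_subset_iff.2 (mem_closedBall_self (zpow_pos hμ.norm_pos _).le))
  have hlim : Tendsto (fun n : ℕ => ENNReal.ofReal (q⁻¹ ^ n)) atTop (𝓝 0) := by
    simpa using ENNReal.tendsto_ofReal (tendsto_pow_atTop_nhds_zero_of_lt_one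
      (inv_nonneg.2 hμ.q_pos.le) (inv_lt_one_of_one_lt₀ hμ.one_lt))
  exact le_antisymm (ge_of_tendsto' hlim hle) zero_le

variable [BorelSpace K]

theorem measureReal_sphere (hμ : IsNormalizedHaar p f π μ q) (c : K) (k : ℤ) :
    μ.real (sphere c (‖π‖ ^ k)) = q ^ (-k) * (1 - q⁻¹) := by
  rw [hμ.sphere_zpow_eq_sdiff, measureReal_sdiff (hμ.closedBall_zpow_anti c (by lia))
    measurableSet_closedBall (hμ.measure_closedBall_ne_top _ _), hμ.measureReal_closedBall,
    hμ.measureReal_closedBall, neg_add, zpow_add₀ hμ.q_pos.ne', zpow_neg_one]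
  ring

theorem integral_closedBall_radial (hμ : IsNormalizedHaar p f π μ q) (c : K) (k : ℤ) {g : K → ℝ}
    {F : ℕ → ℝ} (hF : Summable fun l => F l / q ^ l)
    (hg : ∀ l : ℕ, ∀ z ∈ sphere c (‖π‖ ^ (k + l : ℤ)), g z = F l) :
    IntegrableOn g (closedBall c (‖π‖ ^ k)) μ ∧
      ∫ z in closedBall c (‖π‖ ^ k), g z ∂μ = q ^ (-k) * (1 - q⁻¹) * ∑' l, F l / q ^ l := by
  have hterm (l : ℕ) : F l * μ.real (sphere c (‖π‖ ^ (k + l : ℤ))) =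
      q ^ (-k) * (1 - q⁻¹) * (F l / q ^ l) := by
    rw [hμ.measureReal_sphere, neg_add, zpow_add₀ hμ.q_pos.ne', zpow_neg q l, zpow_natCast]
    ring
  have key := integral_iUnion_of_const (μ := μ) (s := fun l : ℕ => sphere c (‖π‖ ^ (k + l : ℤ)))
    (fun l => isClosed_sphere.measurableSet)
    (fun i j hij => hμ.disjoint_sphere_zpow c (by simpa using hij))
    (fun l => hμ.measure_sphere_ne_top c _) hg (by simpa only [hterm] using hF.mul_left _)
  have hae : (⋃ l : ℕ, sphere c (‖π‖ ^ (k + l : ℤ))) =ᵐ[μ] closedBall c (‖π‖ ^ k) := by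
    rw [← hμ.closedBall_sdiff_singleton_eq_iUnion_sphere]
    exact sdiff_null_ae_eq_self (hμ.nonatomic c)
  refine ⟨key.1.congr_set_ae hae.symm, ?_⟩
  rw [← setIntegral_congr_set hae, key.2, ← tsum_mul_left]
  exact tsum_congr hterm

variable [Fact p.Prime] [NormedAlgebra ℚ_[p] K] {m : ℕ}

theorem measurableSet_domainE (hμ : IsNormalizedHaar p f π μ q) :
    MeasurableSet (domainE p π m) := by
  rw [hμ.domainE_eq_iUnion_sphere]
  exact MeasurableSet.iUnion fun j => isClosed_sphere.measurableSet

theorem integral_domainE_of_valK (hμ : IsNormalizedHaar p f π μ q) {g : K → ℝ} (c : ℤ → ℝ)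
    (hg : ∀ z ∈ domainE p π m, g z = c (valK π z)) :
    IntegrableOn g (domainE p π m) μ ∧ ∫ z in domainE p π m, g z ∂μ =
      (1 - q⁻¹) * ∑ j ∈ Finset.range m, c j * q ^ (-(j : ℤ)) := by
  have key := integral_iUnion_of_const (μ := μ) (s := fun j : Fin m => sphere 0 (‖π‖ ^ (j : ℤ)))
    (g := g) (c := fun j => c j) (fun j => isClosed_sphere.measurableSet)
    (fun i j hij => hμ.disjoint_sphere_zpow 0 (by simpa [Fin.ext_iff] using hij))
    (fun j => hμ.measure_sphere_ne_top 0 _) (fun j z hz => by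
      have hzE : z ∈ domainE p π m := by
        rw [hμ.domainE_eq_iUnion_sphere]
        exact Set.mem_iUnion.2 ⟨j, hz⟩
      rw [hg z hzE, ← (hμ.mem_sphere_zpow_iff.1 hz).2, sub_zero])
    (Summable.of_finite)
  rw [← hμ.domainE_eq_iUnion_sphere (p := p) (m := m)] at key
  refine ⟨key.1, ?_⟩
  rw [key.2, tsum_fintype, Finset.sum_range, Finset.mul_sum]
  refine Finset.sum_congr rfl fun j _ => ?_
  rw [hμ.measureReal_sphere]
  ring

theorem integral_domainE_radial (hμ : IsNormalizedHaar p f π μ q) (hy : y ∈ domainE p π m)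
    {Ψ : ℕ → ℝ} (hΨ : Summable fun l => Ψ l / q ^ l) (hzero : Ψ 0 = 0) {g : K → ℝ}
    (hg : ∀ z ∈ domainE p π m, z ≠ y → g z = Ψ (relVal π z y)) :
    IntegrableOn g (domainE p π m) μ ∧
      ∫ z in domainE p π m, g z ∂μ = q ^ (-valK π y) * (1 - q⁻¹) * ∑' l, Ψ l / q ^ l := by
  set B := closedBall y (‖π‖ ^ (valK π y + 1))
  have hBE : B ⊆ domainE p π m := hμ.closedBall_subset_domainE hy (by lia)
  have hoff : ∀ z ∈ domainE p π m \ B, g z = 0 := by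
    rintro z ⟨hz, hzB⟩
    have hzy : z ≠ y := fun h => hzB (h ▸ mem_closedBall_self (zpow_pos hμ.norm_pos _).le)
    rw [hμ.mem_closedBall_zpow_iff hzy] at hzB
    rw [hg z hz hzy, show relVal π z y = 0 by rw [relVal]; lia, hzero]
  have hrad := hμ.integral_closedBall_radial y (valK π y + 1) (g := g) (F := fun l => Ψ (l + 1))
    (((summable_nat_add_iff 1).2 hΨ).mul_left q |>.congr fun l => by
      rw [pow_succ]
      field_simp [hμ.q_pos.ne'])
    (fun l z hz => by
      obtain ⟨hzy, hval⟩ := hμ.mem_sphere_zpow_iff.1 hz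
      rw [hg z (hBE ((hμ.mem_closedBall_zpow_iff hzy).2 (by lia))) hzy,
        show relVal π z y = l + 1 by rw [relVal]; lia])
  refine ⟨hrad.1.of_forall_sdiff_eq_zero hμ.measurableSet_domainE hoff, ?_⟩
  rw [setIntegral_eq_of_subset_of_forall_sdiff_eq_zero hμ.measurableSet_domainE hBE hoff, hrad.2,
    hΨ.tsum_eq_zero_add, hzero, zero_div, zero_add, neg_add, zpow_add₀ hμ.q_pos.ne', zpow_neg_one,
    ← tsum_mul_left, ← tsum_mul_left]
  refine tsum_congr fun l => ?_
  rw [pow_succ]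
  field_simp

end IsNormalizedHaar

end RadialIntegration

section Laplacian

theorem geom_kernel_sum {q : ℝ} (hq : 0 < q) {m : ℕ} {s : ℤ} (hs : 0 ≤ s) (hsm : s < m) :
    (1 - q⁻¹) * ∑ j ∈ Finset.range m, q ^ (-|(j : ℤ) - s|) =
      1 + q⁻¹ - q⁻¹ * (q ^ (-s) + q ^ (-((m : ℤ) - 1 - s))) := by
  set h : ℕ → ℝ := fun j =>
    if (j : ℤ) ≤ s then q⁻¹ * q ^ ((j : ℤ) - s) else 1 + q⁻¹ - q ^ (s - (j : ℤ)) with hdef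
  have hstep (j : ℕ) : (1 - q⁻¹) * q ^ (-|(j : ℤ) - s|) = h (j + 1) - h j := by
    simp only [hdef]
    rcases lt_trichotomy (j : ℤ) s with hlt | heq | hgt
    · rw [if_pos (by push_cast; lia), if_pos hlt.le, abs_of_neg (by lia), neg_neg,
        show ((j + 1 : ℕ) : ℤ) - s = (j : ℤ) - s + 1 by push_cast; ring, zpow_add_one₀ hq.ne']
      field_simp
    · rw [if_neg (by push_cast; lia), if_pos heq.le, ← heq,
        show (j : ℤ) - ((j + 1 : ℕ) : ℤ) = -1 by push_cast; ring, zpow_neg_one]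
      simp
    · rw [if_neg (by push_cast; lia), if_neg (by lia), abs_of_pos (by lia), neg_sub,
        show s - ((j + 1 : ℕ) : ℤ) = s - (j : ℤ) - 1 by push_cast; ring, zpow_sub_one₀ hq.ne']
      ring
  rw [Finset.mul_sum, Finset.sum_congr rfl fun j _ => hstep j, Finset.sum_range_sub]
  simp only [hdef]
  rw [if_neg (by lia), if_pos (by simpa using hs),
    show -((m : ℤ) - 1 - s) = s - (m : ℤ) + 1 by ring, zpow_add_one₀ hq.ne',
    Nat.cast_zero, zero_sub]
  field_simp
  ring

/-- The value at relative valuation `k = relVal π x y` of the Laplacian of a function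
`x ↦ Ψ (relVal π x y)`, up to the factor `q ^ (-|v x - v y|)`; here `U` stands for `U_K(y)`.
See `IsNormalizedHaar.lap_eq_relLap`. -/
noncomputable def relLap (q U : ℝ) (Ψ : ℕ → ℝ) (k : ℕ) : ℝ :=
  q⁻¹ * (1 - U) * (Ψ 0 - Ψ k) + (1 - q⁻¹) * ∑' l, (Ψ l - Ψ k) * q ^ (2 * min l k) / q ^ l

theorem summable_relLap {q : ℝ} (hq : 1 < q) {Ψ : ℕ → ℝ} (hΨ : Summable fun l => Ψ l / q ^ l)
    (k : ℕ) : Summable fun l => (Ψ l - Ψ k) * q ^ (2 * min l k) / q ^ l := by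
  have hgeom : Summable fun l => Ψ k / q ^ l := by
    simpa only [div_eq_mul_inv, ← inv_pow] using
      (summable_geometric_of_lt_one (by positivity) (inv_lt_one_of_one_lt₀ hq)).mul_left (Ψ k)
  refine (summable_nat_add_iff k).1
    (((summable_nat_add_iff k).2 ((hΨ.sub hgeom).mul_left (q ^ (2 * k)))).congr fun l => ?_)
  rw [min_eq_right (by lia)]
  ring

theorem hasSum_const_div_pow {q : ℝ} (hq : 1 < q) (a : ℝ) :
    HasSum (fun l : ℕ => a / q ^ l) (a * (1 - q⁻¹)⁻¹) := by
  simpa only [div_eq_mul_inv, ← inv_pow] using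
    (hasSum_geometric_of_lt_one (by positivity) (inv_lt_one_of_one_lt₀ hq)).mul_left a

namespace IsNormalizedHaar

variable {p f : ℕ} {K : Type*} [NormedField K] [MeasurableSpace K] {π : K} {μ : Measure K} {q : ℝ}
  {m : ℕ} {φ : K → ℝ} {x y z : K}

theorem lapIntegrand_eq (hμ : IsNormalizedHaar p f π μ q) (hx : x ≠ 0) (hzx : z ≠ x) :
    lapIntegrand p f π φ x z = (φ z - φ x) * q ^ (2 * valK π (z - x) - valK π x) := by
  rw [lapIntegrand, hμ.absK_eq_zpow hx, hμ.absK_eq_zpow (sub_ne_zero.2 hzx), ← zpow_natCast,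
    ← zpow_mul, div_mul_eq_mul_div, mul_div_assoc, ← zpow_sub₀ hμ.q_pos.ne']
  congr 2
  push_cast
  ring

theorem UK_eq (hμ : IsNormalizedHaar p f π μ q) :
    UK p f π m y = q ^ (-valK π y) + q ^ (-((m : ℤ) - 1 - valK π y)) := by
  simp only [UK, ← hμ.pow_eq, ← zpow_natCast (p : ℝ) f, ← zpow_mul, mul_neg]

theorem lapIntegrand_comp_valK (hμ : IsNormalizedHaar p f π μ q) (c : ℤ → ℝ)
    (hx : x ≠ 0) (hz : z ≠ 0) : lapIntegrand p f π (fun t => c (valK π t)) x z =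
      (c (valK π z) - c (valK π x)) * q ^ (valK π z - |valK π z - valK π x|) := by
  by_cases h : valK π z = valK π x
  · simp [lapIntegrand, h]
  · have hzx : z ≠ x := fun h' => h (congrArg _ h')
    rw [hμ.lapIntegrand_eq hx hzx, hμ.valK_sub_eq_min hz hx h]
    congr 2
    grind

variable [Fact p.Prime] [NormedAlgebra ℚ_[p] K]

theorem integral_domainE_kernel [BorelSpace K] (hμ : IsNormalizedHaar p f π μ q) {g : K → ℝ}
    (c : ℤ → ℝ) (s : ℤ)
    (hg : ∀ z ∈ domainE p π m, g z = c (valK π z) * q ^ (valK π z - |valK π z - s|)) :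
    IntegrableOn g (domainE p π m) μ ∧ ∫ z in domainE p π m, g z ∂μ =
      (1 - q⁻¹) * ∑ j ∈ Finset.range m, c j * q ^ (-|(j : ℤ) - s|) := by
  obtain ⟨hint, heq⟩ := hμ.integral_domainE_of_valK (fun j => c j * q ^ (j - |j - s|)) hg
  refine ⟨hint, heq.trans ?_⟩
  congr 1
  refine Finset.sum_congr rfl fun j _ => ?_
  rw [mul_assoc, ← zpow_add₀ hμ.q_pos.ne']
  congr 2
  ring

theorem lap_comp_valK [BorelSpace K] (hμ : IsNormalizedHaar p f π μ q) (c : ℤ → ℝ)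
    (hx : x ∈ domainE p π m) :
    IntegrableOn (lapIntegrand p f π (fun t => c (valK π t)) x) (domainE p π m) μ ∧
      lap p f μ π m (fun t => c (valK π t)) x = (1 - q⁻¹) * ∑ j ∈ Finset.range m,
        (c j - c (valK π x)) * q ^ (-|(j : ℤ) - valK π x|) :=
  hμ.integral_domainE_kernel (fun j => c j - c (valK π x)) (valK π x) fun _ hz =>
    hμ.lapIntegrand_comp_valK c (hμ.ne_zero_of_mem_domainE hx) (hμ.ne_zero_of_mem_domainE hz)

/-- The subtracted term is integrated by `geom_kernel_sum`; what remains is radial around `y` and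
vanishes off a ball contained in the domain, so `integral_domainE_radial` applies to it. -/
theorem lapIntegrand_sub_eq (hμ : IsNormalizedHaar p f π μ q) {Ψ : ℕ → ℝ}
    (hφ : ∀ z ∈ domainE p π m, z ≠ y → φ z = Ψ (relVal π z y)) (hx : x ∈ domainE p π m)
    (hy : y ∈ domainE p π m) (hxy : x ≠ y) (hz : z ∈ domainE p π m) (hzy : z ≠ y) :
    lapIntegrand p f π φ x z -
        (Ψ 0 - Ψ (relVal π x y)) * q ^ (valK π z - |valK π z - valK π x|) =
      q ^ (valK π y - |valK π x - valK π y|) * ((Ψ (relVal π z y) - Ψ (relVal π x y)) *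
        q ^ (2 * min (relVal π z y) (relVal π x y)) - (Ψ 0 - Ψ (relVal π x y))) := by
  have hx0 := hμ.ne_zero_of_mem_domainE hx
  have hy0 := hμ.ne_zero_of_mem_domainE hy
  have hz0 := hμ.ne_zero_of_mem_domainE hz
  have hk := hμ.valK_eq_of_relVal_pos hx0 hy0
  have hl := hμ.valK_eq_of_relVal_pos hz0 hy0
  by_cases hlk : relVal π z y = relVal π x y
  · have hzero : lapIntegrand p f π φ x z = 0 := by
      rw [lapIntegrand, hφ z hz hzy, hφ x hx hxy, hlk, sub_self, zero_div, zero_mul]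
    rw [hzero, hlk]
    rcases Nat.eq_zero_or_pos (relVal π x y) with h0 | h0
    · simp [h0]
    · rw [hk h0, hl (hlk ▸ h0)]
      simp only [sub_self, abs_zero, sub_zero, zero_mul, zero_sub]
      ring
  · have hsub := hμ.valK_sub_eq_min_of_relVal_ne hxy hzy hlk
    rw [hμ.valK_sub_eq_min_add_relVal hz0 hy0 hzy, hμ.valK_sub_eq_min_add_relVal hx0 hy0 hxy]
      at hsub
    rw [hμ.lapIntegrand_eq hx0 fun h => hlk (h ▸ rfl), hφ z hz hzy, hφ x hx hxy, hsub,
      ← zpow_natCast q (2 * _)]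
    set k := relVal π x y
    set l := relVal π z y
    rcases Nat.eq_zero_or_pos l with h0 | h0
    · have hvx := hk (by lia)
      rw [h0, show 2 * min (min (valK π z) (valK π y) + (0 : ℕ)) (min (valK π x) (valK π y) + k) -
        valK π x = valK π z - |valK π z - valK π x| by grind]
      simp
    · rw [show 2 * min (min (valK π z) (valK π y) + (l : ℤ)) (min (valK π x) (valK π y) + k) -
          valK π x = valK π y - |valK π x - valK π y| + (2 * min l k : ℕ) by grind,
        zpow_add₀ hμ.q_pos.ne', show valK π z - |valK π z - valK π x| =
          valK π y - |valK π x - valK π y| by grind]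
      ring

theorem lap_eq_relLap [BorelSpace K] (hμ : IsNormalizedHaar p f π μ q) {Ψ : ℕ → ℝ}
    (hΨ : Summable fun l => Ψ l / q ^ l)
    (hφ : ∀ z ∈ domainE p π m, z ≠ y → φ z = Ψ (relVal π z y)) (hx : x ∈ domainE p π m)
    (hy : y ∈ domainE p π m) (hxy : x ≠ y) :
    IntegrableOn (lapIntegrand p f π φ x) (domainE p π m) μ ∧
      lap p f μ π m φ x =
        q ^ (-|valK π x - valK π y|) * relLap q (UK p f π m y) Ψ (relVal π x y) := by
  set k := relVal π x y
  set Θ : ℕ → ℝ := fun l => (Ψ l - Ψ k) * q ^ (2 * min l k) - (Ψ 0 - Ψ k)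
  set e := |valK π x - valK π y|
  have hΘ : HasSum (fun l => Θ l / q ^ l)
      (∑' l, (Ψ l - Ψ k) * q ^ (2 * min l k) / q ^ l - (Ψ 0 - Ψ k) * (1 - q⁻¹)⁻¹) := by
    simpa only [Θ, sub_div] using
      (summable_relLap hμ.one_lt hΨ k).hasSum.sub (hasSum_const_div_pow hμ.one_lt (Ψ 0 - Ψ k))
  have hfar := hμ.integral_domainE_kernel (m := m) (p := p) (fun _ => Ψ 0 - Ψ k) (valK π x)
    fun z _ => rfl
  have hnear := hμ.integral_domainE_radial hy (Ψ := fun l => q ^ (valK π y - e) * Θ l)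
    (by simpa only [mul_div_assoc] using hΘ.summable.mul_left _)
    (by simp [Θ]) fun z hz hzy => hμ.lapIntegrand_sub_eq hφ hx hy hxy hz hzy
  have hint : IntegrableOn (lapIntegrand p f π φ x) (domainE p π m) μ :=
    (hnear.1.add hfar.1).congr_fun (fun z _ => sub_add_cancel _ _) hμ.measurableSet_domainE
  refine ⟨hint, ?_⟩
  obtain ⟨-, hvx_nonneg, hvx_lt⟩ := hμ.mem_domainE_iff.1 hx
  have hsplit := hnear.2
  simp only [mul_div_assoc, tsum_mul_left] at hsplit
  rw [integral_sub hint hfar.1, hfar.2, hΘ.tsum_eq, sub_eq_iff_eq_add, ← Finset.mul_sum,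
    mul_left_comm (1 - q⁻¹), geom_kernel_sum hμ.q_pos hvx_nonneg hvx_lt, sub_eq_add_neg (valK π y),
    zpow_add₀ hμ.q_pos.ne', zpow_neg q (valK π y)] at hsplit
  have hqv := mul_inv_cancel₀ (zpow_pos hμ.q_pos (valK π y)).ne'
  have hq1 := mul_inv_cancel₀ (sub_pos.2 (inv_lt_one_of_one_lt₀ hμ.one_lt)).ne'
  rw [lap, hsplit, relLap, hμ.UK_eq]
  set T := ∑' l, (Ψ l - Ψ k) * q ^ (2 * min l k) / q ^ l
  rcases Nat.eq_zero_or_pos k with h0 | h0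
  · rw [h0]
    linear_combination q ^ (-e) * (1 - q⁻¹) * T * hqv
  · have hv : valK π x = valK π y := hμ.valK_eq_of_relVal_pos (hμ.ne_zero_of_mem_domainE hx)
      (hμ.ne_zero_of_mem_domainE hy) h0
    rw [show e = 0 by simp [e, hv], hv, neg_zero, zpow_zero]
    linear_combination (1 - q⁻¹) * (T - (Ψ 0 - Ψ k) * (1 - q⁻¹)⁻¹) * hqv - (Ψ 0 - Ψ k) * hq1

end IsNormalizedHaar

end Laplacian

section RadialSequences

variable {q U t : ℝ} {Ψ Φ : ℕ → ℝ}

theorem hasSum_pow_div_pow (hq : 0 < q) (ht : |t| < q) :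
    HasSum (fun l : ℕ => t ^ l / q ^ l) (q / (q - t)) := by
  have key := hasSum_geometric_of_abs_lt_one (r := t / q)
    (by rwa [abs_div, abs_of_pos hq, div_lt_one hq])
  rw [one_sub_div hq.ne', inv_div] at key
  simpa only [div_pow] using key

theorem hasSum_natCast_div_pow (hq : 1 < q) :
    HasSum (fun l : ℕ => (l : ℝ) / q ^ l) (q / (q - 1) ^ 2) := by
  have hq0 : q ≠ 0 := (one_pos.trans hq).ne'
  have key := hasSum_coe_mul_geometric_of_norm_lt_one (r := q⁻¹)
    (by rw [Real.norm_of_nonneg (by positivity)]; exact inv_lt_one_of_one_lt₀ hq)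
  rw [show q⁻¹ / (1 - q⁻¹) ^ 2 = q / (q - 1) ^ 2 by
    rw [show 1 - q⁻¹ = (q - 1) / q by field_simp]; field_simp] at key
  simpa only [inv_pow, ← div_eq_mul_inv] using key

theorem relLap_const_add (A : ℝ) (k : ℕ) :
    relLap q U (fun l => A + Ψ l) k = relLap q U Ψ k := by
  simp only [relLap, add_sub_add_left_eq_sub]

theorem relLap_const_mul (c : ℝ) (k : ℕ) :
    relLap q U (fun l => c * Ψ l) k = c * relLap q U Ψ k := by
  simp only [relLap, ← mul_sub, mul_assoc, mul_div_assoc, tsum_mul_left]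
  ring

theorem relLap_add (hq : 1 < q) (hΨ : Summable fun l => Ψ l / q ^ l)
    (hΦ : Summable fun l => Φ l / q ^ l) (k : ℕ) :
    relLap q U (fun l => Ψ l + Φ l) k = relLap q U Ψ k + relLap q U Φ k := by
  simp only [relLap, add_sub_add_comm, add_mul, add_div,
    (summable_relLap hq hΨ k).tsum_add (summable_relLap hq hΦ k)]
  ring

theorem relLap_eq_sum_add_tsum (hq : 1 < q) (hΨ : Summable fun l => Ψ l / q ^ l) (k : ℕ) :
    relLap q U Ψ k = q⁻¹ * (1 - U) * (Ψ 0 - Ψ k) + (1 - q⁻¹) *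
      (∑ l ∈ Finset.range k, (Ψ l - Ψ k) * q ^ l + q ^ k * ∑' j, (Ψ (j + k) - Ψ k) / q ^ j) := by
  rw [relLap, ← (summable_relLap hq hΨ k).sum_add_tsum_nat_add k, ← tsum_mul_left]
  congr 3
  · refine Finset.sum_congr rfl fun l hl => ?_
    rw [min_eq_left (Finset.mem_range.1 hl).le, two_mul, pow_add]
    field_simp
  · refine tsum_congr fun j => ?_
    rw [min_eq_right (by lia), two_mul, pow_add, pow_add]
    field_simp

theorem relLap_pow (hq : 1 < q) (ht : |t| < q) (k : ℕ) :
    relLap q U (fun l => t ^ l) k = (t - 1) / (q - t) + U / q * (t ^ k - 1) +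
      (q + 1) * (1 - t) ^ 2 / (q - t) * ∑ l ∈ Finset.range k, (t * q) ^ l := by
  have hq0 := one_pos.trans hq
  have hq1 := sub_pos.2 hq
  have hqt : 0 < q - t := sub_pos.2 ((le_abs_self t).trans_lt ht)
  have htail : ∑' j : ℕ, (t ^ (j + k) - t ^ k) / q ^ j = t ^ k * (q / (q - t) - q / (q - 1)) := by
    rw [← ((hasSum_pow_div_pow hq0 ht).sub (hasSum_pow_div_pow hq0 (t := 1)
      (by simpa using hq))).tsum_eq, ← tsum_mul_left]
    refine tsum_congr fun j => ?_
    rw [pow_add, one_pow]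
    ring
  have hhead : ∑ l ∈ Finset.range k, (t ^ l - t ^ k) * q ^ l =
      ∑ l ∈ Finset.range k, (t * q) ^ l - t ^ k * ((q ^ k - 1) / (q - 1)) := by
    simp only [sub_mul, ← mul_pow, Finset.sum_sub_distrib, ← Finset.mul_sum, geom_sum_eq hq.ne']
  have hgeom : t ^ k * q ^ k = 1 + (∑ l ∈ Finset.range k, (t * q) ^ l) * (t * q - 1) := by
    rw [geom_sum_mul, ← mul_pow, add_sub_cancel]
  rw [relLap_eq_sum_add_tsum hq (hasSum_pow_div_pow hq0 ht).summable, htail, hhead]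
  set S := ∑ l ∈ Finset.range k, (t * q) ^ l
  field_simp
  linear_combination (t + t * q - 2 * q) * hgeom

theorem sum_range_sub_mul_pow (hq : q ≠ 1) (k : ℕ) : ∑ l ∈ Finset.range k, ((l : ℝ) - k) * q ^ l =
    (k * (q - 1) + q - q ^ (k + 1)) / (q - 1) ^ 2 := by
  induction k with
  | zero => simp
  | succ k ih =>
    have hterm (l : ℕ) : ((l : ℝ) - (k + 1 : ℕ)) * q ^ l = (l - k) * q ^ l - q ^ l := by
      push_cast
      ring
    have hq1 := sub_ne_zero.2 hq
    simp only [hterm, Finset.sum_sub_distrib]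
    rw [Finset.sum_range_succ, ih, geom_sum_eq hq]
    push_cast
    field_simp
    ring

theorem relLap_natCast (hq : 1 < q) (k : ℕ) :
    relLap q U (fun l => (l : ℝ)) k = 1 / (q - 1) + U / q * k := by
  have hq1 := sub_pos.2 hq
  have htail : ∑' j : ℕ, (((j + k : ℕ) : ℝ) - k) / q ^ j = q / (q - 1) ^ 2 := by
    simpa using (hasSum_natCast_div_pow hq).tsum_eq
  rw [relLap_eq_sum_add_tsum hq (hasSum_natCast_div_pow hq).summable, htail,
    sum_range_sub_mul_pow hq.ne']
  field_simp
  ring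

end RadialSequences

section PowerSeries

theorem eq_zero_of_tsum_mul_pow_eq_zero {d : ℕ → ℝ} (hd : Tendsto d atTop (𝓝 0))
    (hd0 : ∀ k, d k ≠ 0) (hd1 : ∀ k, |d k| ≤ 1) {e : ℕ → ℝ} (he : Summable e)
    (h : ∀ k, ∑' n, e n * d k ^ n = 0) (n : ℕ) : e n = 0 := by
  have hterm {e : ℕ → ℝ} (k n : ℕ) : ‖e n * d k ^ n‖ ≤ |e n| := by
    rw [Real.norm_eq_abs, abs_mul, abs_pow]
    exact mul_le_of_le_one_right (abs_nonneg _) (pow_le_one₀ (abs_nonneg _) (hd1 k))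
  have hlead {e : ℕ → ℝ} (he : Summable e) (h : ∀ k, ∑' n, e n * d k ^ n = 0) : e 0 = 0 := by
    have hlim := tendsto_tsum_of_dominated_convergence (f := fun k n => e n * d k ^ n)
      (g := fun n => e n * 0 ^ n) he.abs (fun n => (hd.pow n).const_mul (e n))
      (Eventually.of_forall fun k n => hterm k n)
    rw [tsum_eq_single 0 fun n hn => by simp [hn]] at hlim
    simpa [h] using tendsto_nhds_unique hlim (by simp only [h]; exact tendsto_const_nhds)
  induction n generalizing e with
  | zero => exact hlead he h
  | succ _ ih =>
    refine ih ((summable_nat_add_iff 1).2 he) fun k => ?_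
    have hk := h k
    rw [(Summable.of_norm_bounded he.abs (hterm k)).tsum_eq_zero_add, hlead he h] at hk
    simpa [pow_succ, ← mul_assoc, tsum_mul_right, hd0 k] using hk

variable {q U : ℝ}

theorem hasSum_relLap (hq : 1 < q) {Ψ : ℕ → ℕ → ℝ} {b : ℕ → ℝ} (hb : Summable b)
    (hΨ : ∀ n l, |Ψ n l| ≤ b n) (k : ℕ) :
    HasSum (fun n => relLap q U (Ψ n) k) (relLap q U (fun l => ∑' n, Ψ n l) k) := by
  have hq0 := one_pos.trans hq
  have hsum (l : ℕ) : Summable fun n => Ψ n l := Summable.of_norm_bounded hb fun n => hΨ n l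
  have hgeom : Summable fun l : ℕ => 2 * q ^ (2 * k) * (1 / q ^ l) :=
    (hasSum_const_div_pow hq 1).summable.mul_left _
  have hfamily : Summable fun i : ℕ × ℕ =>
      (Ψ i.2 i.1 - Ψ i.2 k) * q ^ (2 * min i.1 k) / q ^ i.1 := by
    refine Summable.of_norm_bounded (hgeom.mul_of_nonneg hb (fun l => by positivity)
      fun n => (abs_nonneg _).trans (hΨ n 0)) fun i => ?_
    have hdiff : |Ψ i.2 i.1 - Ψ i.2 k| ≤ 2 * b i.2 :=
      (abs_sub _ _).trans (by linarith [hΨ i.2 i.1, hΨ i.2 k])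
    have hpow : q ^ (2 * min i.1 k) ≤ q ^ (2 * k) := pow_le_pow_right₀ hq.le (by lia)
    rw [Real.norm_eq_abs, abs_div, abs_mul, abs_of_pos (pow_pos hq0 (2 * min i.1 k)),
      abs_of_pos (pow_pos hq0 i.1)]
    calc |Ψ i.2 i.1 - Ψ i.2 k| * q ^ (2 * min i.1 k) / q ^ i.1
        ≤ 2 * b i.2 * q ^ (2 * k) / q ^ i.1 := by gcongr; exact (abs_nonneg _).trans hdiff
      _ = 2 * q ^ (2 * k) * (1 / q ^ i.1) * b i.2 := by ring
  have hcol (l : ℕ) : ∑' n, (Ψ n l - Ψ n k) * q ^ (2 * min l k) / q ^ l =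
      (∑' n, Ψ n l - ∑' n, Ψ n k) * q ^ (2 * min l k) / q ^ l := by
    rw [tsum_div_const, tsum_mul_right, (hsum l).tsum_sub (hsum k)]
  have hdouble : HasSum (fun n => ∑' l, (Ψ n l - Ψ n k) * q ^ (2 * min l k) / q ^ l)
      (∑' l, (∑' n, Ψ n l - ∑' n, Ψ n k) * q ^ (2 * min l k) / q ^ l) := by
    simp only [← hcol]
    rw [← Summable.tsum_comm (f := fun l n => (Ψ n l - Ψ n k) * q ^ (2 * min l k) / q ^ l) hfamily]
    exact hfamily.prod_symm.prod.hasSum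
  exact (((hsum 0).hasSum.sub (hsum k).hasSum).mul_left _).add (hdouble.mul_left _)

/-- The value of `A + λ₀ log_q d + ∑_{n ≥ 1} λ_n d ^ n` at `d = q ^ (-l)`. -/
noncomputable def radialSeries (q A lam0 : ℝ) (lam : ℕ → ℝ) (l : ℕ) : ℝ :=
  A + lam0 * (-(l : ℝ)) + ∑' n : ℕ, lam (n + 1) * (q⁻¹ ^ (n + 1)) ^ l

theorem inv_pow_pow_le_one (hq : 1 < q) (n l : ℕ) : (q⁻¹ ^ n) ^ l ≤ 1 :=
  pow_le_one₀ (by positivity) (pow_le_one₀ (by positivity) (inv_le_one_of_one_le₀ hq.le))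

theorem abs_inv_pow_lt (hq : 1 < q) (n : ℕ) : |q⁻¹ ^ n| < q := by
  rw [abs_of_pos (by positivity)]
  exact (pow_le_one₀ (by positivity) (inv_le_one_of_one_le₀ hq.le)).trans_lt hq

theorem abs_mul_inv_pow_pow_le (hq : 1 < q) (a : ℝ) (n l : ℕ) : |a * (q⁻¹ ^ n) ^ l| ≤ |a| := by
  rw [abs_mul, abs_of_nonneg (by positivity : 0 ≤ (q⁻¹ ^ n) ^ l)]
  exact mul_le_of_le_one_right (abs_nonneg _) (inv_pow_pow_le_one hq n l)

theorem summable_tsum_mul_pow_div_pow (hq : 1 < q) {lam : ℕ → ℝ}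
    (hlam : Summable fun n => lam (n + 1)) :
    Summable fun l => (∑' n, lam (n + 1) * (q⁻¹ ^ (n + 1)) ^ l) / q ^ l := by
  have hq0 := one_pos.trans hq
  have hbound (l : ℕ) : |∑' n, lam (n + 1) * (q⁻¹ ^ (n + 1)) ^ l| ≤ ∑' n, |lam (n + 1)| :=
    tsum_of_norm_bounded (f := fun n => lam (n + 1) * (q⁻¹ ^ (n + 1)) ^ l) hlam.abs.hasSum
      fun n => abs_mul_inv_pow_pow_le hq _ _ _
  refine Summable.of_norm_bounded
    (hasSum_const_div_pow hq (∑' n, |lam (n + 1)|)).summable fun l => ?_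
  rw [Real.norm_eq_abs, abs_div, abs_of_pos (pow_pos hq0 l)]
  gcongr
  exact hbound l

theorem summable_radialSeries_div_pow (hq : 1 < q) (A lam0 : ℝ) {lam : ℕ → ℝ}
    (hlam : Summable fun n => lam (n + 1)) :
    Summable fun l => radialSeries q A lam0 lam l / q ^ l := by
  refine (((hasSum_const_div_pow hq A).summable.sub
    ((hasSum_natCast_div_pow hq).summable.mul_left lam0)).add
      (summable_tsum_mul_pow_div_pow hq hlam)).congr fun l => ?_
  rw [radialSeries]
  ring

theorem hasSum_relLap_radialSeries (hq : 1 < q) (A lam0 : ℝ) {lam : ℕ → ℝ}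
    (hlam : Summable fun n => lam (n + 1)) (k : ℕ) :
    HasSum (fun n => lam (n + 1) * relLap q U (fun l => (q⁻¹ ^ (n + 1)) ^ l) k)
      (relLap q U (radialSeries q A lam0 lam) k + lam0 * (1 / (q - 1) + U / q * k)) := by
  have hsplit : radialSeries q A lam0 lam = fun l : ℕ =>
      A + (-lam0 * l + ∑' n, lam (n + 1) * (q⁻¹ ^ (n + 1)) ^ l) := by
    funext l
    rw [radialSeries]
    ring
  have hlin : Summable fun l : ℕ => -lam0 * (l : ℝ) / q ^ l := by
    simpa only [mul_div_assoc] using (hasSum_natCast_div_pow hq).summable.mul_left (-lam0)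
  have hseries := hasSum_relLap (U := U) hq hlam.abs
    (fun n l => abs_mul_inv_pow_pow_le hq (lam (n + 1)) (n + 1) l) k
  simp only [relLap_const_mul] at hseries
  convert hseries using 1
  rw [hsplit, relLap_const_add, relLap_add hq hlin (summable_tsum_mul_pow_div_pow hq hlam),
    relLap_const_mul, relLap_natCast hq]
  ring

theorem relLap_radialSeries_zero (hq : 1 < q) (A lam0 : ℝ) {lam : ℕ → ℝ}
    (hlam : Summable fun n => lam (n + 1)) :
    relLap q U (radialSeries q A lam0 lam) 0 = -(lam0 / (q - 1)) +
      ∑' n, lam (n + 1) * ((q⁻¹ ^ (n + 1) - 1) / (q - q⁻¹ ^ (n + 1))) := by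
  have key := (hasSum_relLap_radialSeries (U := U) hq A lam0 hlam 0).tsum_eq
  simp only [relLap_pow hq (abs_inv_pow_lt hq _)] at key
  simp only [pow_zero, sub_self, mul_zero, Finset.range_zero, Finset.sum_empty, add_zero,
    CharP.cast_eq_zero] at key
  linear_combination -key

/-- The coefficient by which `λ_{n+2}` enters `d ^ (n + 1)` in the expansion of the Laplacian of
`∑ λ_n d ^ n`. -/
noncomputable def shiftCoeff (q : ℝ) (n : ℕ) : ℝ :=
  (q + 1) * (1 - q⁻¹ ^ (n + 2)) ^ 2 / ((1 - q⁻¹ ^ (n + 1)) * (q - q⁻¹ ^ (n + 2)))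

theorem relLap_inv_pow_sub (hq : 1 < q) (n k : ℕ) :
    relLap q U (fun l => (q⁻¹ ^ (n + 2)) ^ l) k - relLap q U (fun l => (q⁻¹ ^ (n + 2)) ^ l) 0 =
      U / q * ((q⁻¹ ^ (n + 2)) ^ k - 1) - shiftCoeff q n * ((q⁻¹ ^ (n + 1)) ^ k - 1) := by
  have hq0 := one_pos.trans hq
  have hlt : q⁻¹ ^ (n + 1) < 1 := pow_lt_one₀ (by positivity) (inv_lt_one_of_one_lt₀ hq) (by lia)
  have hmul : q⁻¹ ^ (n + 2) * q = q⁻¹ ^ (n + 1) := by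
    rw [pow_succ, mul_assoc, inv_mul_cancel₀ hq0.ne', mul_one]
  simp only [relLap_pow hq (abs_inv_pow_lt hq _), hmul, shiftCoeff, geom_sum_eq hlt.ne]
  rw [← neg_sub (q⁻¹ ^ (n + 1)) 1]
  simp only [pow_zero, sub_self, zero_div, mul_zero, add_zero]
  have := (sub_neg.2 hlt).ne
  field_simp
  ring

theorem relLap_inv_sub (hq : 1 < q) (k : ℕ) :
    relLap q U (fun l => q⁻¹ ^ l) k - relLap q U (fun l => q⁻¹ ^ l) 0 =
      U / q * (q⁻¹ ^ k - 1) + (1 - q⁻¹) * k := by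
  have hq0 := one_pos.trans hq
  have hlt : |q⁻¹| < q := by simpa using abs_inv_pow_lt hq 1
  have hden : q ^ 2 - 1 ≠ 0 := (sub_pos.2 (one_lt_pow₀ hq two_ne_zero)).ne'
  simp only [relLap_pow hq hlt, inv_mul_cancel₀ hq0.ne', one_pow, Finset.sum_const,
    Finset.card_range, nsmul_eq_mul, mul_one, pow_zero, sub_self, mul_zero, add_zero,
    CharP.cast_eq_zero]
  field_simp
  ring

theorem shiftCoeff_pos (hq : 1 < q) (n : ℕ) : 0 < shiftCoeff q n := by
  have hlt (k : ℕ) : 0 < 1 - q⁻¹ ^ (k + 1) :=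
    sub_pos.2 (pow_lt_one₀ (by positivity) (inv_lt_one_of_one_lt₀ hq) k.succ_ne_zero)
  have hden : 0 < q - q⁻¹ ^ (n + 2) := sub_pos.2 ((le_abs_self _).trans_lt (abs_inv_pow_lt hq _))
  exact div_pos (mul_pos (by positivity) (pow_pos (hlt (n + 1)) 2)) (mul_pos (hlt n) hden)

theorem shiftCoeff_le (hq : 1 < q) (n : ℕ) :
    shiftCoeff q n ≤ (q + 1) / ((1 - q⁻¹) * (q - 1)) := by
  have hqi := sub_pos.2 (inv_lt_one_of_one_lt₀ hq)
  have h1 : q⁻¹ ^ (n + 1) ≤ q⁻¹ := pow_le_of_le_one (by positivity)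
    (inv_le_one_of_one_le₀ hq.le) (by lia)
  have h2 : q⁻¹ ^ (n + 2) ≤ 1 := pow_le_one₀ (by positivity) (inv_le_one_of_one_le₀ hq.le)
  have h3 : 0 < q⁻¹ ^ (n + 2) := by positivity
  have h4 : 0 < 1 - q⁻¹ ^ (n + 1) := by linarith
  unfold shiftCoeff
  gcongr
  rw [mul_le_iff_le_one_right (by linarith)]
  exact pow_le_one₀ (by linarith) (by linarith)

/-- The coefficient of `d ^ (n + 1)` in the expansion of the Laplacian of `∑ λ_n d ^ n`. -/
noncomputable def lapCoeff (q U : ℝ) (lam : ℕ → ℝ) (n : ℕ) : ℝ :=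
  U / q * lam (n + 1) - shiftCoeff q n * lam (n + 2)

theorem summable_shiftCoeff_mul (hq : 1 < q) {lam : ℕ → ℝ} (hlam : Summable fun n => lam (n + 1)) :
    Summable fun n => shiftCoeff q n * lam (n + 2) := by
  refine Summable.of_norm_bounded
    (((summable_nat_add_iff 1).2 hlam.abs).mul_left ((q + 1) / ((1 - q⁻¹) * (q - 1)))) fun n => ?_
  rw [norm_mul, Real.norm_of_nonneg (shiftCoeff_pos hq n).le, Real.norm_eq_abs]
  exact mul_le_mul_of_nonneg_right (shiftCoeff_le hq n) (abs_nonneg _)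

theorem summable_lapCoeff (hq : 1 < q) {lam : ℕ → ℝ} (hlam : Summable fun n => lam (n + 1)) :
    Summable (lapCoeff q U lam) :=
  (hlam.mul_left _).sub (summable_shiftCoeff_mul hq hlam)

theorem relLap_radialSeries_sub (hq : 1 < q) (A lam0 : ℝ) {lam : ℕ → ℝ}
    (hlam : Summable fun n => lam (n + 1)) (k : ℕ) :
    relLap q U (radialSeries q A lam0 lam) k - relLap q U (radialSeries q A lam0 lam) 0 =
      ((1 - q⁻¹) * lam 1 - U / q * lam0) * k +
        ∑' n, lapCoeff q U lam n * ((q⁻¹ ^ (n + 1)) ^ k - 1) := by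
  have hsum {a : ℕ → ℝ} (ha : Summable a) :
      Summable fun n => a n * ((q⁻¹ ^ (n + 1)) ^ k - 1) := by
    simpa only [mul_sub, mul_one] using
      (Summable.of_norm_bounded ha.abs fun n => abs_mul_inv_pow_pow_le hq (a n) (n + 1) k).sub ha
  have hvalues := ((hasSum_relLap_radialSeries (U := U) hq A lam0 hlam k).sub
    (hasSum_relLap_radialSeries (U := U) hq A lam0 hlam 0))
  have hsplit := hvalues.tsum_eq
  rw [hvalues.summable.tsum_eq_zero_add] at hsplit
  simp only [← mul_sub, zero_add, pow_one, relLap_inv_sub hq, relLap_inv_pow_sub hq] at hsplit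
  have hfirst := (hsum hlam).tsum_eq_zero_add
  simp only [zero_add, pow_one] at hfirst
  have htail : ∑' n, lam (n + 1 + 1) * (U / q * ((q⁻¹ ^ (n + 2)) ^ k - 1) -
      shiftCoeff q n * ((q⁻¹ ^ (n + 1)) ^ k - 1)) =
      U / q * ∑' n, lam (n + 1 + 1) * ((q⁻¹ ^ (n + 1 + 1)) ^ k - 1) -
        ∑' n, shiftCoeff q n * lam (n + 2) * ((q⁻¹ ^ (n + 1)) ^ k - 1) := by
    rw [← tsum_mul_left, ← (((summable_nat_add_iff 1).2 (hsum hlam)).mul_left _).tsum_sub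
      (hsum (summable_shiftCoeff_mul hq hlam))]
    exact tsum_congr fun n => by ring
  have hgoal : ∑' n, lapCoeff q U lam n * ((q⁻¹ ^ (n + 1)) ^ k - 1) =
      U / q * ∑' n, lam (n + 1) * ((q⁻¹ ^ (n + 1)) ^ k - 1) -
        ∑' n, shiftCoeff q n * lam (n + 2) * ((q⁻¹ ^ (n + 1)) ^ k - 1) := by
    rw [← tsum_mul_left, ← ((hsum hlam).mul_left _).tsum_sub
      (hsum (summable_shiftCoeff_mul hq hlam))]
    exact tsum_congr fun n => by rw [lapCoeff]; ring
  rw [hgoal, hfirst]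
  rw [htail] at hsplit
  push_cast at hsplit
  linear_combination -hsplit

/-- The ratio `λ_n / λ₀` singled out by the theorem, with `q = p ^ f` and `U = U_K(y)`. -/
noncomputable def greenCoeff (q U : ℝ) (n : ℕ) : ℝ :=
  U ^ n * ((q ^ (n + 1) - 1) / ((q - 1) * (q + 1) ^ n * (q ^ n - 1)))

theorem greenCoeff_one (hq : 1 < q) : greenCoeff q U 1 = U / (q - 1) := by
  have := (sub_pos.2 hq).ne'
  have : q + 1 ≠ 0 := by linarith
  rw [greenCoeff]
  field_simp
  ring

theorem shiftCoeff_mul_greenCoeff (hq : 1 < q) (n : ℕ) :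
    shiftCoeff q n * greenCoeff q U (n + 2) = U / q * greenCoeff q U (n + 1) := by
  have hpow (k : ℕ) : q ^ (k + 1) - 1 ≠ 0 := (sub_pos.2 (one_lt_pow₀ hq k.succ_ne_zero)).ne'
  have h1 := hpow n
  have h2 := hpow (n + 1)
  have h3 := hpow (n + 2)
  have := (sub_pos.2 hq).ne'
  have : q + 1 ≠ 0 := by linarith
  have hinv (k : ℕ) : q⁻¹ ^ k = (q ^ k)⁻¹ := inv_pow q k
  have hden : q - (q ^ (n + 2))⁻¹ = (q ^ (n + 3) - 1) / q ^ (n + 2) := by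
    field_simp
    ring
  rw [shiftCoeff, greenCoeff, greenCoeff, hinv, hinv, hden]
  have hs1 : 1 - (q ^ (n + 1))⁻¹ = (q ^ (n + 1) - 1) / q ^ (n + 1) := by field_simp
  have hs2 : 1 - (q ^ (n + 2))⁻¹ = (q ^ (n + 2) - 1) / q ^ (n + 2) := by field_simp
  rw [hs1, hs2]
  field_simp
  ring

theorem forall_eq_greenCoeff_mul_iff (hq : 1 < q) {lam0 : ℝ} {lam : ℕ → ℝ} :
    (∀ n, lam (n + 1) = greenCoeff q U (n + 1) * lam0) ↔
      (1 - q⁻¹) * lam 1 = U / q * lam0 ∧ ∀ n, lapCoeff q U lam n = 0 := by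
  have hq1 := (sub_pos.2 hq).ne'
  have hfirst : (1 - q⁻¹) * lam 1 = U / q * lam0 ↔ lam 1 = greenCoeff q U 1 * lam0 := by
    have := (one_pos.trans hq).ne'
    rw [greenCoeff_one hq]
    field_simp
  rw [hfirst]
  refine ⟨fun h => ⟨h 0, fun n => ?_⟩, fun ⟨h0, h⟩ n => ?_⟩
  · rw [lapCoeff, h n, h (n + 1), ← mul_assoc, ← mul_assoc, shiftCoeff_mul_greenCoeff hq, sub_self]
  · induction n with
    | zero => exact h0
    | succ n ih =>
      have hn := sub_eq_zero.1 (h n)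
      rw [ih, ← mul_assoc, ← shiftCoeff_mul_greenCoeff hq, mul_assoc] at hn
      exact (mul_left_cancel₀ (shiftCoeff_pos hq n).ne' hn).symm

theorem eq_zero_of_forall_abs_mul_le {a C : ℝ} (h : ∀ k : ℕ, |a * k| ≤ C) : a = 0 := by
  by_contra ha
  obtain ⟨k, hk⟩ := exists_nat_gt (C / |a|)
  have := h k
  rw [abs_mul, Nat.abs_cast] at this
  exact absurd ((div_lt_iff₀' (abs_pos.2 ha)).1 hk) this.not_gt

theorem eq_zero_of_mul_add_tsum_mul_pow_eq_const (hq : 1 < q) {a b : ℝ} {e : ℕ → ℝ}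
    (he : Summable e) (h : ∀ k : ℕ, 0 < k → a * k + ∑' n, e n * (q⁻¹ ^ (n + 1)) ^ k = b) :
    a = 0 ∧ ∀ n, e n = 0 := by
  have hterm (k n : ℕ) := abs_mul_inv_pow_pow_le hq (e n) (n + 1) k
  have hbound (k : ℕ) : |∑' n, e n * (q⁻¹ ^ (n + 1)) ^ k| ≤ ∑' n, |e n| :=
    tsum_of_norm_bounded (f := fun n => e n * (q⁻¹ ^ (n + 1)) ^ k) he.abs.hasSum (hterm k)
  have ha : a = 0 := by
    refine eq_zero_of_forall_abs_mul_le (C := |b| + ∑' n, |e n|) fun k => ?_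
    rcases k.eq_zero_or_pos with rfl | hk
    · simpa using add_nonneg (abs_nonneg b) (tsum_nonneg fun n => abs_nonneg (e n))
    · rw [eq_sub_of_add_eq (h k hk)]
      exact (abs_sub _ _).trans (by gcongr; exact hbound k)
  have hcoeff := eq_zero_of_tsum_mul_pow_eq_zero (d := fun k => q⁻¹ ^ (k + 1))
    (e := fun n => Nat.casesOn n (-b) e)
    ((tendsto_pow_atTop_nhds_zero_of_lt_one (by positivity)
      (inv_lt_one_of_one_lt₀ hq)).comp (tendsto_add_atTop_nat 1))
    (fun k => by positivity)
    (fun k => by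
      rw [abs_of_pos (by positivity)]
      exact pow_le_one₀ (by positivity) (inv_le_one_of_one_le₀ hq.le))
    ((summable_nat_add_iff 1).1 he) fun k => by
      have hk := h (k + 1) k.succ_pos
      have hsum : Summable fun n => e n * (q⁻¹ ^ (n + 1)) ^ (k + 1) :=
        Summable.of_norm_bounded he.abs (hterm (k + 1))
      simp only [ha, zero_mul, zero_add, pow_right_comm _ _ (k + 1)] at hk hsum
      rw [Summable.tsum_eq_zero_add ((summable_nat_add_iff 1).1 _)]
      · simp only [pow_zero, mul_one, hk]
        exact neg_add_cancel b
      · exact hsum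
  exact ⟨ha, fun n => hcoeff (n + 1)⟩

theorem relLap_radialSeries_const_iff (hq : 1 < q) (A lam0 : ℝ) {lam : ℕ → ℝ}
    (hlam : Summable fun n => lam (n + 1)) :
    (∃ c, ∀ k, 0 < k → relLap q U (radialSeries q A lam0 lam) k = c) ↔
      ∀ n, lam (n + 1) = greenCoeff q U (n + 1) * lam0 := by
  have he := summable_lapCoeff (U := U) hq hlam
  have hsub := relLap_radialSeries_sub (U := U) hq A lam0 hlam
  rw [forall_eq_greenCoeff_mul_iff hq]
  refine ⟨fun ⟨c, hc⟩ => ?_, fun ⟨hlin, hzero⟩ => ⟨relLap q U (radialSeries q A lam0 lam) 0,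
    fun k _ => sub_eq_zero.1 (by simp [hsub, hlin, hzero])⟩⟩
  have hexpand (k : ℕ) (hk : 0 < k) : ((1 - q⁻¹) * lam 1 - U / q * lam0) * k +
        ∑' n, lapCoeff q U lam n * (q⁻¹ ^ (n + 1)) ^ k =
      c - relLap q U (radialSeries q A lam0 lam) 0 + ∑' n, lapCoeff q U lam n := by
    have := hsub k
    simp only [hc k hk, mul_sub, mul_one] at this
    rw [(Summable.of_norm_bounded he.abs fun n =>
      abs_mul_inv_pow_pow_le hq (lapCoeff q U lam n) (n + 1) k).tsum_sub he] at this
    linear_combination -this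
  obtain ⟨hlin, hzero⟩ := eq_zero_of_mul_add_tsum_mul_pow_eq_const hq he hexpand
  exact ⟨sub_eq_zero.1 hlin, hzero⟩

theorem greenCoeff_nonneg (hq : 1 < q) (hU : 0 ≤ U) (n : ℕ) : 0 ≤ greenCoeff q U n := by
  have hpow (k : ℕ) : 0 ≤ q ^ k - 1 := sub_nonneg.2 (one_le_pow₀ hq.le)
  have := hpow n
  have := hpow (n + 1)
  unfold greenCoeff
  positivity

theorem greenCoeff_succ_le (hq : 1 < q) (hU : 0 ≤ U) (n : ℕ) :
    greenCoeff q U (n + 1) ≤ (q + 1) / (q - 1) * (U / (q + 1)) ^ (n + 1) := by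
  have hq1 := sub_pos.2 hq
  have hpow : 0 < q ^ (n + 1) - 1 := sub_pos.2 (one_lt_pow₀ hq n.succ_ne_zero)
  have hratio : (q ^ (n + 2) - 1) / (q ^ (n + 1) - 1) ≤ q + 1 := by
    have hle : q ≤ q ^ (n + 1) := le_self_pow₀ hq.le n.succ_ne_zero
    rw [div_le_iff₀ hpow, pow_succ]
    linarith
  calc greenCoeff q U (n + 1)
      = (U / (q + 1)) ^ (n + 1) * ((q ^ (n + 2) - 1) / (q ^ (n + 1) - 1)) / (q - 1) := by
        rw [greenCoeff, div_pow]
        field_simp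
    _ ≤ (U / (q + 1)) ^ (n + 1) * (q + 1) / (q - 1) := by gcongr
    _ = (q + 1) / (q - 1) * (U / (q + 1)) ^ (n + 1) := by ring

theorem hasSum_div_pow_succ (hq : 1 < q) (hU : 0 ≤ U) (hUq : U < q + 1) :
    HasSum (fun n : ℕ => (U / (q + 1)) ^ (n + 1)) (U / (q + 1 - U)) := by
  have hq2 : 0 < q + 1 := by linarith
  have key := (hasSum_geometric_of_lt_one (div_nonneg hU hq2.le)
    ((div_lt_one hq2).2 hUq)).mul_left (U / (q + 1))
  rw [one_sub_div hq2.ne', inv_div, div_mul_div_cancel₀ hq2.ne'] at key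
  simpa only [pow_succ'] using key

theorem summable_greenCoeff (hq : 1 < q) (hU : 0 ≤ U) (hUq : U < q + 1) :
    Summable fun n => greenCoeff q U (n + 1) :=
  .of_nonneg_of_le (fun n => greenCoeff_nonneg hq hU (n + 1)) (greenCoeff_succ_le hq hU)
    ((hasSum_div_pow_succ hq hU hUq).summable.mul_left _)

theorem relLap_radialSeries_greenCoeff (hq : 1 < q) (hU : 0 ≤ U) (hUq : U < q + 1) (A lam0 : ℝ)
    {lam : ℕ → ℝ} (hlam : ∀ n, lam (n + 1) = greenCoeff q U (n + 1) * lam0) (k : ℕ) :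
    relLap q U (radialSeries q A lam0 lam) k = -(lam0 / (q - 1)) * ((q + 1) / (q + 1 - U)) := by
  have hq1 := (sub_pos.2 hq).ne'
  have hUq' := (sub_pos.2 hUq).ne'
  have hsum : Summable fun n => lam (n + 1) := by
    simpa only [hlam] using (summable_greenCoeff hq hU hUq).mul_right lam0
  have hterm (n : ℕ) : lam (n + 1) * ((q⁻¹ ^ (n + 1) - 1) / (q - q⁻¹ ^ (n + 1))) =
      -(lam0 / (q - 1)) * (U / (q + 1)) ^ (n + 1) := by
    have h1 : q ^ (n + 1) - 1 ≠ 0 := (sub_pos.2 (one_lt_pow₀ hq n.succ_ne_zero)).ne'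
    have h2 : q ^ (n + 2) - 1 ≠ 0 := (sub_pos.2 (one_lt_pow₀ hq (n + 1).succ_ne_zero)).ne'
    have hfactor : (q⁻¹ ^ (n + 1) - 1) / (q - q⁻¹ ^ (n + 1)) =
        -((q ^ (n + 1) - 1) / (q ^ (n + 2) - 1)) := by
      rw [inv_pow, show q - (q ^ (n + 1))⁻¹ = (q ^ (n + 2) - 1) / q ^ (n + 1) by field_simp; ring]
      field_simp
      ring
    rw [hlam, hfactor, greenCoeff, div_pow]
    field_simp
  have hconst : relLap q U (radialSeries q A lam0 lam) k =
      relLap q U (radialSeries q A lam0 lam) 0 := by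
    obtain ⟨hlin, hzero⟩ := (forall_eq_greenCoeff_mul_iff hq).1 hlam
    exact sub_eq_zero.1 (by simp [relLap_radialSeries_sub hq A lam0 hsum k, hlin, hzero])
  rw [hconst, relLap_radialSeries_zero hq A lam0 hsum, tsum_congr hterm, tsum_mul_left,
    (hasSum_div_pow_succ hq hU hUq).tsum_eq]
  field_simp
  ring

end PowerSeries

section Arrays

open Finset

/-- The Laplacian of `x ↦ c (v x)` at a point of valuation `a`;
see `IsNormalizedHaar.lap_comp_valK`. -/
noncomputable def arrayLap (q : ℝ) (m : ℕ) (c : ℤ → ℝ) (a : ℤ) : ℝ :=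
  (1 - q⁻¹) * ∑ j ∈ range m, (c j - c a) * q ^ (-|(j : ℤ) - a|)

/-- The total mass of the kernel of `arrayLap` at `a`. It equals `Λ_a`; see `Lam_eq_kernelMass`. -/
noncomputable def kernelMass (q : ℝ) (m : ℕ) (a : ℤ) : ℝ :=
  (1 - q⁻¹) * ∑ j ∈ range m, q ^ (-|(j : ℤ) - a|)

/-- The equation satisfied by the column with index `r` of the array. -/
def ColumnEq (q : ℝ) (m : ℕ) (α β : ℝ) (r : ℤ) (c : ℤ → ℝ) : Prop :=
  ∀ a : ℤ, 0 ≤ a → a < m → arrayLap q m c a = -α + β * q ^ (-|a - r|)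

/-- The combination of consecutive equations of `ColumnEq` beyond the diagonal entry `r` in which
the term with `β` cancels. It constrains only the entries `c a` with `r ≤ a < m`. -/
def TailEq (q : ℝ) (m : ℕ) (α : ℝ) (r : ℤ) (c : ℤ → ℝ) : Prop :=
  ∀ a : ℤ, r < a → a < m → q * arrayLap q m c a - arrayLap q m c (a - 1) = -(α * (q - 1))

variable {q α β : ℝ} {m : ℕ} {r a j : ℤ} {c c' : ℤ → ℝ}

theorem kernel_pred (hq : q ≠ 0) (h : j < a) : q ^ (-|j - (a - 1)|) = q * q ^ (-|j - a|) := by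
  rw [← zpow_one_add₀ hq, abs_of_nonpos (by lia), abs_of_nonpos (by lia)]
  congr 1
  ring

theorem kernel_succ (hq : q ≠ 0) (h : a < j) : q ^ (-|j - (a + 1)|) = q * q ^ (-|j - a|) := by
  rw [← zpow_one_add₀ hq, abs_of_nonneg (by lia), abs_of_nonneg (by lia)]
  congr 1
  ring

theorem kernel_second_difference (hq : q ≠ 0) (h : j ≠ a) :
    (q + q⁻¹) * q ^ (-|j - a|) - q ^ (-|j - (a - 1)|) - q ^ (-|j - (a + 1)|) = 0 := by
  rcases h.lt_or_gt with h | h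
  · have h1 := kernel_pred hq (h.trans (lt_add_one a))
    rw [add_sub_cancel_right] at h1
    rw [kernel_pred hq h, h1]
    field_simp
    ring
  · have h1 := kernel_succ hq ((sub_one_lt a).trans h)
    rw [sub_add_cancel] at h1
    rw [kernel_succ hq h, h1]
    field_simp
    ring

theorem kernelMass_pos (hq : 1 < q) (hm : 0 < m) (a : ℤ) : 0 < kernelMass q m a :=
  mul_pos (sub_pos.2 (inv_lt_one_of_one_lt₀ hq)) (sum_pos
    (fun _ _ => zpow_pos (one_pos.trans hq) _) (nonempty_range_iff.2 hm.ne'))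

theorem arrayLap_sub (c c' : ℤ → ℝ) (a : ℤ) :
    arrayLap q m (fun j => c j - c' j) a = arrayLap q m c a - arrayLap q m c' a := by
  simp only [arrayLap, ← mul_sub, ← sum_sub_distrib]
  congr 1
  exact sum_congr rfl fun j _ => by ring

theorem sum_arrayLap (c : ℤ → ℝ) : ∑ a ∈ range m, arrayLap q m c a = 0 := by
  have hanti : ∑ a ∈ range m, ∑ j ∈ range m, (c j - c a) * q ^ (-|(j : ℤ) - a|) =
      -∑ a ∈ range m, ∑ j ∈ range m, (c j - c a) * q ^ (-|(j : ℤ) - a|) := by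
    conv_lhs => rw [sum_comm]
    simp only [← sum_neg_distrib]
    refine sum_congr rfl fun a _ => sum_congr rfl fun j _ => ?_
    rw [abs_sub_comm]
    ring
  simp only [arrayLap, ← mul_sum, self_eq_neg.1 hanti, mul_zero]

theorem arrayLap_reflect (c : ℤ → ℝ) (a : ℤ) :
    arrayLap q m (fun j => c (m - 1 - j)) a = arrayLap q m c (m - 1 - a) := by
  rw [arrayLap, arrayLap, ← sum_range_reflect]
  congr 1
  refine sum_congr rfl fun j hj => ?_
  have hj := mem_range.1 hj
  rw [show ((m - 1 - j : ℕ) : ℤ) = m - 1 - j by lia, sub_sub_cancel,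
    show (m : ℤ) - 1 - j - a = -(j - (m - 1 - a)) by ring, abs_neg]

theorem arrayLap_first_difference (c : ℤ → ℝ) (a : ℤ) :
    q * arrayLap q m c a - arrayLap q m c (a - 1) =
      kernelMass q m (a - 1) * (c (a - 1) - c a) + (1 - q⁻¹) * ∑ j ∈ range m,
        (c j - c a) * (q * q ^ (-|(j : ℤ) - a|) - q ^ (-|(j : ℤ) - (a - 1)|)) := by
  simp only [arrayLap, kernelMass, mul_sum, sum_mul, ← sum_sub_distrib, ← sum_add_distrib]
  exact sum_congr rfl fun j _ => by ring

theorem arrayLap_second_difference (hq : q ≠ 0) (c : ℤ → ℝ) (a : ℤ) :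
    (q + q⁻¹) * arrayLap q m c a - arrayLap q m c (a - 1) - arrayLap q m c (a + 1) =
      kernelMass q m (a - 1) * (c (a - 1) - c a) + kernelMass q m (a + 1) * (c (a + 1) - c a) := by
  simp only [arrayLap, kernelMass, mul_sum, sum_mul, ← sum_sub_distrib, ← sum_add_distrib]
  refine sum_congr rfl fun j _ => ?_
  have hkernel : (c j - c a) * ((q + q⁻¹) * q ^ (-|(j : ℤ) - a|) - q ^ (-|(j : ℤ) - (a - 1)|) -
      q ^ (-|(j : ℤ) - (a + 1)|)) = 0 := by
    rcases eq_or_ne (j : ℤ) a with h | h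
    · rw [h, sub_self, zero_mul]
    · rw [kernel_second_difference hq h, mul_zero]
  linear_combination (1 - q⁻¹) * hkernel

theorem TailEq.mono {s : ℤ} (hrs : r ≤ s) (h : TailEq q m α r c) : TailEq q m α s c :=
  fun a ha => h a (hrs.trans_lt ha)

theorem TailEq.congr_add_const (hq : q ≠ 0) (h : TailEq q m α r c) (k : ℝ)
    (hcc : ∀ a, r ≤ a → a < m → c' a = c a + k) : TailEq q m α r c' := by
  intro a hra ham
  rw [← h a hra ham, arrayLap_first_difference, arrayLap_first_difference,
    hcc a hra.le ham, hcc (a - 1) (by lia) (by lia)]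
  congr 2
  · ring
  · refine sum_congr rfl fun j hj => ?_
    have hjm : (j : ℤ) < m := mod_cast mem_range.1 hj
    rcases lt_or_ge (j : ℤ) a with h | h
    · rw [kernel_pred hq h, sub_self, mul_zero, mul_zero]
    · rw [hcc j (by lia) hjm]
      ring

theorem TailEq.eq_last (hq : 1 < q) (hm : 0 < m) (h : TailEq q m 0 r c) (i : ℕ)
    (hi : r ≤ m - 1 - i) : c (m - 1 - i) = c (m - 1) := by
  induction i using Nat.strong_induction_on with
  | _ i ih =>
    rcases i with _ | i
    · simp
    have htail (j : ℤ) (hj : (m : ℤ) - 1 - i ≤ j) (hjm : j < m) : c j = c (m - 1) := by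
      have := ih (m - 1 - j).toNat (by lia) (by lia)
      rwa [show (m : ℤ) - 1 - ((m : ℤ) - 1 - j).toNat = j by lia] at this
    have hi' := h (m - 1 - i) (by lia) (by lia)
    rw [arrayLap_first_difference, sum_eq_zero, mul_zero, add_zero, zero_mul, neg_zero] at hi'
    · have := sub_eq_zero.1 ((mul_eq_zero.1 hi').resolve_left (kernelMass_pos hq hm _).ne')
      rwa [htail (m - 1 - i) le_rfl (by lia), sub_sub, ← Nat.cast_succ] at this
    · intro j hj
      have hjm : (j : ℤ) < m := mod_cast mem_range.1 hj
      rcases lt_or_ge (j : ℤ) (m - 1 - i) with h | h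
      · rw [kernel_pred (by linarith) h, sub_self, mul_zero]
      · rw [htail j h hjm, htail (m - 1 - i) le_rfl (by lia), sub_self, zero_mul]

theorem TailEq.sub_last_eq (hq : 1 < q) (hm : 0 < m) (h : TailEq q m α r c)
    (h' : TailEq q m α r c') (hra : r ≤ a) (ham : a < m) :
    c a - c (m - 1) = c' a - c' (m - 1) := by
  have hdiff : TailEq q m 0 r fun j => c j - c' j := fun a hra ham => by
    rw [arrayLap_sub, arrayLap_sub]
    linear_combination h a hra ham - h' a hra ham
  have := hdiff.eq_last hq hm ((m : ℤ) - 1 - a).toNat (by lia)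
  rw [show (m : ℤ) - 1 - ((m : ℤ) - 1 - a).toNat = a by lia] at this
  linarith

theorem ColumnEq.tailEq (hq : q ≠ 0) (hr : 0 ≤ r) (h : ColumnEq q m α β r c) :
    TailEq q m α r c := by
  intro a hra ham
  have hkernel := kernel_pred hq hra
  rw [abs_sub_comm, abs_sub_comm r] at hkernel
  rw [h a (by lia) ham, h (a - 1) (by lia) (by lia), hkernel]
  ring

theorem ColumnEq.reflect (h : ColumnEq q m α β r c) :
    ColumnEq q m α β (m - 1 - r) fun j => c (m - 1 - j) := by
  intro a h0 h1
  rw [arrayLap_reflect, h _ (by lia) (by lia),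
    show a - ((m : ℤ) - 1 - r) = -((m : ℤ) - 1 - a - r) by ring, abs_neg]

theorem ColumnEq.mul_kernelMass (h : ColumnEq q m α β r c) :
    β * kernelMass q m r = α * (m * (1 - q⁻¹)) := by
  have hsum := sum_arrayLap (q := q) (m := m) c
  rw [sum_congr rfl fun (a : ℕ) ha => h (a : ℤ) (by lia) (mod_cast mem_range.1 ha),
    sum_add_distrib, ← mul_sum, sum_const, card_range, nsmul_eq_mul] at hsum
  rw [kernelMass]
  linear_combination (1 - q⁻¹) * hsum

theorem TailEq.residual_eq (hq : q ≠ 0) (h : TailEq q m α r c) (i : ℕ) (hi : r + i < m) :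
    arrayLap q m c (r + i) - (-α + β * q ^ (-(i : ℤ))) =
      q ^ (-(i : ℤ)) * (arrayLap q m c r - (-α + β)) := by
  induction i with
  | zero => simp
  | succ i ih =>
    have hstep := h (r + (i + 1)) (by lia) (by lia)
    rw [← add_assoc, add_sub_cancel_right] at hstep
    have hi := ih (by lia)
    push_cast
    rw [← add_assoc, neg_add, zpow_add₀ hq, zpow_neg_one]
    field_simp
    linear_combination hstep + hi

theorem columnEq_iff (hq : 1 < q) (hr : 0 ≤ r) (hrm : r < m)
    (hβ : β * kernelMass q m r = α * (m * (1 - q⁻¹))) :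
    ColumnEq q m α β r c ↔
      TailEq q m α r c ∧ TailEq q m α (m - 1 - r) fun j => c (m - 1 - j) := by
  have hq0 : q ≠ 0 := by linarith
  refine ⟨fun h => ⟨h.tailEq hq0 hr, h.reflect.tailEq hq0 (by lia)⟩, fun ⟨h, h'⟩ => ?_⟩
  set ρ := arrayLap q m c r - (-α + β) with hρ
  have hres (a : ℤ) (h0 : 0 ≤ a) (h1 : a < m) :
      arrayLap q m c a - (-α + β * q ^ (-|a - r|)) = q ^ (-|a - r|) * ρ := by
    rcases le_total r a with hra | har
    · have := h.residual_eq (β := β) hq0 (a - r).toNat (by lia)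
      rwa [show ((a - r).toNat : ℤ) = |a - r| by grind,
        show r + |a - r| = a by grind] at this
    · have := h'.residual_eq (β := β) hq0 (r - a).toNat (by lia)
      rwa [show ((r - a).toNat : ℤ) = |a - r| by grind, arrayLap_reflect, arrayLap_reflect,
        show (m : ℤ) - 1 - (m - 1 - r + |a - r|) = a by grind, sub_sub_cancel] at this
  have hsum : ∑ a ∈ range m, (arrayLap q m c a - (-α + β * q ^ (-|(a : ℤ) - r|))) =
      ∑ a ∈ range m, q ^ (-|(a : ℤ) - r|) * ρ :=
    sum_congr rfl fun a ha => hres a (by lia) (mod_cast mem_range.1 ha)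
  rw [sum_sub_distrib, sum_arrayLap, sum_add_distrib, ← mul_sum, ← sum_mul, sum_const, card_range,
    nsmul_eq_mul] at hsum
  have hmass : kernelMass q m r * ρ = 0 := by
    rw [kernelMass] at hβ ⊢
    linear_combination -(1 - q⁻¹) * hsum - hβ
  have hρ0 := (mul_eq_zero.1 hmass).resolve_left (kernelMass_pos hq (by lia) r).ne'
  exact fun a h0 h1 => sub_eq_zero.1 (by rw [hres a h0 h1, hρ0, mul_zero])

theorem symm_columnEq_iff (hq : 1 < q) (hm : 0 < m) {β : ℤ → ℝ}
    (hβ : ∀ r : ℤ, 0 ≤ r → r < m → β r * kernelMass q m r = α * (m * (1 - q⁻¹))) (C : ℤ → ℤ → ℝ) :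
    ((∀ a r : ℤ, 0 ≤ a → a < m → 0 ≤ r → r < m → C a r = C r a) ∧
      ∀ r : ℤ, 0 ≤ r → r < m → ColumnEq q m α (β r) r fun a => C a r) ↔
    (TailEq q m α 0 (fun a => C a 0) ∧
      (∀ a r : ℤ, 0 ≤ r → r ≤ a → a < m → C a r = C a 0 + C (m - 1 - r) 0 - C (m - 1) 0) ∧
      ∀ a r : ℤ, 0 ≤ a → a ≤ r → r < m → C a r = C (m - 1 - a) 0 + C r 0 - C (m - 1) 0) := by
  refine ⟨fun ⟨hsymm, hC⟩ => ?_, fun ⟨htail, hlower, hupper⟩ => ⟨?_, fun r h0 h1 => ?_⟩⟩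
  · have htail (r : ℤ) (h0 : 0 ≤ r) (h1 : r < m) :=
      (columnEq_iff hq h0 h1 (hβ r h0 h1)).1 (hC r h0 h1)
    have htail0 := (htail 0 le_rfl (by lia)).1
    have hlower (a r : ℤ) (h0 : 0 ≤ r) (h1 : r ≤ a) (h2 : a < m) :
        C a r = C a 0 + C (m - 1 - r) 0 - C (m - 1) 0 := by
      have hcol := (htail r h0 (by lia)).1.sub_last_eq hq hm (htail0.mono h0) h1 h2
      have hlast := (htail (m - 1) (by lia) (by lia)).2
      rw [sub_self] at hlast
      have hrow := hlast.sub_last_eq hq hm htail0 (a := m - 1 - r) (by lia) (by lia)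
      simp only [sub_sub_cancel, sub_self] at hrow
      linear_combination hcol + hrow + hsymm (m - 1) r (by lia) (by lia) h0 (by lia) -
        hsymm (m - 1) 0 (by lia) (by lia) le_rfl (by lia)
    refine ⟨htail0, hlower, fun a r h0 h1 h2 => ?_⟩
    rw [hsymm a r h0 (by lia) (by lia) h2, hlower r a h0 h1 h2]
    ring
  · intro a r h0 h1 h2 h3
    rcases le_total a r with h | h
    · rw [hupper a r h0 h h3, hlower r a h0 h h3, add_comm]
    · rw [hlower a r h2 h h1, hupper r a h2 h h1, add_comm]
  · have hq0 : q ≠ 0 := by linarith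
    refine (columnEq_iff hq h0 h1 (hβ r h0 h1)).2 ⟨?_, ?_⟩
    · refine (htail.mono h0).congr_add_const hq0 (C (m - 1 - r) 0 - C (m - 1) 0)
        fun a hra ham => ?_
      rw [hlower a r h0 hra ham, add_sub_assoc]
    · refine (htail.mono (by lia)).congr_add_const hq0 (C r 0 - C (m - 1) 0)
        fun a hra ham => ?_
      rw [hupper _ r (by lia) (by lia) h1, sub_sub_cancel, add_sub_assoc]

theorem tailEq_zero_iff (hq : 1 < q) (c : ℤ → ℝ) :
    TailEq q m α 0 c ↔
      (2 ≤ m → kernelMass q m (m - 2) * (c (m - 2) - c (m - 1)) = -(α * (q - 1))) ∧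
      ∀ a : ℤ, 0 ≤ a → a < m - 2 →
        kernelMass q m a * (c a - c (a + 1)) + kernelMass q m (a + 2) * (c (a + 2) - c (a + 1)) =
          -(α * (q - 1) * (1 - q⁻¹)) := by
  have hq0 : q ≠ 0 := by linarith
  have hlast : q * arrayLap q m c (m - 1) - arrayLap q m c (m - 1 - 1) =
      kernelMass q m (m - 2) * (c (m - 2) - c (m - 1)) := by
    rw [arrayLap_first_difference, sum_eq_zero, mul_zero, add_zero,
      show (m : ℤ) - 1 - 1 = m - 2 by ring]
    intro j hj
    have hjm : (j : ℤ) < m := mod_cast mem_range.1 hj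
    rcases (Int.le_sub_one_of_lt hjm).lt_or_eq with h | h
    · rw [kernel_pred hq0 h, sub_self, mul_zero]
    · rw [h, sub_self, zero_mul]
  have hmid (a : ℤ) := arrayLap_second_difference (m := m) hq0 c (a + 1)
  simp only [add_sub_cancel_right, add_assoc, one_add_one_eq_two] at hmid
  refine ⟨fun h => ⟨fun hm => ?_, fun a h0 h1 => ?_⟩, fun ⟨hlast', hmid'⟩ => ?_⟩
  · rw [← hlast, h _ (by lia) (by lia)]
  · have h1 := h (a + 1) (by lia) (by lia)
    have h2 := h (a + 2) (by lia) (by lia)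
    rw [add_sub_cancel_right] at h1
    rw [show a + 2 - 1 = a + 1 by ring] at h2
    rw [← hmid]
    field_simp
    linear_combination q * h1 - h2
  · have hdescent (i : ℕ) (hi : (i : ℤ) < m - 1) :
        q * arrayLap q m c (m - 1 - i) - arrayLap q m c (m - 1 - i - 1) = -(α * (q - 1)) := by
      induction i with
      | zero => rw [Nat.cast_zero, sub_zero, hlast, hlast' (by lia)]
      | succ i ih =>
        have hi' := ih (by lia)
        have ha := hmid' (m - 1 - i - 2) (by lia) (by lia)
        rw [← hmid, show (m : ℤ) - 1 - i - 2 + 1 = m - 1 - i - 1 by ring, sub_add_cancel] at ha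
        push_cast
        rw [← sub_sub, sub_sub _ 1 1, one_add_one_eq_two]
        field_simp at ha
        refine mul_left_cancel₀ hq0 ?_
        linear_combination ha + hi'
    intro a h0 h1
    have := hdescent ((m : ℤ) - 1 - a).toNat (by lia)
    rwa [show (m : ℤ) - 1 - ((m : ℤ) - 1 - a).toNat = a by lia] at this

variable {p f : ℕ}

theorem Lam_eq_kernelMass (hqe : (p : ℝ) ^ f = q) (hq : 0 < q) (h0 : 0 ≤ a) (h1 : a < m) :
    Lam p f m a = kernelMass q m a := by
  have hz (k : ℤ) : (p : ℝ) ^ (-((f : ℤ) * k)) = q ^ (-k) := by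
    rw [← hqe, ← zpow_natCast (p : ℝ) f, ← zpow_mul, mul_neg]
  have hz1 : (p : ℝ) ^ (-(f : ℤ)) = q⁻¹ := by simpa using hz 1
  rw [kernelMass, geom_kernel_sum hq h0 h1, Lam, hz, hz, hz1, neg_add, zpow_add₀ hq.ne',
    zpow_neg_one, show -((m : ℤ) - a) = -(m - 1 - a) - 1 by ring, zpow_sub_one₀ hq.ne']
  ring

theorem isRecurrent_iff (hqe : (p : ℝ) ^ f = q) (hq : 1 < q) (hm : 0 < m)
    (hα : α * (m * (1 - q⁻¹)) = 1) {β : ℤ → ℝ}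
    (hβ : ∀ r : ℤ, 0 ≤ r → r < m → β r * kernelMass q m r = 1) (C : ℤ → ℤ → ℝ) :
    ((∀ a r : ℤ, 0 ≤ a → a < m → 0 ≤ r → r < m → C a r = C r a) ∧
      ∀ r : ℤ, 0 ≤ r → r < m → ColumnEq q m α (β r) r fun a => C a r) ↔ IsRecurrent p f m C := by
  have hq0 := one_pos.trans hq
  have hm0 : (m : ℝ) ≠ 0 := by positivity
  have hmass (a : ℤ) : kernelMass q m a ≠ 0 := (kernelMass_pos hq hm a).ne'
  have hα' : α * (q - 1) = q / m := by
    field_simp at hα ⊢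
    linear_combination hα
  have hlast : (2 ≤ m → kernelMass q m (m - 2) * (C (m - 2) 0 - C (m - 1) 0) = -(α * (q - 1))) ↔
      (2 ≤ m → C (m - 2) 0 = C (m - 1) 0 - (p : ℝ) ^ f / (m * Lam p f m (m - 2))) := by
    refine forall_congr' fun h => ?_
    have := hmass (m - 2)
    rw [Lam_eq_kernelMass hqe hq0 (by lia) (by lia), hα', hqe]
    field_simp
    constructor <;> intro e <;> linear_combination e
  have hstep : (∀ a : ℤ, 0 ≤ a → a < m - 2 → kernelMass q m a * (C a 0 - C (a + 1) 0) +
        kernelMass q m (a + 2) * (C (a + 2) 0 - C (a + 1) 0) = -(α * (q - 1) * (1 - q⁻¹))) ↔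
      ∀ a : ℤ, 0 ≤ a → a < m - 2 →
        C a 0 = (Lam p f m a + Lam p f m (a + 2)) / Lam p f m a * C (a + 1) 0 -
          Lam p f m (a + 2) / Lam p f m a * C (a + 2) 0 -
            ((p : ℝ) ^ f - 1) / (m * Lam p f m a) := by
    refine forall_congr' fun a => forall_congr' fun h0 => forall_congr' fun h1 => ?_
    have := hmass a
    rw [Lam_eq_kernelMass hqe hq0 (by lia) (by lia), Lam_eq_kernelMass hqe hq0 (by lia) (by lia),
      hα', hqe]
    field_simp
    constructor <;> intro e <;> linear_combination e
  have hle (a : ℤ) : a ≤ (m : ℤ) - 1 ↔ a < m := by lia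
  rw [symm_columnEq_iff hq hm (fun r h0 h1 => (hβ r h0 h1).trans hα.symm), tailEq_zero_iff hq,
    hlast, hstep]
  simp only [← hle]
  exact ⟨fun ⟨⟨hlast, hstep⟩, hlower, hupper⟩ => ⟨hlast, hstep, hlower, hupper⟩,
    fun h => ⟨⟨h.step_last, h.step⟩, h.lower, h.upper⟩⟩

/-- The column with index `0` of the array, indexed from its last entry `c` upwards. -/
noncomputable def firstColumn (p f m : ℕ) (c : ℝ) : ℕ → ℝ
  | 0 => c
  | 1 => c - (p : ℝ) ^ f / (m * Lam p f m (m - 2))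
  | i + 2 =>
    (Lam p f m (m - 3 - i) + Lam p f m (m - 3 - i + 2)) / Lam p f m (m - 3 - i) *
        firstColumn p f m c (i + 1) -
      Lam p f m (m - 3 - i + 2) / Lam p f m (m - 3 - i) * firstColumn p f m c i -
      ((p : ℝ) ^ f - 1) / (m * Lam p f m (m - 3 - i))

theorem exists_isRecurrent (p f : ℕ) (hm : 0 < m) (c : ℝ) :
    ∃ C : ℤ → ℤ → ℝ, IsRecurrent p f m C ∧ C (m - 1) 0 = c := by
  set g : ℤ → ℝ := fun a => firstColumn p f m c ((m : ℤ) - 1 - a).toNat with hg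
  have hgc : g (m - 1) = c := by simp [hg, firstColumn]
  set C : ℤ → ℤ → ℝ := fun a r => g (max a r) + g (m - 1 - min a r) - c with hC
  have hC0 (a : ℤ) (h0 : 0 ≤ a) : C a 0 = g a := by
    simp only [hC, max_eq_left h0, min_eq_right h0, sub_zero, hgc, add_sub_cancel_right]
  refine ⟨C, ⟨fun h2 => ?_, fun a h0 h1 => ?_, fun a r h0 h1 h2 => ?_, fun a r h0 h1 h2 => ?_⟩,
    by rw [hC0 _ (by lia), hgc]⟩
  · rw [hC0 _ (by lia), hC0 _ (by lia), hgc]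
    simp only [hg]
    rw [show ((m : ℤ) - 1 - (m - 2)).toNat = 1 by lia, firstColumn]
  · rw [hC0 _ (by lia), hC0 _ (by lia), hC0 _ (by lia)]
    obtain ⟨i, rfl⟩ : ∃ i : ℕ, a = (m : ℤ) - 3 - i := ⟨((m : ℤ) - 3 - a).toNat, by lia⟩
    simp only [hg]
    rw [show ((m : ℤ) - 1 - (m - 3 - i)).toNat = i + 2 by lia,
      show ((m : ℤ) - 1 - (m - 3 - i + 1)).toNat = i + 1 by lia,
      show ((m : ℤ) - 1 - (m - 3 - i + 2)).toNat = i by lia, firstColumn]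
  · rw [hC0 _ (by lia), hC0 _ (by lia), hC0 _ (by lia), hgc]
    simp only [hC, max_eq_left h1, min_eq_right h1]
  · rw [hC0 _ (by lia), hC0 _ (by lia), hC0 _ (by lia), hgc]
    simp only [hC, max_eq_right h1, min_eq_left h1]
    ring

end Arrays
section GreenSeries

namespace IsNormalizedHaar

variable {p f : ℕ} {K : Type*} [NormedField K] [MeasurableSpace K] {π : K} {μ : Measure K} {q : ℝ}
  {m : ℕ} {x y : K} {lam0 : ℝ}

theorem UK_nonneg (hμ : IsNormalizedHaar p f π μ q) (y : K) : 0 ≤ UK p f π m y := by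
  have := hμ.q_pos
  rw [hμ.UK_eq]
  positivity

theorem lambdaK_eq (hμ : IsNormalizedHaar p f π μ q) (lam0 : ℝ) (n : ℕ) (y : K) :
    lambdaK p f π m lam0 n y = greenCoeff q (UK p f π m y) n * lam0 := by
  simp only [lambdaK, greenCoeff, pow_mul, hμ.pow_eq]

variable [Fact p.Prime] [NormedAlgebra ℚ_[p] K]

theorem exists_mem_domainE (hμ : IsNormalizedHaar p f π μ q) {a : ℤ} (h0 : 0 ≤ a) (ham : a < m) :
    ∃ x ∈ domainE p π m, valK π x = a := by
  obtain ⟨hne, hval⟩ := hμ.norm_eq_zpow_iff.1 (norm_zpow π a)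
  exact ⟨π ^ a, hμ.mem_domainE_iff.2 ⟨hne, by lia⟩, hval⟩

theorem exists_relVal_eq (hμ : IsNormalizedHaar p f π μ q) (hy : y ∈ domainE p π m) {k : ℕ}
    (hk : 0 < k) : ∃ x ∈ domainE p π m, x ≠ y ∧ valK π x = valK π y ∧ relVal π x y = k := by
  have hy0 := hμ.ne_zero_of_mem_domainE hy
  obtain ⟨hxy, hval⟩ := hμ.mem_sphere_zpow_iff (z := y * (1 + π ^ k)) (c := y)
    (k := valK π y + k).1 <| by
      rw [mem_sphere_iff_norm, mul_one_add, add_sub_cancel_left, norm_mul, norm_pow,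
        hμ.norm_eq_zpow_valK hy0, zpow_add₀ hμ.norm_pos.ne', zpow_natCast]
  have hxE := hμ.closedBall_subset_domainE hy (lt_add_one _)
    ((hμ.mem_closedBall_zpow_iff hxy).2 (by lia))
  have hrel : relVal π (y * (1 + π ^ k)) y = k := by
    rw [relVal, hval]
    lia
  exact ⟨_, hxE, hxy,
    hμ.valK_eq_of_relVal_pos (hμ.ne_zero_of_mem_domainE hxE) hy0 (by lia), hrel⟩

theorem exists_ne_of_valK (hμ : IsNormalizedHaar p f π μ q) {a r : ℤ} (h0a : 0 ≤ a) (ham : a < m)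
    (h0r : 0 ≤ r) (hrm : r < m) :
    ∃ x ∈ domainE p π m, ∃ y ∈ domainE p π m, x ≠ y ∧ valK π x = a ∧ valK π y = r := by
  obtain ⟨y, hy, rfl⟩ := hμ.exists_mem_domainE h0r hrm
  obtain rfl | hne := eq_or_ne a (valK π y)
  · obtain ⟨x, hx, hxy, hval, -⟩ := hμ.exists_relVal_eq hy one_pos
    exact ⟨x, hx, y, hy, hxy, hval, rfl⟩
  · obtain ⟨x, hx, rfl⟩ := hμ.exists_mem_domainE h0a ham
    exact ⟨x, hx, y, hy, ne_of_apply_ne _ hne, rfl, rfl⟩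

theorem q_mul_kernelMass (hμ : IsNormalizedHaar p f π μ q) (hy : y ∈ domainE p π m) :
    q * kernelMass q m (valK π y) = q + 1 - UK p f π m y := by
  have hq := hμ.q_pos
  obtain ⟨-, h0, hm⟩ := hμ.mem_domainE_iff.1 hy
  rw [kernelMass, geom_kernel_sum hq h0 hm, hμ.UK_eq]
  field_simp

theorem UK_lt (hμ : IsNormalizedHaar p f π μ q) (hy : y ∈ domainE p π m) :
    UK p f π m y < q + 1 := by
  have hm := hμ.mem_domainE_iff.1 hy
  rw [← sub_pos, ← hμ.q_mul_kernelMass hy]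
  exact mul_pos hμ.q_pos (kernelMass_pos hμ.one_lt (by lia) _)

theorem summable_lambdaK (hμ : IsNormalizedHaar p f π μ q) (lam0 : ℝ) (hy : y ∈ domainE p π m) :
    Summable fun n : ℕ => lambdaK p f π m lam0 (n + 1) y := by
  simpa only [hμ.lambdaK_eq] using
    (summable_greenCoeff hμ.one_lt (hμ.UK_nonneg y) (hμ.UK_lt hy)).mul_right lam0

theorem logSeries_eq (hμ : IsNormalizedHaar p f π μ q) (lam0 : ℝ) (A : K → ℝ) (lam : ℕ → K → ℝ)
    (hx : x ∈ domainE p π m) (hy : y ∈ domainE p π m) (hxy : x ≠ y) :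
    logSeries p f π lam0 A lam x y =
      radialSeries q (A y) lam0 (fun n => lam n y) (relVal π x y) := by
  rw [logSeries, radialSeries, hμ.pow_eq,
    hμ.dist01_eq (hμ.ne_zero_of_mem_domainE hx) (hμ.ne_zero_of_mem_domainE hy) hxy,
    Real.logb_inv, Real.logb_pow, Real.logb_self_eq_one hμ.one_lt, mul_one]
  simp only [inv_pow, ← pow_mul, mul_comm (relVal π x y)]

theorem lap_add {φ ψ : K → ℝ} (hφ : IntegrableOn (lapIntegrand p f π φ x) (domainE p π m) μ)
    (hψ : IntegrableOn (lapIntegrand p f π ψ x) (domainE p π m) μ) :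
    IntegrableOn (lapIntegrand p f π (fun z => φ z + ψ z) x) (domainE p π m) μ ∧
      lap p f μ π m (fun z => φ z + ψ z) x = lap p f μ π m φ x + lap p f μ π m ψ x := by
  have hadd : lapIntegrand p f π (fun z => φ z + ψ z) x =
      fun z => lapIntegrand p f π φ x z + lapIntegrand p f π ψ x z := by
    funext z
    simp only [lapIntegrand]
    ring
  rw [lap, hadd]
  exact ⟨hφ.add hψ, integral_add hφ hψ⟩

variable [BorelSpace K]

theorem lap_logSeries (hμ : IsNormalizedHaar p f π μ q) (lam0 : ℝ) (A : K → ℝ) {lam : ℕ → K → ℝ}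
    (hx : x ∈ domainE p π m) (hy : y ∈ domainE p π m) (hxy : x ≠ y)
    (hlam : Summable fun n => lam (n + 1) y) :
    IntegrableOn (lapIntegrand p f π (fun z => logSeries p f π lam0 A lam z y) x)
        (domainE p π m) μ ∧
      lap p f μ π m (fun z => logSeries p f π lam0 A lam z y) x =
        q ^ (-|valK π x - valK π y|) * relLap q (UK p f π m y)
          (radialSeries q (A y) lam0 fun n => lam n y) (relVal π x y) :=
  hμ.lap_eq_relLap (summable_radialSeries_div_pow hμ.one_lt (A y) lam0 hlam)
    (fun _ hz hzy => hμ.logSeries_eq lam0 A lam hz hy hzy) hx hy hxy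

theorem lap_logSeries_of_eq_lambdaK (hμ : IsNormalizedHaar p f π μ q) (A : K → ℝ)
    {lam : ℕ → K → ℝ} (hx : x ∈ domainE p π m) (hy : y ∈ domainE p π m) (hxy : x ≠ y)
    (hlam : ∀ n, lam (n + 1) y = lambdaK p f π m lam0 (n + 1) y) :
    IntegrableOn (lapIntegrand p f π (fun z => logSeries p f π lam0 A lam z y) x)
        (domainE p π m) μ ∧
      lap p f μ π m (fun z => logSeries p f π lam0 A lam z y) x =
        q ^ (-|valK π x - valK π y|) *
          (-(lam0 / (q - 1)) * ((q + 1) / (q + 1 - UK p f π m y))) := by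
  rw [← relLap_radialSeries_greenCoeff hμ.one_lt (hμ.UK_nonneg y) (hμ.UK_lt hy) (A y) lam0
    (lam := fun n => lam n y) (fun n => (hlam n).trans (hμ.lambdaK_eq ..)) (relVal π x y)]
  exact hμ.lap_logSeries lam0 A hx hy hxy (by simpa only [hlam] using hμ.summable_lambdaK lam0 hy)

theorem eq_lambdaK_of_lap_logSeries_eq (hμ : IsNormalizedHaar p f π μ q) (A : K → ℝ)
    {lam : ℕ → K → ℝ} (hy : y ∈ domainE p π m) (hlam : Summable fun n => lam (n + 1) y)
    (hlap : ∀ x ∈ domainE p π m, ∀ x' ∈ domainE p π m, x ≠ y → x' ≠ y → valK π x = valK π x' →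
      lap p f μ π m (fun z => logSeries p f π lam0 A lam z y) x =
        lap p f μ π m (fun z => logSeries p f π lam0 A lam z y) x') (n : ℕ) :
    lam (n + 1) y = lambdaK p f π m lam0 (n + 1) y := by
  obtain ⟨x', hx', hxy', hval', -⟩ := hμ.exists_relVal_eq hy one_pos
  rw [hμ.lambdaK_eq]
  refine (relLap_radialSeries_const_iff hμ.one_lt (A y) lam0 (lam := fun n => lam n y) hlam).1
    ⟨lap p f μ π m (fun z => logSeries p f π lam0 A lam z y) x', fun k hk => ?_⟩ n
  obtain ⟨x, hx, hxy, hval, rfl⟩ := hμ.exists_relVal_eq hy hk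
  rw [← hlap x hx x' hx' hxy hxy' (hval.trans hval'.symm),
    (hμ.lap_logSeries lam0 A hx hy hxy hlam).2, hval]
  simp

theorem lap_logSeries_congr_valK_iff (hμ : IsNormalizedHaar p f π μ q) (A : K → ℝ)
    {lam : ℕ → K → ℝ} (hlam : ∀ y ∈ domainE p π m, Summable fun n : ℕ => lam (n + 1) y) :
    (∀ x ∈ domainE p π m, ∀ y ∈ domainE p π m, ∀ x' ∈ domainE p π m, ∀ y' ∈ domainE p π m,
      x ≠ y → x' ≠ y' → valK π x = valK π x' → valK π y = valK π y' →
        lap p f μ π m (fun z => logSeries p f π lam0 A lam z y) x =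
          lap p f μ π m (fun z => logSeries p f π lam0 A lam z y') x') ↔
      ∀ y ∈ domainE p π m, ∀ n : ℕ, 1 ≤ n → lam n y = lambdaK p f π m lam0 n y := by
  constructor
  · intro hlap y hy n hn
    obtain ⟨n, rfl⟩ := Nat.exists_eq_add_of_le' hn
    exact hμ.eq_lambdaK_of_lap_logSeries_eq A hy (hlam y hy)
      (fun x hx x' hx' hxy hxy' hval => hlap x hx y hy x' hx' y hy hxy hxy' hval rfl) n
  · intro hcoeff x hx y hy x' hx' y' hy' hxy hxy' hvx hvy
    rw [(hμ.lap_logSeries_of_eq_lambdaK A hx hy hxy fun n => hcoeff y hy _ n.succ_pos).2,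
      (hμ.lap_logSeries_of_eq_lambdaK A hx' hy' hxy' fun n => hcoeff y' hy' _ n.succ_pos).2,
      hμ.UK_eq, hμ.UK_eq, hvx, hvy]

theorem lap_BKm (hμ : IsNormalizedHaar p f π μ q) (lam0 : ℝ) (hx : x ∈ domainE p π m)
    (hy : y ∈ domainE p π m) (hxy : x ≠ y) :
    IntegrableOn (lapIntegrand p f π (fun z => BKm p f π m lam0 z y) x) (domainE p π m) μ ∧
      lap p f μ π m (fun z => BKm p f π m lam0 z y) x =
        q ^ (-|valK π x - valK π y|) *
          (-(lam0 / (q - 1)) * ((q + 1) / (q + 1 - UK p f π m y))) :=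
  hμ.lap_logSeries_of_eq_lambdaK _ hx hy hxy fun _ => rfl

theorem lap_BKm_add (hμ : IsNormalizedHaar p f π μ q) (lam0 : ℝ) (C : ℤ → ℤ → ℝ)
    (hx : x ∈ domainE p π m) (hy : y ∈ domainE p π m) (hxy : x ≠ y) :
    IntegrableOn (lapIntegrand p f π (fun z => BKm p f π m lam0 z y +
        C (valK π z) (valK π y)) x) (domainE p π m) μ ∧
      lap p f μ π m (fun z => BKm p f π m lam0 z y + C (valK π z) (valK π y)) x =
        arrayLap q m (fun a => C a (valK π y)) (valK π x) -
          lam0 * (q + 1) / (q * (q - 1)) / kernelMass q m (valK π y) *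
            q ^ (-|valK π x - valK π y|) := by
  obtain ⟨hBint, hB⟩ := hμ.lap_BKm lam0 hx hy hxy
  obtain ⟨hCint, hC⟩ := hμ.lap_comp_valK (fun a => C a (valK π y)) hx
  have hcoeff : lam0 / (q - 1) * ((q + 1) / (q * kernelMass q m (valK π y))) =
      lam0 * (q + 1) / (q * (q - 1)) / kernelMass q m (valK π y) := by field_simp
  obtain ⟨hint, hadd⟩ := lap_add hBint hCint
  refine ⟨hint, ?_⟩
  rw [hadd, hB, hC, ← hμ.q_mul_kernelMass hy, neg_mul, hcoeff, arrayLap]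
  ring

end IsNormalizedHaar

end GreenSeries
section MultiplicativeMeasure

namespace IsNormalizedHaar

variable {p f : ℕ} {K : Type*} [NormedField K] [MeasurableSpace K] {π : K} {μ : Measure K} {q : ℝ}
  {m : ℕ}

theorem absK_nonneg (hμ : IsNormalizedHaar p f π μ q) (x : K) : 0 ≤ absK p f π x := by
  obtain rfl | hx := eq_or_ne x 0
  · simp [absK]
  · rw [hμ.absK_eq_zpow hx]
    exact zpow_nonneg hμ.q_pos.le _

theorem absK_eq_rpow (hμ : IsNormalizedHaar p f π μ q) (x : K) :
    absK p f π x = ‖x‖ ^ (Real.log q / -Real.log ‖π‖) := by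
  have hlogq : 0 < Real.log q := Real.log_pos hμ.one_lt
  have hlogπ : Real.log ‖π‖ < 0 := Real.log_neg hμ.norm_pos hμ.norm_lt_one
  obtain rfl | hx := eq_or_ne x 0
  · rw [absK, if_pos rfl, norm_zero, Real.zero_rpow (div_pos hlogq (neg_pos.2 hlogπ)).ne']
  · rw [hμ.absK_eq_zpow hx, hμ.norm_eq_zpow_valK hx, Real.rpow_def_of_pos (zpow_pos hμ.norm_pos _),
      Real.log_zpow, ← Real.exp_log (zpow_pos hμ.q_pos _), Real.log_zpow]
    push_cast
    field_simp [hlogπ.ne]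

variable [BorelSpace K]

theorem measurable_absK (hμ : IsNormalizedHaar p f π μ q) : Measurable (absK p f π) := by
  rw [funext hμ.absK_eq_rpow]
  fun_prop

theorem measurable_ofReal_inv_absK (hμ : IsNormalizedHaar p f π μ q) :
    Measurable fun x => ENNReal.ofReal (absK p f π x)⁻¹ :=
  hμ.measurable_absK.inv.ennreal_ofReal

theorem setIntegral_mulMeasure (hμ : IsNormalizedHaar p f π μ q) (g : K → ℝ) {S : Set K}
    (hS : MeasurableSet S) :
    ∫ x in S, g x ∂(mulMeasure p f μ π) = ∫ x in S, (absK p f π x)⁻¹ * g x ∂μ := by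
  rw [mulMeasure, setIntegral_withDensity_eq_setIntegral_toReal_smul
    hμ.measurable_ofReal_inv_absK (.of_forall fun _ => ENNReal.ofReal_lt_top) _ hS]
  simp only [ENNReal.toReal_ofReal (inv_nonneg.2 (hμ.absK_nonneg _)), smul_eq_mul]

variable [Fact p.Prime] [NormedAlgebra ℚ_[p] K]

theorem integrableOn_mulMeasure (hμ : IsNormalizedHaar p f π μ q) {g : K → ℝ}
    (hg : IntegrableOn g (domainE p π m) μ) :
    IntegrableOn g (domainE p π m) (mulMeasure p f μ π) := by
  have hE : MeasurableSet (domainE p π m) := hμ.measurableSet_domainE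
  rw [IntegrableOn, mulMeasure, restrict_withDensity hE,
    integrable_withDensity_iff_integrable_smul' hμ.measurable_ofReal_inv_absK
      (.of_forall fun _ => ENNReal.ofReal_lt_top)]
  simp only [ENNReal.toReal_ofReal (inv_nonneg.2 (hμ.absK_nonneg _)), smul_eq_mul]
  refine hg.bdd_mul (c := q ^ (m : ℤ)) hμ.measurable_absK.inv.aestronglyMeasurable ?_
  filter_upwards [ae_restrict_mem hE] with x hx
  obtain ⟨hx0, -, hxm⟩ := hμ.mem_domainE_iff.1 hx
  rw [hμ.absK_eq_zpow hx0, zpow_neg, inv_inv,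
    Real.norm_of_nonneg (zpow_pos hμ.q_pos _).le]
  exact zpow_le_zpow_right₀ hμ.one_lt.le hxm.le

theorem vol_eq (hμ : IsNormalizedHaar p f π μ q) : vol p f μ π m = m * (1 - q⁻¹) := by
  have hq := hμ.q_pos
  rw [vol, ← measureReal_def, ← mul_one (Measure.real _ _), ← smul_eq_mul, ← setIntegral_const,
    hμ.setIntegral_mulMeasure _ hμ.measurableSet_domainE,
    (hμ.integral_domainE_of_valK (fun j => q ^ j) fun z hz => by
      rw [hμ.absK_eq_zpow (hμ.ne_zero_of_mem_domainE hz), zpow_neg, inv_inv, mul_one]).2]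
  simp [hq.ne', mul_comm]

end IsNormalizedHaar

end MultiplicativeMeasure

section GreenArrays

theorem mul_add_one_div_eq_one_iff {q lam0 : ℝ} (hq : 1 < q) :
    lam0 * (q + 1) / (q * (q - 1)) = 1 ↔ lam0 = q * (q - 1) / (q + 1) := by
  rw [div_eq_one_iff_eq (by positivity), eq_div_iff (by positivity)]

namespace IsNormalizedHaar

variable {p f : ℕ} [Fact p.Prime] {K : Type*} [NormedField K] [NormedAlgebra ℚ_[p] K]
  [MeasurableSpace K] [BorelSpace K] {π : K} {μ : Measure K} {q : ℝ} {m : ℕ} {lam0 : ℝ}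

theorem lap_BKm_add_eq_iff_columnEq (hμ : IsNormalizedHaar p f π μ q) (lam0 : ℝ)
    (C : ℤ → ℤ → ℝ) (α : ℝ) :
    (∀ x ∈ domainE p π m, ∀ y ∈ domainE p π m, x ≠ y →
      lap p f μ π m (fun z => BKm p f π m lam0 z y + C (valK π z) (valK π y)) x = -α) ↔
    ∀ r : ℤ, 0 ≤ r → r < m →
      ColumnEq q m α (lam0 * (q + 1) / (q * (q - 1)) / kernelMass q m r) r fun a => C a r := by
  constructor
  · intro hlap r h0r hrm a h0a ham
    obtain ⟨x, hx, y, hy, hxy, rfl, rfl⟩ := hμ.exists_ne_of_valK h0a ham h0r hrm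
    rw [← hlap x hx y hy hxy, (hμ.lap_BKm_add lam0 C hx hy hxy).2]
    ring
  · intro hcol x hx y hy hxy
    obtain ⟨-, h0x, hxm⟩ := hμ.mem_domainE_iff.1 hx
    obtain ⟨-, h0y, hym⟩ := hμ.mem_domainE_iff.1 hy
    rw [(hμ.lap_BKm_add lam0 C hx hy hxy).2, hcol _ h0y hym _ h0x hxm]
    ring

theorem vol_pos (hμ : IsNormalizedHaar p f π μ q) (hm : 0 < m) : 0 < vol p f μ π m := by
  rw [hμ.vol_eq]
  exact mul_pos (Nat.cast_pos.2 hm) (sub_pos.2 (inv_lt_one_of_one_lt₀ hμ.one_lt))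

theorem one_div_vol_mul (hμ : IsNormalizedHaar p f π μ q) (hm : 0 < m) :
    1 / vol p f μ π m * (m * (1 - q⁻¹)) = 1 := by
  rw [← hμ.vol_eq (f := f), one_div_mul_cancel (hμ.vol_pos hm).ne']

theorem symm_and_lap_iff_isRecurrent (hμ : IsNormalizedHaar p f π μ q) (hm : 0 < m)
    (hlam0 : lam0 = q * (q - 1) / (q + 1)) (C : ℤ → ℤ → ℝ) :
    ((∀ a r : ℤ, 0 ≤ a → a ≤ (m : ℤ) - 1 → 0 ≤ r → r ≤ (m : ℤ) - 1 → C a r = C r a) ∧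
      ∀ x ∈ domainE p π m, ∀ y ∈ domainE p π m, x ≠ y →
        lap p f μ π m (fun z => BKm p f π m lam0 z y + C (valK π z) (valK π y)) x =
          -(1 / vol p f μ π m)) ↔ IsRecurrent p f m C := by
  simp only [Int.le_sub_one_iff, hμ.lap_BKm_add_eq_iff_columnEq]
  refine isRecurrent_iff hμ.pow_eq hμ.one_lt hm (hμ.one_div_vol_mul hm) (fun r _ _ => ?_) C
  rw [(mul_add_one_div_eq_one_iff hμ.one_lt).2 hlam0,
    one_div_mul_cancel (kernelMass_pos hμ.one_lt hm r).ne']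

theorem exists_lap_BKm_add_eq_iff (hμ : IsNormalizedHaar p f π μ q) (hm : 0 < m) :
    (∃ C : ℤ → ℤ → ℝ, ∀ x ∈ domainE p π m, ∀ y ∈ domainE p π m, x ≠ y →
      lap p f μ π m (fun z => BKm p f π m lam0 z y + C (valK π z) (valK π y)) x =
        -(1 / vol p f μ π m)) ↔ lam0 = q * (q - 1) / (q + 1) := by
  constructor
  · rintro ⟨C, hC⟩
    have hmass := ((hμ.lap_BKm_add_eq_iff_columnEq lam0 C _).1 hC 0 le_rfl
      (by lia)).mul_kernelMass
    rwa [hμ.one_div_vol_mul hm, div_mul_cancel₀ _ (kernelMass_pos hμ.one_lt hm 0).ne',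
      mul_add_one_div_eq_one_iff hμ.one_lt] at hmass
  · intro hlam0
    obtain ⟨C, hC, -⟩ := exists_isRecurrent p f hm 0
    exact ⟨C, ((hμ.symm_and_lap_iff_isRecurrent hm hlam0 C).2 hC).2⟩

end IsNormalizedHaar

end GreenArrays

section SymmetricKernel

theorem integral_mul_integral_sub_comm {X : Type*} [MeasurableSpace X] {ν : Measure X}
    [IsFiniteMeasure ν] {k : X → X → ℝ} (hk : Measurable fun w : X × X => k w.1 w.2) {C : ℝ}
    (hC : ∀ x z, ‖k x z‖ ≤ C) (hsymm : ∀ x z, k x z = k z x) {g φ : X → ℝ}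
    (hg : Integrable g ν) (hφ : Integrable φ ν) (hgφ : Integrable (fun x => g x * φ x) ν) :
    ∫ x, g x * ∫ z, (φ z - φ x) * k x z ∂ν ∂ν = ∫ x, φ x * ∫ z, (g z - g x) * k x z ∂ν ∂ν := by
  have hkx (x : X) : AEStronglyMeasurable (k x) ν :=
    (hk.comp measurable_prodMk_left).aestronglyMeasurable
  have hconst (x : X) : Integrable (k x) ν := .of_bound (hkx x) C (.of_forall (hC x))
  have hmass : AEStronglyMeasurable (fun x => ∫ z, k x z ∂ν) ν :=
    hk.stronglyMeasurable.integral_prod_right.aestronglyMeasurable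
  have expand {u v : X → ℝ} (hu : Integrable u ν) (hv : Integrable v ν)
      (huv : Integrable (fun x => u x * v x) ν) :
      ∫ x, u x * ∫ z, (v z - v x) * k x z ∂ν ∂ν =
        ∫ w, u w.1 * v w.2 * k w.1 w.2 ∂(ν.prod ν) - ∫ x, u x * v x * ∫ z, k x z ∂ν ∂ν := by
    have hprod : Integrable (fun w : X × X => u w.1 * v w.2 * k w.1 w.2) (ν.prod ν) :=
      (hu.mul_prod hv).mul_bdd hk.aestronglyMeasurable (.of_forall fun w => hC w.1 w.2)
    have hdiag : Integrable (fun x => u x * v x * ∫ z, k x z ∂ν) ν :=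
      huv.mul_bdd hmass (.of_forall fun x => norm_integral_le_of_norm_le_const (.of_forall (hC x)))
    rw [integral_prod _ hprod, ← integral_sub hprod.integral_prod_left hdiag]
    refine integral_congr_ae (.of_forall fun x => ?_)
    simp only [mul_assoc, sub_mul]
    rw [integral_sub (hv.mul_bdd (hkx x) (.of_forall (hC x))) ((hconst x).const_mul _),
      integral_const_mul, integral_const_mul, mul_sub]
  rw [expand hg hφ hgφ, expand hφ hg (by simpa only [mul_comm] using hgφ), ← integral_prod_swap]
  simp only [Prod.fst_swap, Prod.snd_swap, hsymm, mul_comm (g _) (φ _)]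

end SymmetricKernel

section LocallyConstant

variable {K : Type*} [NormedField K] {π : K} {S : Set K} {N : ℤ} {φ : K → ℝ} {x y : K}

/-- `φ` is constant on each of the balls of radius `‖π‖ ^ N` centred in `S`. With `S` the whole
fundamental domain this is local constancy with a uniform radius; with `S` the complement of a ball
around `y` it describes a Green's function away from its pole. -/
def ConstOnBalls (π : K) (S : Set K) (N : ℤ) (φ : K → ℝ) : Prop :=
  ∀ x ∈ S, ∀ z ∈ closedBall x (‖π‖ ^ N), φ z = φ x

/-- The kernel `|z - x|_K⁻²` of the Laplacian, cut off where `z` is within `‖π‖ ^ N` of `x`. -/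
noncomputable def truncKernel (p f : ℕ) (π : K) (N : ℤ) (x z : K) : ℝ :=
  if dist z x ≤ ‖π‖ ^ N then 0 else (absK p f π (z - x) ^ 2)⁻¹

theorem absK_congr (p f : ℕ) (π : K) (hnorm : ‖x‖ = ‖y‖) : absK p f π x = absK p f π y := by
  classical
  have hzero : x = 0 ↔ y = 0 := by rw [← norm_eq_zero, hnorm, norm_eq_zero]
  rw [absK, absK, valK_congr π hnorm]
  exact if_congr hzero rfl rfl

theorem absK_sub_comm (p f : ℕ) (π x y : K) : absK p f π (x - y) = absK p f π (y - x) :=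
  absK_congr p f π (norm_sub_rev x y)

theorem truncKernel_comm (p f : ℕ) (π : K) (N : ℤ) (x z : K) :
    truncKernel p f π N x z = truncKernel p f π N z x := by
  rw [truncKernel, truncKernel, dist_comm, absK_sub_comm]

namespace IsUniformizer

theorem closedBall_zpow_mem_nhds (hπ : IsUniformizer π) (x : K) (N : ℤ) :
    closedBall x (‖π‖ ^ N) ∈ 𝓝 x :=
  closedBall_mem_nhds x (zpow_pos hπ.norm_pos N)

theorem continuousAt_of_constOnBalls (hπ : IsUniformizer π) (hφ : ConstOnBalls π S N φ)
    (hx : x ∈ S) : ContinuousAt φ x :=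
  continuousAt_const.congr (mem_of_superset (hπ.closedBall_zpow_mem_nhds x N)
    fun z hz => (hφ x hx z hz).symm)

theorem continuousOn_of_constOnBalls (hπ : IsUniformizer π) (hφ : ConstOnBalls π S N φ) :
    ContinuousOn φ S :=
  fun _ hx => (hπ.continuousAt_of_constOnBalls hφ hx).continuousWithinAt

theorem isLocallyConstant_of_constOnBalls (hπ : IsUniformizer π) (hφ : ConstOnBalls π S N φ) :
    IsLocallyConstant fun x : S => φ x :=
  (IsLocallyConstant.iff_eventually_eq _).2 fun x =>
    continuous_subtype_val.continuousAt.eventually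
      (mem_of_superset (hπ.closedBall_zpow_mem_nhds x N) (hφ x x.2))

variable {p : ℕ} [Fact p.Prime] [NormedAlgebra ℚ_[p] K] {m : ℕ}

theorem domainE_mem_nhds (hπ : IsUniformizer π) (hx : x ∈ domainE p π m) :
    domainE p π m ∈ 𝓝 x :=
  mem_of_superset (hπ.closedBall_zpow_mem_nhds x m)
    (hπ.closedBall_subset_domainE hx (hπ.mem_domainE_iff.1 hx).2.2)

variable [ProperSpace K]

theorem isCompact_domainE (hπ : IsUniformizer π) : IsCompact (domainE p π m) := by
  rw [hπ.domainE_eq_iUnion_sphere]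
  exact isCompact_iUnion fun j => isCompact_sphere 0 _

theorem exists_constOnBalls (hπ : IsUniformizer π)
    (hφ : IsLocallyConstant fun x : domainE p π m => φ x) :
    ∃ N : ℤ, m ≤ N ∧ ConstOnBalls π (domainE p π m) N φ := by
  have : CompactSpace (domainE p π m) := isCompact_iff_compactSpace.1 hπ.isCompact_domainE
  obtain ⟨δ, hδ, hball⟩ := lebesgue_number_lemma_of_metric isCompact_univ
    (fun c : ℝ => hφ.isOpen_fiber c) fun x _ => Set.mem_iUnion.2 ⟨φ x, rfl⟩
  obtain ⟨n, hn⟩ := exists_pow_lt_of_lt_one hδ hπ.norm_lt_one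
  refine ⟨max m n, le_max_left _ _, fun x hx z hz => ?_⟩
  have hzE : z ∈ domainE p π m := hπ.closedBall_subset_domainE hx
    ((hπ.mem_domainE_iff.1 hx).2.2.trans_le (le_max_left _ _)) hz
  have hzx : dist z x < δ :=
    (mem_closedBall.1 (hπ.closedBall_zpow_anti x (le_max_right _ _) hz)).trans_lt
      (by simpa using hn)
  obtain ⟨c, hc⟩ := hball ⟨x, hx⟩ (Set.mem_univ _)
  exact (hc (show (⟨z, hzE⟩ : domainE p π m) ∈ ball ⟨x, hx⟩ δ from hzx)).trans
    (hc (mem_ball_self hδ)).symm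

end IsUniformizer

namespace IsNormalizedHaar

variable [MeasurableSpace K] {μ : Measure K} {p f : ℕ} {q : ℝ}

theorem isLocallyFiniteMeasure (hμ : IsNormalizedHaar p f π μ q) : IsLocallyFiniteMeasure μ :=
  ⟨fun x => ⟨_, hμ.closedBall_zpow_mem_nhds x 0, (hμ.measure_closedBall_ne_top x 0).lt_top⟩⟩

theorem norm_truncKernel_le (hμ : IsNormalizedHaar p f π μ q) (N : ℤ) (x z : K) :
    ‖truncKernel p f π N x z‖ ≤ q ^ (2 * N) := by
  rw [truncKernel]
  split_ifs with h
  · simpa using zpow_nonneg hμ.q_pos.le _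
  · have hzx : z ≠ x := by
      rintro rfl
      exact h (by simpa using zpow_nonneg hμ.norm_pos.le N)
    rw [← mem_closedBall, hμ.mem_closedBall_zpow_iff hzx] at h
    rw [hμ.absK_eq_zpow (sub_ne_zero.2 hzx), ← zpow_natCast, ← zpow_mul, ← zpow_neg,
      Real.norm_of_nonneg (zpow_nonneg hμ.q_pos.le _)]
    exact zpow_le_zpow_right₀ hμ.one_lt.le (by push_cast; lia)

theorem measurable_truncKernel [BorelSpace K] [SecondCountableTopology K]
    (hμ : IsNormalizedHaar p f π μ q) (N : ℤ) :
    Measurable fun w : K × K => truncKernel p f π N w.1 w.2 := by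
  have := hμ.measurable_absK
  exact Measurable.ite (measurableSet_le (by fun_prop) measurable_const) measurable_const
    (by fun_prop)

theorem mulMeasure_closedBall_ne_zero [BorelSpace K] (hμ : IsNormalizedHaar p f π μ q)
    (c : K) (N : ℤ) :
    mulMeasure p f μ π (closedBall c (‖π‖ ^ N)) ≠ 0 := by
  have hac : μ ≪ mulMeasure p f μ π := by
    refine withDensity_absolutelyContinuous' hμ.measurable_ofReal_inv_absK.aemeasurable ?_
    filter_upwards [measure_eq_zero_iff_ae_notMem.1 (hμ.nonatomic 0)] with x hx
    rw [hμ.absK_eq_zpow hx, Ne, ENNReal.ofReal_eq_zero, not_le]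
    exact inv_pos.2 (zpow_pos hμ.q_pos _)
  refine mt (@hac _) ?_
  rw [hμ.measure_closedBall]
  exact (ENNReal.ofReal_pos.2 (zpow_pos hμ.q_pos _)).ne'

variable [Fact p.Prime] [NormedAlgebra ℚ_[p] K] {m : ℕ}

theorem inv_absK_mul_lap (hμ : IsNormalizedHaar p f π μ q) (hφ : ConstOnBalls π S N φ)
    (hxS : x ∈ S) (hx : x ≠ 0) : (absK p f π x)⁻¹ * lap p f μ π m φ x =
      ∫ z in domainE p π m, (φ z - φ x) * truncKernel p f π N x z ∂μ := by
  have habs : absK p f π x ≠ 0 := by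
    rw [hμ.absK_eq_zpow hx]
    exact (zpow_pos hμ.q_pos _).ne'
  rw [lap, ← integral_const_mul]
  congr 1
  funext z
  rw [lapIntegrand, truncKernel]
  split_ifs with h
  · simp [hφ x hxS z h]
  · field_simp

variable [BorelSpace K] [ProperSpace K] {g : K → ℝ}

theorem integrableOn_of_constOnBalls (hμ : IsNormalizedHaar p f π μ q)
    (hφ : ConstOnBalls π (domainE p π m) N φ) : IntegrableOn φ (domainE p π m) μ :=
  have := hμ.isLocallyFiniteMeasure
  (hμ.continuousOn_of_constOnBalls hφ).integrableOn_compact hμ.isCompact_domainE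

theorem isFiniteMeasure_restrict_domainE (hμ : IsNormalizedHaar p f π μ q) :
    IsFiniteMeasure (μ.restrict (domainE p π m)) :=
  have := hμ.isLocallyFiniteMeasure
  isFiniteMeasure_restrict.2 (hμ.isCompact_domainE (p := p)).measure_ne_top

theorem integral_mul_lap (hμ : IsNormalizedHaar p f π μ q)
    (hφ : ConstOnBalls π (domainE p π m) N φ) (hg : IntegrableOn g (domainE p π m) μ) :
    ∫ x in domainE p π m, g x * lap p f μ π m φ x ∂(mulMeasure p f μ π) =
      ∫ x in domainE p π m, φ x *
        ∫ z in domainE p π m, (g z - g x) * truncKernel p f π N x z ∂μ ∂μ := by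
  have := hμ.isFiniteMeasure_restrict_domainE (m := m) (p := p)
  rw [hμ.setIntegral_mulMeasure _ hμ.measurableSet_domainE,
    ← integral_mul_integral_sub_comm (hμ.measurable_truncKernel N) (hμ.norm_truncKernel_le N)
      (truncKernel_comm p f π N) hg (hμ.integrableOn_of_constOnBalls hφ)
      (hg.mul_continuousOn (hμ.continuousOn_of_constOnBalls hφ) hμ.isCompact_domainE)]
  refine setIntegral_congr_fun hμ.measurableSet_domainE fun x hx => ?_
  rw [← hμ.inv_absK_mul_lap hφ hx (hμ.ne_zero_of_mem_domainE hx), mul_left_comm]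

theorem integral_lap_eq_zero (hμ : IsNormalizedHaar p f π μ q)
    (hφ : ConstOnBalls π (domainE p π m) N φ) :
    ∫ x in domainE p π m, lap p f μ π m φ x ∂(mulMeasure p f μ π) = 0 := by
  have hone : ConstOnBalls π (domainE p π m) N fun _ => 1 := fun _ _ _ _ => rfl
  simpa using hμ.integral_mul_lap hφ (hμ.integrableOn_of_constOnBalls hone)

end IsNormalizedHaar

end LocallyConstant

section GreenFunction

/-- The function `B_{K,m}(x,y) + C(v_K(x), v_K(y))`. -/
noncomputable def greenFn {K : Type*} [NormedField K] (p f : ℕ) (π : K) (m : ℕ) (lam0 : ℝ)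
    (C : ℤ → ℤ → ℝ) (x y : K) : ℝ :=
  BKm p f π m lam0 x y + C (valK π x) (valK π y)

theorem IsRecurrent.symm {p f m : ℕ} {C : ℤ → ℤ → ℝ} (hC : IsRecurrent p f m C) {a r : ℤ}
    (h0a : 0 ≤ a) (ham : a < m) (h0r : 0 ≤ r) (hrm : r < m) : C a r = C r a := by
  rcases le_total a r with hle | hle
  · rw [hC.upper a r h0a hle (by lia), hC.lower r a h0a hle (by lia), add_comm (C r 0)]
  · rw [hC.lower a r h0r hle (by lia), hC.upper r a h0r hle (by lia), add_comm (C a 0)]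

theorem IsRecurrent.add_const {p f m : ℕ} {C : ℤ → ℤ → ℝ} (hC : IsRecurrent p f m C)
    (hLam : ∀ a : ℤ, 0 ≤ a → a < m → Lam p f m a ≠ 0) (k : ℝ) :
    IsRecurrent p f m fun a r => C a r + k where
  step_last hm2 := by rw [hC.step_last hm2]; ring
  step a h0a ha := by
    have := hLam a h0a (by lia)
    rw [hC.step a h0a ha]
    field_simp
    ring
  lower a r h0r hra ham := by rw [hC.lower a r h0r hra ham]; ring
  upper a r h0a har hrm := by rw [hC.upper a r h0a har hrm]; ring

section RadialFunctions

variable {p f : ℕ} [Fact p.Prime] {K : Type*} [NormedField K] [NormedAlgebra ℚ_[p] K] {π : K}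
  {m : ℕ} {x y z : K} {N : ℤ} {g : K → ℝ} {Ψ : ℕ → ℝ} {c : ℤ → ℝ}

theorem lap_sub_const [MeasurableSpace K] {μ : Measure K} (φ : K → ℝ) (a : ℝ) (x : K) :
    lap p f μ π m (fun z => φ z - a) x = lap p f μ π m φ x := by
  simp only [lap, lapIntegrand, sub_sub_sub_cancel_right]

namespace IsUniformizer

theorem exists_notMem_closedBall (hπ : IsUniformizer π) (m : ℕ) (hxy : x ≠ y) :
    ∃ N : ℤ, m ≤ N ∧ x ∉ closedBall y (‖π‖ ^ N) := by
  refine ⟨max m (valK π (x - y) + 1), le_max_left _ _, ?_⟩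
  rw [hπ.mem_closedBall_zpow_iff hxy]
  lia

theorem constOnBalls_of_radial (hπ : IsUniformizer π) (hN : m ≤ N)
    (hg : ∀ z ∈ domainE p π m, z ≠ y → g z = Ψ (relVal π z y) + c (valK π z)) :
    ConstOnBalls π (domainE p π m \ closedBall y (‖π‖ ^ N)) N g := by
  have := hπ.isUltrametricDist
  rintro x ⟨hx, hxy⟩ z hz
  have hlt : valK π x < N := (hπ.mem_domainE_iff.1 hx).2.2.trans_le hN
  have hyx : y ∉ closedBall x (‖π‖ ^ N) := by rwa [mem_closedBall_comm]
  have hself : y ∈ closedBall y (‖π‖ ^ N) := mem_closedBall_self (zpow_pos hπ.norm_pos N).le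
  rw [hg z (hπ.closedBall_subset_domainE hx hlt hz) (by rintro rfl; exact hyx hz),
    hg x hx (by rintro rfl; exact hxy hself), relVal, relVal,
    valK_congr π (norm_sub_eq_of_mem_closedBall hyx hz),
    valK_congr π (hπ.norm_eq_of_mem_closedBall (hπ.ne_zero_of_mem_domainE hx) hlt hz)]

theorem continuousOn_of_radial (hπ : IsUniformizer π)
    (hg : ∀ z ∈ domainE p π m, z ≠ y → g z = Ψ (relVal π z y) + c (valK π z)) :
    ContinuousOn g (domainE p π m \ {y}) := by
  rintro x ⟨hx, hxy⟩
  obtain ⟨N, hN, hxN⟩ := hπ.exists_notMem_closedBall m hxy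
  exact (hπ.continuousAt_of_constOnBalls (hπ.constOnBalls_of_radial hN hg)
    ⟨hx, hxN⟩).continuousWithinAt

end IsUniformizer

namespace IsNormalizedHaar

variable [MeasurableSpace K] {μ : Measure K} {q : ℝ} {lam0 : ℝ}

theorem exists_BKm_eq_radial (hμ : IsNormalizedHaar p f π μ q) (lam0 : ℝ)
    (hy : y ∈ domainE p π m) : ∃ Ψ : ℕ → ℝ, Ψ 0 = 0 ∧ (Summable fun l => Ψ l / q ^ l) ∧
      ∀ x ∈ domainE p π m, x ≠ y → BKm p f π m lam0 x y = Ψ (relVal π x y) :=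
  ⟨_, by simp [radialSeries], summable_radialSeries_div_pow hμ.one_lt _ _
    (hμ.summable_lambdaK lam0 hy), fun _ hx hxy => hμ.logSeries_eq lam0 _ _ hx hy hxy⟩

theorem BKm_symm (hμ : IsNormalizedHaar p f π μ q) (lam0 : ℝ) (hx : x ∈ domainE p π m)
    (hy : y ∈ domainE p π m) : BKm p f π m lam0 x y = BKm p f π m lam0 y x := by
  obtain rfl | hxy := eq_or_ne x y
  · rfl
  have hx0 := hμ.ne_zero_of_mem_domainE hx
  have hy0 := hμ.ne_zero_of_mem_domainE hy
  have hcomm := hμ.relVal_comm hx0 hy0 hxy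
  rcases Nat.eq_zero_or_pos (relVal π x y) with hzero | hpos
  · obtain ⟨Ψ, hΨ, -, hΨy⟩ := hμ.exists_BKm_eq_radial lam0 hy
    obtain ⟨Φ, hΦ, -, hΦx⟩ := hμ.exists_BKm_eq_radial lam0 hx
    rw [hΨy x hx hxy, hΦx y hy hxy.symm, ← hcomm, hzero, hΨ, hΦ]
  · have hval := hμ.valK_eq_of_relVal_pos hx0 hy0 hpos
    have hlambda (n : ℕ) : lambdaK p f π m lam0 n x = lambdaK p f π m lam0 n y := by
      rw [lambdaK, lambdaK, UK, UK, hval]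
    rw [BKm, BKm, hμ.logSeries_eq lam0 _ _ hx hy hxy, hμ.logSeries_eq lam0 _ _ hy hx hxy.symm,
      ← hcomm]
    simp only [hlambda]

theorem exists_greenFn_eq_radial (hμ : IsNormalizedHaar p f π μ q) (lam0 : ℝ) (C : ℤ → ℤ → ℝ)
    (hy : y ∈ domainE p π m) : ∃ Ψ : ℕ → ℝ, Ψ 0 = 0 ∧ (Summable fun l => Ψ l / q ^ l) ∧
      ∀ x ∈ domainE p π m, x ≠ y →
        greenFn p f π m lam0 C x y = Ψ (relVal π x y) + C (valK π x) (valK π y) := by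
  obtain ⟨Ψ, hzero, hΨ, hB⟩ := hμ.exists_BKm_eq_radial lam0 hy
  exact ⟨Ψ, hzero, hΨ, fun x hx hxy => by rw [greenFn, hB x hx hxy]⟩

theorem ae_ne (hμ : IsNormalizedHaar p f π μ q) (y : K) :
    ∀ᵐ x ∂(mulMeasure p f μ π).restrict (domainE p π m), x ≠ y :=
  ae_restrict_of_ae ((withDensity_absolutelyContinuous _ _).ae_le
    (measure_eq_zero_iff_ae_notMem.1 (hμ.nonatomic y)))

variable [BorelSpace K]

theorem integrableOn_of_radial (hμ : IsNormalizedHaar p f π μ q) (hy : y ∈ domainE p π m)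
    (hΨ : Summable fun l => Ψ l / q ^ l) (hzero : Ψ 0 = 0)
    (hg : ∀ z ∈ domainE p π m, z ≠ y → g z = Ψ (relVal π z y) + c (valK π z)) :
    IntegrableOn g (domainE p π m) μ := by
  have hval := (hμ.integral_domainE_of_valK (m := m) (p := p) c fun z _ => rfl).1
  have hrad := (hμ.integral_domainE_radial hy hΨ hzero (g := fun z => g z - c (valK π z))
    fun z hz hzy => by rw [hg z hz hzy, add_sub_cancel_right]).1
  exact (hrad.add hval).congr_fun (fun z _ => sub_add_cancel _ _) hμ.measurableSet_domainE

theorem isSymmGreen_congr (hμ : IsNormalizedHaar p f π μ q) {G G' : K → K → ℝ}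
    (hG : IsSymmGreen p f μ π m G)
    (heq : ∀ x ∈ domainE p π m, ∀ y ∈ domainE p π m, x ≠ y → G' x y = G x y) :
    IsSymmGreen p f μ π m G' := by
  have hae : ∀ y ∈ domainE p π m,
      ∀ᵐ x ∂(mulMeasure p f μ π).restrict (domainE p π m), G' x y = G x y := by
    intro y hy
    filter_upwards [hμ.ae_ne y, ae_restrict_mem hμ.measurableSet_domainE] with x hxy hx
    exact heq x hx y hy hxy
  refine ⟨fun x hx y hy => ?_, fun y hy => ?_, fun y hy => ?_, fun y hy φ hφ => ?_⟩
  · obtain rfl | hxy := eq_or_ne x y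
    · rfl
    · rw [heq x hx y hy hxy, heq y hy x hx hxy.symm, hG.symm x hx y hy]
  · exact (hG.continuousOn y hy).congr fun x hx => heq x hx.1 y hy hx.2
  · exact (integrable_congr (hae y hy)).2 (hG.integrableOn y hy)
  · rw [← hG.green y hy φ hφ]
    refine integral_congr_ae ?_
    filter_upwards [hae y hy] with x hx
    rw [hx]

theorem integral_mul_lap_of_lap_eq [ProperSpace K] (hμ : IsNormalizedHaar p f π μ q)
    (hy : y ∈ domainE p π m) {φ : K → ℝ} (hφ : ConstOnBalls π (domainE p π m) N φ)
    (hg : IntegrableOn g (domainE p π m) μ)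
    (hgN : ConstOnBalls π (domainE p π m \ closedBall y (‖π‖ ^ N)) N g) {α : ℝ}
    (hlap : ∀ x ∈ domainE p π m, x ≠ y → lap p f μ π m g x = -α) :
    ∫ x in domainE p π m, g x * lap p f μ π m φ x ∂(mulMeasure p f μ π) =
      α * (vol p f μ π m * φ y - ∫ x in domainE p π m, φ x ∂(mulMeasure p f μ π)) := by
  have hE : MeasurableSet (domainE p π m) := hμ.measurableSet_domainE
  set ψ : K → ℝ := fun x => φ x - φ y
  have hψ : ConstOnBalls π (domainE p π m) N ψ := fun x hx z hz => by simp only [ψ, hφ x hx z hz]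
  have hconst : ConstOnBalls π (domainE p π m) N fun _ => φ y := fun _ _ _ _ => rfl
  calc ∫ x in domainE p π m, g x * lap p f μ π m φ x ∂(mulMeasure p f μ π)
      = ∫ x in domainE p π m, g x * lap p f μ π m ψ x ∂(mulMeasure p f μ π) := by
        simp only [ψ, lap_sub_const]
    _ = ∫ x in domainE p π m, (absK p f π x)⁻¹ * (-α * ψ x) ∂μ := by
        rw [hμ.integral_mul_lap hψ hg]
        refine setIntegral_congr_fun hE fun x hx => ?_
        by_cases hxy : x ∈ closedBall y (‖π‖ ^ N)
        · simp [show ψ x = 0 from sub_eq_zero.2 (hφ y hy x hxy)]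
        · have hne : x ≠ y := by
            rintro rfl
            exact hxy (mem_closedBall_self (zpow_pos hμ.norm_pos N).le)
          rw [← hμ.inv_absK_mul_lap hgN ⟨hx, hxy⟩ (hμ.ne_zero_of_mem_domainE hx), hlap x hx hne]
          ring
    _ = -α * ∫ x in domainE p π m, ψ x ∂(mulMeasure p f μ π) := by
        rw [← hμ.setIntegral_mulMeasure _ hE, integral_const_mul]
    _ = α * (vol p f μ π m * φ y - ∫ x in domainE p π m, φ x ∂(mulMeasure p f μ π)) := by
        rw [integral_sub (hμ.integrableOn_mulMeasure (hμ.integrableOn_of_constOnBalls hφ))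
          (hμ.integrableOn_mulMeasure (hμ.integrableOn_of_constOnBalls hconst)),
          setIntegral_const, smul_eq_mul, measureReal_def, ← vol]
        ring

theorem lap_greenFn (hμ : IsNormalizedHaar p f π μ q) (hm : 0 < m)
    (hlam0 : lam0 = q * (q - 1) / (q + 1)) {C : ℤ → ℤ → ℝ} (hC : IsRecurrent p f m C)
    (hx : x ∈ domainE p π m) (hy : y ∈ domainE p π m) (hxy : x ≠ y) :
    lap p f μ π m (fun z => greenFn p f π m lam0 C z y) x = -(1 / vol p f μ π m) :=
  ((hμ.symm_and_lap_iff_isRecurrent hm hlam0 C).2 hC).2 x hx y hy hxy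

theorem isSymmGreen_greenFn [ProperSpace K] (hμ : IsNormalizedHaar p f π μ q) (hm : 0 < m)
    (hlam0 : lam0 = q * (q - 1) / (q + 1)) {C : ℤ → ℤ → ℝ} (hC : IsRecurrent p f m C) :
    IsSymmGreen p f μ π m (greenFn p f π m lam0 C) where
  symm x hx y hy := by
    obtain ⟨-, h0x, hxm⟩ := hμ.mem_domainE_iff.1 hx
    obtain ⟨-, h0y, hym⟩ := hμ.mem_domainE_iff.1 hy
    rw [greenFn, greenFn, hμ.BKm_symm lam0 hx hy, hC.symm h0x hxm h0y hym]
  continuousOn y hy := by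
    obtain ⟨Ψ, -, -, hG⟩ := hμ.exists_greenFn_eq_radial lam0 C hy
    exact hμ.continuousOn_of_radial (c := fun a => C a (valK π y)) hG
  integrableOn y hy := by
    obtain ⟨Ψ, hzero, hΨ, hG⟩ := hμ.exists_greenFn_eq_radial lam0 C hy
    exact hμ.integrableOn_mulMeasure
      (hμ.integrableOn_of_radial (c := fun a => C a (valK π y)) hy hΨ hzero hG)
  green y hy φ hφ := by
    obtain ⟨N, hN, hφN⟩ := hμ.exists_constOnBalls hφ
    obtain ⟨Ψ, hzero, hΨ, hG⟩ := hμ.exists_greenFn_eq_radial lam0 C hy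
    rw [hμ.integral_mul_lap_of_lap_eq hy hφN
      (hμ.integrableOn_of_radial (c := fun a => C a (valK π y)) hy hΨ hzero hG)
      (hμ.constOnBalls_of_radial (c := fun a => C a (valK π y)) hN hG)
      fun x hx hxy => hμ.lap_greenFn hm hlam0 hC hx hy hxy, mul_sub, ← mul_assoc,
      one_div_mul_cancel (hμ.vol_pos hm).ne', one_mul]

end IsNormalizedHaar

end RadialFunctions

end GreenFunction

section Averaging

variable {X : Type*} [MeasurableSpace X] {ν : Measure X} {B : Set X} {g h F : X → ℝ}

open Classical in
/-- `g` with its values on `B` replaced by their average over `B`. Averaging a Green's function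
over a small ball around its pole produces a locally constant test function. -/
noncomputable def averageOn (ν : Measure X) (B : Set X) (g : X → ℝ) : X → ℝ :=
  B.piecewise (fun _ => ⨍ x in B, g x ∂ν) g

theorem averageOn_of_mem {x : X} (hx : x ∈ B) : averageOn ν B g x = ⨍ x in B, g x ∂ν :=
  if_pos hx

theorem averageOn_of_notMem {x : X} (hx : x ∉ B) : averageOn ν B g x = g x :=
  if_neg hx

theorem integrable_averageOn [IsFiniteMeasure ν] (hB : MeasurableSet B) (hg : Integrable g ν) :
    Integrable (averageOn ν B g) ν := by
  classical
  exact Integrable.piecewise hB (integrable_const _).integrableOn hg.integrableOn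

theorem integral_averageOn [IsFiniteMeasure ν] (hB : MeasurableSet B) (hg : Integrable g ν) :
    ∫ x, averageOn ν B g x ∂ν = ∫ x, g x ∂ν := by
  classical
  rw [averageOn, integral_piecewise hB (integrable_const _).integrableOn hg.integrableOn,
    setIntegral_setAverage, integral_add_compl hB hg]

theorem integral_mul_eq_average_sub_average [IsFiniteMeasure ν] (hB : MeasurableSet B) {a α : ℝ}
    (hF : F =ᵐ[ν] fun x => B.indicator (fun _ => a) x - α) (hF0 : ∫ x, F x ∂ν = 0)
    (hh : Integrable h ν) :
    ∫ x, h x * F x ∂ν = α * ν.real Set.univ * ((⨍ x in B, h x ∂ν) - ⨍ x, h x ∂ν) := by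
  have hmass : a * ν.real B = α * ν.real Set.univ := by
    rw [integral_congr_ae hF, integral_sub ((integrable_const a).indicator hB)
      (integrable_const α), integral_indicator_const a hB, integral_const, smul_eq_mul,
      smul_eq_mul] at hF0
    linarith
  calc ∫ x, h x * F x ∂ν = ∫ x, (B.indicator (fun x => a * h x) x - α * h x) ∂ν := by
        refine integral_congr_ae (hF.mono fun x hx => ?_)
        by_cases hxB : x ∈ B
        · simp only [hx, Set.indicator_of_mem hxB]
          ring
        · simp only [hx, Set.indicator_of_notMem hxB]
          ring
    _ = a * ∫ x in B, h x ∂ν - α * ∫ x, h x ∂ν := by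
        rw [integral_sub ((hh.const_mul a).indicator hB) (hh.const_mul α),
          integral_indicator hB, integral_const_mul, integral_const_mul]
    _ = α * ν.real Set.univ * ((⨍ x in B, h x ∂ν) - ⨍ x, h x ∂ν) := by
        rw [← measure_smul_setAverage h (measure_ne_top ν B), ← measure_smul_average ν h,
          smul_eq_mul, smul_eq_mul, ← mul_assoc, hmass]
        ring

theorem tendsto_setAverage_of_tendsto_smallSets {ι : Type*} [IsFiniteMeasure ν] {l : Filter X}
    {u : Filter ι} {S : ι → Set X} {b : ℝ} (hS : Tendsto S u l.smallSets)
    (hSν : ∀ᶠ i in u, ν (S i) ≠ 0) (hS_meas : ∀ i, MeasurableSet (S i)) (hh : Integrable h ν)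
    (hb : Tendsto h l (𝓝 b)) : Tendsto (fun i => ⨍ x in S i, h x ∂ν) u (𝓝 b) := by
  refine nhds_basis_closedBall.tendsto_right_iff.2 fun ε hε => ?_
  filter_upwards [tendsto_smallSets_iff.1 hS _ (hb (closedBall_mem_nhds b hε)), hSν] with i hi hi0
  exact (convex_closedBall b ε).set_average_mem isClosed_closedBall hi0 (measure_ne_top ν _)
    ((ae_restrict_mem (hS_meas i)).mono hi) hh.integrableOn

end Averaging

section Uniqueness

variable {p f : ℕ} [Fact p.Prime] {K : Type*} [NormedField K] [NormedAlgebra ℚ_[p] K]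
  [MeasurableSpace K] {π : K} {μ : Measure K} {q : ℝ} {m : ℕ} {lam0 : ℝ} {N : ℤ}
  {x y c : K} {g φ : K → ℝ} {G G₀ : K → K → ℝ}

theorem IsUniformizer.constOnBalls_lap (hπ : IsUniformizer π) (hN : m ≤ N)
    (hφ : ConstOnBalls π (domainE p π m) N φ) :
    ConstOnBalls π (domainE p π m) N (lap p f μ π m φ) := by
  have := hπ.isUltrametricDist
  intro x hx x' hx'
  have hlt : valK π x < N := (hπ.mem_domainE_iff.1 hx).2.2.trans_le hN
  have hφx := hφ x hx x' hx'
  have habs := absK_congr p f π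
    (hπ.norm_eq_of_mem_closedBall (hπ.ne_zero_of_mem_domainE hx) hlt hx')
  refine integral_congr_ae (.of_forall fun z => ?_)
  simp only [lapIntegrand, hφx, habs]
  by_cases hz : z ∈ closedBall x (‖π‖ ^ N)
  · simp only [hφ x hx z hz, sub_self, zero_div]
  · rw [absK_sub_comm p f π z x', absK_sub_comm p f π z x,
      absK_congr p f π (norm_sub_eq_of_mem_closedBall hz hx')]

theorem IsUniformizer.constOnBalls_averageOn (hπ : IsUniformizer π) {ν : Measure K}
    (hg : ConstOnBalls π (domainE p π m \ closedBall c (‖π‖ ^ N)) N g) :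
    ConstOnBalls π (domainE p π m) N (averageOn ν (closedBall c (‖π‖ ^ N)) g) := by
  have := hπ.isUltrametricDist
  intro x hx z hz
  have hiff : z ∈ closedBall c (‖π‖ ^ N) ↔ x ∈ closedBall c (‖π‖ ^ N) := by
    rw [mem_closedBall_comm (x := z), mem_closedBall_comm (x := x),
      IsUltrametricDist.closedBall_eq_of_mem hz]
  by_cases hxB : x ∈ closedBall c (‖π‖ ^ N)
  · rw [averageOn_of_mem hxB, averageOn_of_mem (hiff.2 hxB)]
  · rw [averageOn_of_notMem hxB, averageOn_of_notMem (mt hiff.1 hxB), hg x ⟨hx, hxB⟩ z hz]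

namespace IsNormalizedHaar

variable [BorelSpace K]

theorem lap_averageOn [IsUltrametricDist K] {r : ℝ}
    [IsFiniteMeasure (μ.restrict (domainE p π m))] (hx : x ∉ closedBall c r)
    (hg : IntegrableOn g (domainE p π m) μ)
    (hlap : IntegrableOn (lapIntegrand p f π g x) (domainE p π m) μ) :
    lap p f μ π m (averageOn (μ.restrict (domainE p π m)) (closedBall c r) g) x =
      lap p f μ π m g x := by
  set G := averageOn (μ.restrict (domainE p π m)) (closedBall c r) g
  set κ : ℝ := (absK p f π (c - x) ^ 2)⁻¹ * absK p f π x
  have hG {z : K} (hz : z ∉ closedBall c r) : G z = g z := averageOn_of_notMem hz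
  have hG_int : IntegrableOn G (domainE p π m) μ := integrable_averageOn measurableSet_closedBall hg
  have hdiff : IntegrableOn (fun z => G z - g z) (domainE p π m) μ := hG_int.sub hg
  have hintegrand (z : K) :
      lapIntegrand p f π G x z = lapIntegrand p f π g x z + (G z - g z) * κ := by
    by_cases hz : z ∈ closedBall c r
    · simp only [lapIntegrand, hG hx, absK_congr p f π (norm_sub_eq_of_mem_closedBall hx hz), κ]
      ring
    · simp only [lapIntegrand, hG hx, hG hz, sub_self, zero_mul, add_zero]
  simp only [lap, hintegrand]
  rw [integral_add hlap (hdiff.mul_const κ), integral_mul_const, integral_sub hG_int hg,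
    integral_averageOn measurableSet_closedBall hg, sub_self, zero_mul, add_zero]

variable [ProperSpace K]

theorem isFiniteMeasure_mulMeasure_restrict_domainE (hμ : IsNormalizedHaar p f π μ q) :
    IsFiniteMeasure ((mulMeasure p f μ π).restrict (domainE p π m)) :=
  have := hμ.isFiniteMeasure_restrict_domainE (m := m)
  (integrable_const_iff_isFiniteMeasure one_ne_zero).1
    (hμ.integrableOn_mulMeasure (integrable_const (1 : ℝ)))

/-- The test function is `G(·, c)` averaged over the ball around its pole: its Laplacian is
constant on that ball, equals `-1/V` off it, and has mean zero. -/
theorem exists_integral_mul_lap_eq (hμ : IsNormalizedHaar p f π μ q) (hm : 0 < m)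
    (hc : c ∈ domainE p π m) (hN : m ≤ N) :
    ∃ φ : K → ℝ, (IsLocallyConstant fun x : domainE p π m => φ x) ∧
      ∀ h : K → ℝ, IntegrableOn h (domainE p π m) (mulMeasure p f μ π) →
        ∫ x in domainE p π m, h x * lap p f μ π m φ x ∂(mulMeasure p f μ π) =
          (⨍ x in closedBall c (‖π‖ ^ N), h x ∂((mulMeasure p f μ π).restrict (domainE p π m))) -
            ⨍ x in domainE p π m, h x ∂(mulMeasure p f μ π) := by
  have := hμ.isUltrametricDist
  have := hμ.isFiniteMeasure_restrict_domainE (m := m) (p := p)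
  have := hμ.isFiniteMeasure_mulMeasure_restrict_domainE (m := m)
  obtain ⟨C, hC, -⟩ := exists_isRecurrent p f hm 0
  set g : K → ℝ := fun x => greenFn p f π m (q * (q - 1) / (q + 1)) C x c
  set B := closedBall c (‖π‖ ^ N)
  obtain ⟨Ψ, hzero, hΨ, hG⟩ := hμ.exists_greenFn_eq_radial (q * (q - 1) / (q + 1)) C hc
  have hg : IntegrableOn g (domainE p π m) μ :=
    hμ.integrableOn_of_radial (c := fun a => C a (valK π c)) hc hΨ hzero hG
  have hφ : ConstOnBalls π (domainE p π m) N (averageOn (μ.restrict (domainE p π m)) B g) :=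
    hμ.constOnBalls_averageOn (hμ.constOnBalls_of_radial (c := fun a => C a (valK π c)) hN hG)
  set φ := averageOn (μ.restrict (domainE p π m)) B g
  have hoff {x : K} (hx : x ∈ domainE p π m) (hxB : x ∉ B) :
      lap p f μ π m φ x = -(1 / vol p f μ π m) := by
    have hxc : x ≠ c := by
      rintro rfl
      exact hxB (mem_closedBall_self (zpow_pos hμ.norm_pos N).le)
    rw [lap_averageOn hxB hg (hμ.lap_BKm_add _ C hx hc hxc).1,
      hμ.lap_greenFn hm rfl hC hx hc hxc]
  have hlap : lap p f μ π m φ =ᵐ[(mulMeasure p f μ π).restrict (domainE p π m)] fun x =>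
      B.indicator (fun _ => lap p f μ π m φ c + 1 / vol p f μ π m) x - 1 / vol p f μ π m := by
    filter_upwards [ae_restrict_mem hμ.measurableSet_domainE] with x hx
    by_cases hxB : x ∈ B
    · rw [Set.indicator_of_mem hxB, hμ.constOnBalls_lap hN hφ c hc x hxB, add_sub_cancel_right]
    · rw [Set.indicator_of_notMem hxB, hoff hx hxB, zero_sub]
  refine ⟨φ, hμ.isLocallyConstant_of_constOnBalls hφ, fun h hh => ?_⟩
  rw [integral_mul_eq_average_sub_average measurableSet_closedBall hlap
    (hμ.integral_lap_eq_zero hφ) hh, measureReal_restrict_apply_univ, measureReal_def, ← vol,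
    one_div_mul_cancel (hμ.vol_pos hm).ne', one_mul]

theorem tendsto_setAverage_of_isSymmGreen (hμ : IsNormalizedHaar p f π μ q)
    (hG : IsSymmGreen p f μ π m G) (hc : c ∈ domainE p π m) (hy : y ∈ domainE p π m)
    (hcy : c ≠ y) :
    Tendsto (fun n : ℕ => ⨍ x in closedBall c (‖π‖ ^ (n : ℤ)), G x y
      ∂((mulMeasure p f μ π).restrict (domainE p π m))) atTop (𝓝 (G c y)) := by
  have := hμ.isFiniteMeasure_mulMeasure_restrict_domainE (m := m)
  have hE := hμ.domainE_mem_nhds hc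
  have hballs : Tendsto (fun n : ℕ => closedBall c (‖π‖ ^ (n : ℤ))) atTop (𝓝 c).smallSets := by
    simp only [zpow_natCast]
    exact (tendsto_closedBall_smallSets c).comp
      (tendsto_pow_atTop_nhds_zero_of_lt_one hμ.norm_pos.le hμ.norm_lt_one)
  refine tendsto_setAverage_of_tendsto_smallSets hballs ?_
    (fun _ => measurableSet_closedBall) (hG.integrableOn y hy)
    ((hG.continuousOn y hy).continuousAt (inter_mem hE (isOpen_ne.mem_nhds hcy)))
  filter_upwards [tendsto_smallSets_iff.1 hballs _ hE] with n hn
  rw [Measure.restrict_apply measurableSet_closedBall, Set.inter_eq_left.2 hn]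
  exact hμ.mulMeasure_closedBall_ne_zero c n

theorem sub_average_eq_of_isSymmGreen (hμ : IsNormalizedHaar p f π μ q) (hm : 0 < m)
    (hG : IsSymmGreen p f μ π m G) (hG₀ : IsSymmGreen p f μ π m G₀) (hc : c ∈ domainE p π m)
    (hy : y ∈ domainE p π m) (hcy : c ≠ y) :
    G c y - ⨍ x in domainE p π m, G x y ∂(mulMeasure p f μ π) =
      G₀ c y - ⨍ x in domainE p π m, G₀ x y ∂(mulMeasure p f μ π) := by
  refine tendsto_nhds_unique_of_eventuallyEq
    ((hμ.tendsto_setAverage_of_isSymmGreen hG hc hy hcy).sub_const _)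
    ((hμ.tendsto_setAverage_of_isSymmGreen hG₀ hc hy hcy).sub_const _) ?_
  filter_upwards [eventually_ge_atTop m] with n hn
  obtain ⟨φ, hφ, hint⟩ := hμ.exists_integral_mul_lap_eq hm hc (Nat.cast_le.2 hn)
  rw [← hint _ (hG.integrableOn y hy), ← hint _ (hG₀.integrableOn y hy), hG.green y hy φ hφ,
    hG₀.green y hy φ hφ]

theorem exists_eq_add_of_isSymmGreen (hμ : IsNormalizedHaar p f π μ q) (hm : 0 < m)
    (hG : IsSymmGreen p f μ π m G) (hG₀ : IsSymmGreen p f μ π m G₀) :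
    ∃ k : ℝ, ∀ x ∈ domainE p π m, ∀ y ∈ domainE p π m, x ≠ y → G x y = G₀ x y + k := by
  set κ : K → ℝ := fun y => (⨍ x in domainE p π m, G x y ∂(mulMeasure p f μ π)) -
    ⨍ x in domainE p π m, G₀ x y ∂(mulMeasure p f μ π)
  have hκ {x y : K} (hx : x ∈ domainE p π m) (hy : y ∈ domainE p π m) (hxy : x ≠ y) :
      G x y = G₀ x y + κ y := by
    linarith [hμ.sub_average_eq_of_isSymmGreen hm hG hG₀ hx hy hxy]
  have hone : (1 : K) ∈ domainE p π m := ⟨0, hm, 1, by simp⟩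
  refine ⟨κ 1, fun x hx y hy hxy => ?_⟩
  obtain rfl | hy1 := eq_or_ne y 1
  · exact hκ hx hy hxy
  · linarith [hκ hx hy hxy, hκ hy hone hy1, hκ hone hy hy1.symm, hG.symm 1 hone y hy,
      hG₀.symm 1 hone y hy]

theorem isSymmGreen_iff (hμ : IsNormalizedHaar p f π μ q) (hm : 0 < m)
    (hlam0 : lam0 = q * (q - 1) / (q + 1)) (G : K → K → ℝ) :
    IsSymmGreen p f μ π m G ↔ ∃ C : ℤ → ℤ → ℝ, IsRecurrent p f m C ∧
      ∀ x ∈ domainE p π m, ∀ y ∈ domainE p π m, x ≠ y →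
        G x y = BKm p f π m lam0 x y + C (valK π x) (valK π y) := by
  constructor
  · intro hG
    obtain ⟨C, hC, -⟩ := exists_isRecurrent p f hm 0
    obtain ⟨k, hk⟩ := hμ.exists_eq_add_of_isSymmGreen hm hG (hμ.isSymmGreen_greenFn hm hlam0 hC)
    refine ⟨fun a r => C a r + k, hC.add_const (fun a h0 h1 => ?_) k, fun x hx y hy hxy => ?_⟩
    · rw [Lam_eq_kernelMass hμ.pow_eq hμ.q_pos h0 h1]
      exact (kernelMass_pos hμ.one_lt hm _).ne'
    · rw [hk x hx y hy hxy, greenFn, add_assoc]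
  · rintro ⟨C, hC, hG⟩
    exact hμ.isSymmGreen_congr (hμ.isSymmGreen_greenFn hm hlam0 hC) hG

end IsNormalizedHaar

end Uniqueness

end TateGreen

theorem mainTheorem6 (p : ℕ) [Fact p.Prime] (K : Type*) [NormedField K] [NormedAlgebra ℚ_[p] K]
    [FiniteDimensional ℚ_[p] K] [MeasurableSpace K] [BorelSpace K]
    (f : ℕ) (hf : Nat.card (IsLocalRing.ResidueField (TateGreen.ringOfIntegers p K)) = p ^ f)
    (ϖ : TateGreen.ringOfIntegers p K) (hϖ : Irreducible ϖ)
    (μ : Measure K) [μ.IsAddHaarMeasure] (hμ : μ (TateGreen.ringOfIntegers p K : Set K) = 1)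
    (m : ℕ) (hm : 0 < m) :
    -- the coefficients of the series are forced by independence of `|x - y|`
    (∀ (lam0 : ℝ) (A : K → ℝ) (lam : ℕ → K → ℝ),
      (∀ y ∈ TateGreen.domainE p (ϖ : K) m, Summable fun n : ℕ => |lam (n + 1) y|) →
      ((∀ x ∈ TateGreen.domainE p (ϖ : K) m, ∀ y ∈ TateGreen.domainE p (ϖ : K) m,
          ∀ x' ∈ TateGreen.domainE p (ϖ : K) m, ∀ y' ∈ TateGreen.domainE p (ϖ : K) m,
          x ≠ y → x' ≠ y' → TateGreen.valK (ϖ : K) x = TateGreen.valK (ϖ : K) x' →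
          TateGreen.valK (ϖ : K) y = TateGreen.valK (ϖ : K) y' →
          TateGreen.lap p f μ (ϖ : K) m
              (fun z => TateGreen.logSeries p f (ϖ : K) lam0 A lam z y) x =
            TateGreen.lap p f μ (ϖ : K) m
              (fun z => TateGreen.logSeries p f (ϖ : K) lam0 A lam z y') x') ↔
        ∀ y ∈ TateGreen.domainE p (ϖ : K) m, ∀ n : ℕ, 1 ≤ n →
          lam n y = TateGreen.UK p f (ϖ : K) m y ^ n *
            (((p : ℝ) ^ (f * (n + 1)) - 1) /
              (((p : ℝ) ^ f - 1) * ((p : ℝ) ^ f + 1) ^ n * ((p : ℝ) ^ (f * n) - 1))) * lam0)) ∧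
    -- these coefficients are summable, and the value of `D B` off the diagonal
    (∀ lam0 : ℝ, ∀ y ∈ TateGreen.domainE p (ϖ : K) m,
      (Summable fun n : ℕ => |TateGreen.lambdaK p f (ϖ : K) m lam0 (n + 1) y|) ∧
      ∀ x ∈ TateGreen.domainE p (ϖ : K) m, x ≠ y →
        IntegrableOn
          (TateGreen.lapIntegrand p f (ϖ : K)
            (fun z => TateGreen.BKm p f (ϖ : K) m lam0 z y) x)
          (TateGreen.domainE p (ϖ : K) m) μ ∧
        TateGreen.lap p f μ (ϖ : K) m (fun z => TateGreen.BKm p f (ϖ : K) m lam0 z y) x =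
          -lam0 *
            ((p : ℝ) ^ (-((f : ℤ) * |TateGreen.valK (ϖ : K) x - TateGreen.valK (ϖ : K) y|)) /
              ((p : ℝ) ^ f - 1)) *
            (((p : ℝ) ^ f + 1) / ((p : ℝ) ^ f + 1 - TateGreen.UK p f (ϖ : K) m y))) ∧
    -- the value of `λ₀`
    (∀ lam0 : ℝ,
      (∃ C : ℤ → ℤ → ℝ, ∀ x ∈ TateGreen.domainE p (ϖ : K) m,
        ∀ y ∈ TateGreen.domainE p (ϖ : K) m, x ≠ y →
          TateGreen.lap p f μ (ϖ : K) m
              (fun z => TateGreen.BKm p f (ϖ : K) m lam0 z y +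
                C (TateGreen.valK (ϖ : K) z) (TateGreen.valK (ϖ : K) y)) x =
            -(1 / TateGreen.vol p f μ (ϖ : K) m)) ↔
      lam0 = (p : ℝ) ^ f * ((p : ℝ) ^ f - 1) / ((p : ℝ) ^ f + 1)) ∧
    (∀ lam0 : ℝ, lam0 = (p : ℝ) ^ f * ((p : ℝ) ^ f - 1) / ((p : ℝ) ^ f + 1) →
      -- the symmetrized `C` is exactly the one given by the recurrence
      (∀ C : ℤ → ℤ → ℝ,
        ((∀ q r : ℤ, 0 ≤ q → q ≤ (m : ℤ) - 1 → 0 ≤ r → r ≤ (m : ℤ) - 1 → C q r = C r q) ∧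
          (∀ x ∈ TateGreen.domainE p (ϖ : K) m, ∀ y ∈ TateGreen.domainE p (ϖ : K) m, x ≠ y →
            TateGreen.lap p f μ (ϖ : K) m
                (fun z => TateGreen.BKm p f (ϖ : K) m lam0 z y +
                  C (TateGreen.valK (ϖ : K) z) (TateGreen.valK (ϖ : K) y)) x =
              -(1 / TateGreen.vol p f μ (ϖ : K) m))) ↔
        TateGreen.IsRecurrent p f m C) ∧
      -- the value `C (m - 1) 0` is arbitrary
      (∀ c : ℝ, ∃ C : ℤ → ℤ → ℝ, TateGreen.IsRecurrent p f m C ∧ C ((m : ℤ) - 1) 0 = c) ∧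
      -- the symmetric Green's functions are exactly the functions `B + C`
      (∀ G : K → K → ℝ,
        (TateGreen.IsSymmGreen p f μ (ϖ : K) m G ↔
          ∃ C : ℤ → ℤ → ℝ, TateGreen.IsRecurrent p f m C ∧
            ∀ x ∈ TateGreen.domainE p (ϖ : K) m, ∀ y ∈ TateGreen.domainE p (ϖ : K) m, x ≠ y →
              G x y = TateGreen.BKm p f (ϖ : K) m lam0 x y +
                C (TateGreen.valK (ϖ : K) x) (TateGreen.valK (ϖ : K) y)))) := by
  have : ProperSpace K := FiniteDimensional.proper ℚ_[p] K
  have hG := TateGreen.isNormalizedHaar_of_irreducible hf hϖ hμ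
  refine ⟨fun lam0 A lam hlam => hG.lap_logSeries_congr_valK_iff A fun y hy => (hlam y hy).of_abs,
    fun lam0 y hy => ⟨(hG.summable_lambdaK lam0 hy).abs, fun x hx hxy => ?_⟩,
    fun lam0 => hG.exists_lap_BKm_add_eq_iff hm,
    fun lam0 hlam0 => ⟨hG.symm_and_lap_iff_isRecurrent hm hlam0,
      TateGreen.exists_isRecurrent p f hm, hG.isSymmGreen_iff hm hlam0⟩⟩
  obtain ⟨hint, hlap⟩ := hG.lap_BKm lam0 hx hy hxy
  refine ⟨hint, hlap.trans ?_⟩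
  rw [← mul_neg, zpow_mul, zpow_natCast]
  ring
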